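/- Let $d\ge 2$, let $\Omega\subset\mathbb R^d$ be open and bounded, and let $g_0(s)=\sum_{i=0}^N a_i s^{\alpha_i}$ ($s\ge 0$) with $N\ge 1$, real exponents $0=\alpha_0<\alpha_1<\dots<\alpha_N$ and coefficients $a_i\ge 0$, $a_0>0$, $a_N>0$. For $\xi\ge 0$ put $K(\xi)=1/g_0(s(\xi))$, where $s(\xi)\ge 0$ is the unique nonnegative solution of $s\,g_0(s)=\xi$. Put $$a=\frac{\alpha_N}{\alpha_N+1},\qquad \beta=2-a,\qquad \lambda=\frac{\beta}{\beta-1},$$ and assume the degree condition $a\le \frac{4}{d+2}$. Write $(\cdot,\cdot)$ and $\|\cdot\|$ for the inner product and norm of $L^2(\Omega)$, $\|\cdot\|_{0,\beta}$ for the norm of $L^\beta(\Omega)$ and $\|\cdot\|_1$ for the norm of $H^1(\Omega)$. Let $\mathcal T_h$ be a subdivision of $\Omega$ into finitely many elements of maximal diameter $h$ which is quasiuniform with constant $\sigma>0$: the elements are nonempty, open and pairwise disjoint, they fill $\Omega$ up to a null set, and each of them is star-shaped with respect to every point of some ball of radius $\sigma h$ contained in it (for instance a quasiuniform triangulation). Let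 $W_h$ be the space of discontinuous piecewise polynomials of degree at most $r\ge 0$ over $\mathcal T_h$, with gradients taken element by element, and let $\pi$ be the $L^2(\Omega)$-projection onto $W_h$. Let the data be $f(t)\in L^2(\Omega)$ for $t\ge 0$, $\rho^0\in H^1(\Omega)$, and $\phi(t)\in H^1(\Omega)$ for $t\ge0$ (an extension to $\Omega$ of the Dirichlet data), differentiable on $[0,\infty)$ as a curve in $L^2(\Omega)$ with $\phi_t(t)\in H^1(\Omega)$ and $\|\phi_t\|_1^2$ locally integrable on $[0,\infty)$. Put $\phi^0=\phi(0)$, $\tilde f=f-\phi_t$ and $$g(t)=\|\tilde f(t)\|^{\lambda}+\|\phi(t)\|_1^2 .$$ Let $\tilde\rho_h=\rho_h-\pi\phi:[0,\infty)\to W_h$ be a solution of the semidiscrete problem, that is, $\tilde\rho_h$ is continuous at $0$, differentiable for $t>0$, $\tilde\rho_h(0)=\pi(\rho^0-\phi^0)$, and for all $t>0$ $$(\tilde\rho_{h,t},w_h)+(K(|\nabla\rho_h|)\nabla\rho_h,\nabla w_h)=(\tilde f,w_h)\qquad\text{for all } w_h\in W_h .$$ Then there is a constant $C>0$, depending only on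 $g_0$, $d$, $\Omega$, $r$ and $\sigma$ (in particular not on $h$, $\mathcal T_h$, the data or the solution), such that the following hold. (i) For every continuous increasing function $\mathrm{Env}\,g\ge g$ on $[0,\infty)$ and all $t\ge 0$, $$\|\nabla\rho_h(t)\|_{0,\beta}^{\beta}\le C\Big(1+\|\rho^0\|_1^2+\|\phi^0\|^2+\int_0^t e^{-\frac12(t-s)}\big(\|\phi_t(s)\|_1^2+(\mathrm{Env}\,g(s))^{2/\beta}\big)\,ds\Big).$$ (ii) In $[0,\infty]$, $$\limsup_{t\to\infty}\|\nabla\rho_h(t)\|_{0,\beta}^{\beta}\le C\Big(1+\limsup_{t\to\infty}\|\phi_t(t)\|_1^2+\big(\limsup_{t\to\infty}g(t)\big)^{2/\beta}\Big).$$ (iii) If $\limsup_{t\to\infty}\|\tilde f(t)\|=\limsup_{t\to\infty}\|\phi(t)\|_1=\limsup_{t\to\infty}\|\phi_t(t)\|_1=0$, then $\limsup_{t\to\infty}\|\nabla\rho_h(t)\|_{0,\beta}=0$. -/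

import Mathlib

open MeasureTheory Set Filter Topology
open scoped ContDiff

noncomputable section

namespace Forchheimer

/-! ### The generalized polynomial `g`, the function `K`, the exponents -/

/-- Generalized polynomial `g(s) = a₀ s^{α₀} + ⋯ + a_N s^{α_N}` with
`α₀ = 0 < α₁ < ⋯ < α_N` real, all `aᵢ ≥ 0`, `a₀ > 0`, `a_N > 0`. -/
structure GenPoly (N : ℕ) where
  coeff : Fin (N + 1) → ℝ
  expo : Fin (N + 1) → ℝ
  expo_zero : expo 0 = 0
  expo_strictMono : StrictMono expo
  coeff_nonneg : ∀ i, 0 ≤ coeff i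
  coeff_zero_pos : 0 < coeff 0
  coeff_last_pos : 0 < coeff (Fin.last N)

namespace GenPoly

variable {N : ℕ} (P : GenPoly N)

/-- The value `g(s)`, for `s ≥ 0`. -/
def eval (s : ℝ) : ℝ := ∑ i, P.coeff i * s ^ P.expo i

/-- `deg g = α_N`. -/
def deg : ℝ := P.expo (Fin.last N)

/-- `a = α_N / (α_N + 1)`. -/
def a : ℝ := P.deg / (P.deg + 1)

/-- `β = 2 - a`. -/
def β : ℝ := 2 - P.a

/-- `λ = β / (β - 1) = (2 - a) / (1 - a)`. -/
def lam : ℝ := P.β / (P.β - 1)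

/-- `s(ξ)`: the unique `s ≥ 0` with `s g(s) = ξ` (see `existsUnique_root`). -/
def root (ξ : ℝ) : ℝ := Classical.epsilon fun s : ℝ => 0 ≤ s ∧ s * P.eval s = ξ

/-- `K(ξ) = 1 / g(s(ξ))`, for `ξ ≥ 0`. -/
def K (ξ : ℝ) : ℝ := 1 / P.eval (P.root ξ)

theorem expo_nonneg (i : Fin (N + 1)) : 0 ≤ P.expo i := by
  rw [← P.expo_zero]
  exact P.expo_strictMono.monotone (Fin.zero_le i)

theorem eval_mono {s t : ℝ} (hs : 0 ≤ s) (hst : s ≤ t) : P.eval s ≤ P.eval t := by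
  unfold eval
  exact Finset.sum_le_sum fun i _ => mul_le_mul_of_nonneg_left
    (Real.rpow_le_rpow hs hst (P.expo_nonneg i)) (P.coeff_nonneg i)

theorem coeff_zero_le_eval {s : ℝ} (hs : 0 ≤ s) : P.coeff 0 ≤ P.eval s := by
  have h := Finset.single_le_sum (f := fun i => P.coeff i * s ^ P.expo i)
    (fun i _ => mul_nonneg (P.coeff_nonneg i) (Real.rpow_nonneg hs _)) (Finset.mem_univ 0)
  simpa [eval, P.expo_zero] using h

theorem continuous_eval : Continuous P.eval := by
  unfold eval
  exact continuous_finsetSum _ fun i _ =>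
    continuous_const.mul (Real.continuous_rpow_const (P.expo_nonneg i))

theorem existsUnique_root {ξ : ℝ} (hξ : 0 ≤ ξ) : ∃! s : ℝ, 0 ≤ s ∧ s * P.eval s = ξ := by
  have h0 := P.coeff_zero_pos
  have hle : 0 ≤ ξ / P.coeff 0 := by positivity
  have hc : ContinuousOn (fun s => s * P.eval s) (Icc 0 (ξ / P.coeff 0)) :=
    (continuous_id.mul P.continuous_eval).continuousOn
  have hmem : ξ ∈ Icc ((0 : ℝ) * P.eval 0) (ξ / P.coeff 0 * P.eval (ξ / P.coeff 0)) := by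
    refine ⟨by simpa using hξ, ?_⟩
    calc ξ = ξ / P.coeff 0 * P.coeff 0 := by field_simp
      _ ≤ _ := mul_le_mul_of_nonneg_left (P.coeff_zero_le_eval hle) hle
  obtain ⟨s, hs, hs'⟩ := intermediate_value_Icc hle hc hmem
  refine ⟨s, ⟨hs.1, hs'⟩, ?_⟩
  have key : ∀ u v : ℝ, 0 ≤ u → u < v → u * P.eval u < v * P.eval v := fun u v hu huv =>
    by
      have h1 : u * P.eval u ≤ u * P.eval v :=
        mul_le_mul_of_nonneg_left (P.eval_mono hu huv.le) hu
      have h2 : 0 < P.eval v := h0.trans_le (P.coeff_zero_le_eval (hu.trans huv.le))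
      have h3 : u * P.eval v < v * P.eval v := mul_lt_mul_of_pos_right huv h2
      linarith
  rintro t ⟨ht, ht'⟩
  rcases lt_trichotomy t s with h | h | h
  · have := key t s ht h
    simp only at hs'
    linarith
  · exact h
  · have := key s t hs.1 h
    simp only at hs'
    linarith

theorem root_spec {ξ : ℝ} (hξ : 0 ≤ ξ) : 0 ≤ P.root ξ ∧ P.root ξ * P.eval (P.root ξ) = ξ :=
  Classical.epsilon_spec (P.existsUnique_root hξ).exists

end GenPoly

/-! ### Norms on `Ω` and the Sobolev space `H¹(Ω)` -/

variable {d : ℕ}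

/-- `‖u‖ = ‖u‖_{L²(Ω)}`. -/
def l2Norm (Ω : Set (EuclideanSpace ℝ (Fin d))) (u : EuclideanSpace ℝ (Fin d) → ℝ) : ℝ :=
  lpNorm u 2 (volume.restrict Ω)

/-- `G` is the weak gradient of `u` in `Ω`: `∫_Ω u ∂ᵢη = - ∫_Ω Gᵢ η` for all `i` and all
test functions `η ∈ C_c^∞(Ω)`. -/
def HasWeakGradient (Ω : Set (EuclideanSpace ℝ (Fin d))) (u : EuclideanSpace ℝ (Fin d) → ℝ)
    (G : EuclideanSpace ℝ (Fin d) → EuclideanSpace ℝ (Fin d)) : Prop :=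
  ∀ η : EuclideanSpace ℝ (Fin d) → ℝ, ContDiff ℝ ∞ η → HasCompactSupport η → tsupport η ⊆ Ω →
    ∀ i : Fin d, ∫ x in Ω, u x * gradient η x i = - ∫ x in Ω, G x i * η x

/-- `u ∈ H¹(Ω)`. -/
def MemH1 (Ω : Set (EuclideanSpace ℝ (Fin d))) (u : EuclideanSpace ℝ (Fin d) → ℝ) : Prop :=
  MemLp u 2 (volume.restrict Ω) ∧
    ∃ G, MemLp G 2 (volume.restrict Ω) ∧ HasWeakGradient Ω u G

open Classical in
/-- The weak gradient of `u ∈ H¹(Ω)` (unique up to a null set). -/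
def weakGradient (Ω : Set (EuclideanSpace ℝ (Fin d))) (u : EuclideanSpace ℝ (Fin d) → ℝ) :
    EuclideanSpace ℝ (Fin d) → EuclideanSpace ℝ (Fin d) :=
  if h : ∃ G, MemLp G 2 (volume.restrict Ω) ∧ HasWeakGradient Ω u G then h.choose else 0

/-- `‖u‖₁ = (‖u‖² + ∑ᵢ ‖∂ᵢ u‖²)^{1/2}`, for `u ∈ H¹(Ω)`. -/
def h1Norm (Ω : Set (EuclideanSpace ℝ (Fin d))) (u : EuclideanSpace ℝ (Fin d) → ℝ) : ℝ :=
  √(l2Norm Ω u ^ 2 + lpNorm (weakGradient Ω u) 2 (volume.restrict Ω) ^ 2)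

/-- `v` is the derivative at time `t` of the curve `u : [0, ∞) → L²(Ω)`
(one-sided at `t = 0`). -/
def HasL2TimeDeriv (Ω : Set (EuclideanSpace ℝ (Fin d)))
    (u : ℝ → EuclideanSpace ℝ (Fin d) → ℝ) (v : EuclideanSpace ℝ (Fin d) → ℝ) (t : ℝ) : Prop :=
  Tendsto (fun s => eLpNorm (fun x => (s - t)⁻¹ * (u s x - u t x) - v x) 2 (volume.restrict Ω))
    (𝓝[Ici 0 \ {t}] t) (𝓝 0)

/-! ### Meshes and discontinuous piecewise polynomials -/

/-- `𝒯` is a subdivision of `Ω` of mesh size `h` (the maximum of the diameters of the elements)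
which is quasiuniform with constant `σ`. The elements are represented by their interiors: they are
nonempty, open, pairwise disjoint and fill `Ω` up to a null set, and each of them is star-shaped
with respect to all points of some ball of radius `σ h`. Simplices (straight, or with curved faces
along the boundary of `Ω`) are the typical elements. -/
structure IsQuasiUniformMesh (Ω : Set (EuclideanSpace ℝ (Fin d))) (σ h : ℝ)
    (𝒯 : Finset (Set (EuclideanSpace ℝ (Fin d)))) : Prop where
  isOpen : ∀ T ∈ 𝒯, IsOpen T
  nonempty : ∀ T ∈ 𝒯, T.Nonempty
  subset : ∀ T ∈ 𝒯, T ⊆ Ω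
  disjoint : ∀ T ∈ 𝒯, ∀ T' ∈ 𝒯, T ≠ T' → Disjoint T T'
  cover : volume (Ω \ ⋃ T ∈ 𝒯, T) = 0
  size : IsGreatest {δ | ∃ T ∈ 𝒯, δ = Metric.diam T} h
  star : ∀ T ∈ 𝒯, ∃ x₀, ∀ y ∈ Metric.ball x₀ (σ * h), y ∈ T ∧ StarConvex ℝ y T

/-- The space `W_h` of discontinuous piecewise polynomials of degree at most `r` over `𝒯`.
The values on the null set outside the (open) elements are irrelevant. The gradient of
`w ∈ W_h` is taken element by element, so it is the classical `gradient w x` at every `x` in an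
element, hence at almost every point of the domain. -/
def feSpace (𝒯 : Finset (Set (EuclideanSpace ℝ (Fin d)))) (r : ℕ) :
    Set (EuclideanSpace ℝ (Fin d) → ℝ) :=
  {w | ∀ T ∈ 𝒯, ∃ p : MvPolynomial (Fin d) ℝ, p.totalDegree ≤ r ∧
    ∀ x ∈ T, w x = MvPolynomial.eval (fun i => x i) p}

/-- `p = π u`, the `L²(Ω)`-projection of `u` on `W_h`. -/
def IsL2Projection (Ω : Set (EuclideanSpace ℝ (Fin d)))
    (𝒯 : Finset (Set (EuclideanSpace ℝ (Fin d)))) (r : ℕ)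
    (u p : EuclideanSpace ℝ (Fin d) → ℝ) : Prop :=
  p ∈ feSpace 𝒯 r ∧ ∀ v ∈ feSpace 𝒯 r, ∫ x in Ω, p x * v x = ∫ x in Ω, u x * v x

/-! ### The semidiscrete problem -/

/-- Admissible data: source `f(t) ∈ L²(Ω)`, extension `φ(t) ∈ H¹(Ω)` of the Dirichlet data with
time derivative `φt(t) ∈ H¹(Ω)`, `‖φt‖₁²` locally integrable on `[0, ∞)`, and initial
density `ρ0 ∈ H¹(Ω)`. -/
structure IsData (Ω : Set (EuclideanSpace ℝ (Fin d)))
    (f φ φt : ℝ → EuclideanSpace ℝ (Fin d) → ℝ) (ρ0 : EuclideanSpace ℝ (Fin d) → ℝ) : Prop where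
  f_mem : ∀ t, 0 ≤ t → MemLp (f t) 2 (volume.restrict Ω)
  φ_mem : ∀ t, 0 ≤ t → MemH1 Ω (φ t)
  φt_mem : ∀ t, 0 ≤ t → MemH1 Ω (φt t)
  φ_deriv : ∀ t, 0 ≤ t → HasL2TimeDeriv Ω φ (φt t) t
  φt_int : ∀ t, 0 ≤ t → IntervalIntegrable (fun s => h1Norm Ω (φt s) ^ 2) volume 0 t
  ρ0_mem : MemH1 Ω ρ0

/-- The shifted source `f̃ = f - φ_t`. -/
def ftilde (f φt : ℝ → EuclideanSpace ℝ (Fin d) → ℝ) (t : ℝ) (x : EuclideanSpace ℝ (Fin d)) : ℝ :=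
  f t x - φt t x

/-- The semidiscrete problem. Here `ρt = ρ̃_h`, `πφ t` is the projection of `φ t`, and
`ρ_h = ρ̃_h + π φ`; the equation
`(ρ̃_{h,t}, w) + (K(|∇ρ_h|) ∇ρ_h, ∇w) = (f̃, w)` holds for all `w ∈ W_h` and `t > 0`, the curve
`ρ̃_h` is continuous at `t = 0`, and `ρ̃_h(0) = π(ρ⁰ - φ(0))`. -/
structure IsSemidiscreteSolution {N : ℕ} (P : GenPoly N) (Ω : Set (EuclideanSpace ℝ (Fin d)))
    (𝒯 : Finset (Set (EuclideanSpace ℝ (Fin d)))) (r : ℕ)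
    (f φ φt : ℝ → EuclideanSpace ℝ (Fin d) → ℝ) (ρ0 : EuclideanSpace ℝ (Fin d) → ℝ)
    (πφ ρt : ℝ → EuclideanSpace ℝ (Fin d) → ℝ) : Prop where
  proj : ∀ t, 0 ≤ t → IsL2Projection Ω 𝒯 r (φ t) (πφ t)
  mem : ∀ t, 0 ≤ t → ρt t ∈ feSpace 𝒯 r
  eqn : ∀ t, 0 < t → ∃ v ∈ feSpace 𝒯 r, HasL2TimeDeriv Ω ρt v t ∧
    ∀ w ∈ feSpace 𝒯 r,
      (∫ x in Ω, v x * w x) +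
        (∫ x in Ω, P.K ‖gradient (ρt t + πφ t) x‖ *
          inner ℝ (gradient (ρt t + πφ t) x) (gradient w x)) =
      ∫ x in Ω, ftilde f φt t x * w x
  cont_zero : Tendsto (fun t => eLpNorm (ρt t - ρt 0) 2 (volume.restrict Ω)) (𝓝[>] 0) (𝓝 0)
  init : IsL2Projection Ω 𝒯 r (ρ0 - φ 0) (ρt 0)

/-- `‖∇ρ‖_{0,β}^β` on `Ω`, with the gradient taken element by element. -/
def gradEnergy (Ω : Set (EuclideanSpace ℝ (Fin d))) (β : ℝ)
    (ρ : EuclideanSpace ℝ (Fin d) → ℝ) : ℝ :=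
  lpNorm (gradient ρ) (ENNReal.ofReal β) (volume.restrict Ω) ^ β

/-- `g(t) = ‖f̃(t)‖^λ + ‖φ(t)‖₁²`. -/
def gData {N : ℕ} (P : GenPoly N) (Ω : Set (EuclideanSpace ℝ (Fin d)))
    (f φ φt : ℝ → EuclideanSpace ℝ (Fin d) → ℝ) (t : ℝ) : ℝ :=
  l2Norm Ω (ftilde f φt t) ^ P.lam + h1Norm Ω (φ t) ^ 2

/-- `F` is a continuous, increasing envelope of `u` on `[0, ∞)`. -/
structure IsEnvelope (u F : ℝ → ℝ) : Prop where
  cont : ContinuousOn F (Ici 0)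
  mono : MonotoneOn F (Ici 0)
  le : ∀ t, 0 ≤ t → u t ≤ F t

/-- `𝒜(t) = 1 + ‖ρ⁰‖₁² + ‖φ⁰‖² + ∫₀ᵗ e^{-(t-s)/2} (‖φ_t(s)‖₁² + F(s)^{2/β}) ds`, where `F` is an
envelope of `g`. -/
def bigA {N : ℕ} (P : GenPoly N) (Ω : Set (EuclideanSpace ℝ (Fin d)))
    (φ φt : ℝ → EuclideanSpace ℝ (Fin d) → ℝ) (ρ0 : EuclideanSpace ℝ (Fin d) → ℝ)
    (F : ℝ → ℝ) (t : ℝ) : ℝ :=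
  1 + h1Norm Ω ρ0 ^ 2 + l2Norm Ω (φ 0) ^ 2 +
    ∫ s in (0 : ℝ)..t, Real.exp (-(1 / 2) * (t - s)) *
      (h1Norm Ω (φt s) ^ 2 + F s ^ (2 / P.β))

/-- `limsup_{t → ∞} u(t) ∈ [0, ∞]` of a nonnegative function `u`. -/
def limsupInfty (u : ℝ → ℝ) : ENNReal := limsup (fun t => ENNReal.ofReal (u t)) atTop

end Forchheimer

end

/-! ### The nonlinearity: coercivity, Lipschitz bound and convex potential of the flux -/

noncomputable section

namespace Forchheimer

namespace GenPoly

variable {N : ℕ} (P : GenPoly N)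

/-! Write `u = ρ̃_h`, `z = ∇πφ` and `Z = ∇u + z = ∇ρ_h`. Two energies drive the argument: the
dissipation `D = ∫ K(|Z|)|Z|²` and the potential energy `H = ∫ 2∫₀^{|Z|} K(s)s ds`, which satisfy `D
≤ H ≤ 2D` because `K` is decreasing while `K(s)s` is increasing. Since `ξ^β ≤ η + C K(ξ)ξ²` for
every `η > 0` (`rpow_beta_le`), `D` controls the gradient energy.

The scheme has no jump terms and the elementwise gradient annihilates piecewise constants, so the
dissipation cannot control `u` itself. It controls only the oscillating part `Qu`, where `Q` removes
the `L²` projection on piecewise constants. As `Qu` is an admissible test function with the same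
gradient as `u`, testing with it gives an inequality for `y = ‖Qu‖²` with the damping `-D`. Testing
with `u_t` gives one for `H'`. The two are coupled by a discrete Poincaré–Sobolev inequality,
`y^{β/2} ≤ η + C(D + ‖φ‖₁²)`.

Uniformity in the mesh comes from finite dimensionality and scaling. On polynomials of degree at
most `r`, pointwise values and gradients are bounded by an `L¹` norm over a ball
(`exists_norm_linearMap_le_integral`). After rescaling this yields the inverse inequality
(`exists_inverse_inequality`) and the local Poincaré–Sobolev inequality (`exists_poincare_sobolev`).
In the latter a factor `h^{β(1+d/2)-d}` appears, and the degree condition says exactly that its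
exponent is nonnegative. The bound `‖∇πw‖ ≤ C‖w‖₁` (`IsDiscreteGradient.norm_map_starProjection_le`)
combines the inverse inequality with a Poincaré inequality on star-shaped elements, proved by
mollification and averaging over segments.

What remains is scalar (`EnergySystem`). Young's inequality turns the first estimate into `y' ≤ -δ
y^{β/2} + C(1 + g)`, so `y` stays below a multiple of `1 + g^{2/β}` up to its initial value; then `H
+ 4y` decays at rate `1/2` up to the data. Gronwall's inequality gives (i), and its version for
large times gives (ii) (`EnergySystem.exists_bound`). For (iii), `H + y` decreases at a definite
rate as long as it is not small, because small `D` and small data force both `H` and `y` to be small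
(`EnergySystem.eventually_E_le`). -/

theorem deg_pos (hN : 1 ≤ N) : 0 < P.deg := by
  rw [← P.expo_zero]
  exact P.expo_strictMono (by rw [Fin.lt_def]; simp; omega)

theorem one_lt_beta (hN : 1 ≤ N) : 1 < P.β := by
  have h := P.deg_pos hN
  have : P.a < 1 := by unfold a; rw [div_lt_one (by linarith)]; linarith
  unfold β; linarith

theorem beta_lt_two (hN : 1 ≤ N) : P.β < 2 := by
  have h := P.deg_pos hN
  have : 0 < P.a := by unfold a; positivity
  unfold β; linarith

theorem eval_pos {s : ℝ} (hs : 0 ≤ s) : 0 < P.eval s :=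
  P.coeff_zero_pos.trans_le (P.coeff_zero_le_eval hs)

theorem root_nonneg {ξ : ℝ} (hξ : 0 ≤ ξ) : 0 ≤ P.root ξ := (P.root_spec hξ).1

/-- The magnitude of the flux is the root itself, hence increasing, although `K` is decreasing.
These two monotonicities are the source of all later properties of the flux. -/
theorem K_mul_self {ξ : ℝ} (hξ : 0 ≤ ξ) : P.K ξ * ξ = P.root ξ := by
  obtain ⟨h1, h2⟩ := P.root_spec hξ
  have h3 := P.eval_pos h1
  unfold K
  nth_rw 2 [← h2]
  field_simp

theorem root_mono {ξ ζ : ℝ} (hξ : 0 ≤ ξ) (h : ξ ≤ ζ) : P.root ξ ≤ P.root ζ := by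
  obtain ⟨h1, h2⟩ := P.root_spec hξ
  obtain ⟨h3, h4⟩ := P.root_spec (hξ.trans h)
  by_contra! hlt
  have h5 : P.root ζ * P.eval (P.root ζ) < P.root ξ * P.eval (P.root ξ) :=
    mul_lt_mul hlt (P.eval_mono h3 hlt.le) (P.eval_pos h3) h1
  linarith

theorem K_nonneg {ξ : ℝ} (hξ : 0 ≤ ξ) : 0 ≤ P.K ξ :=
  (one_div_pos.2 (P.eval_pos (P.root_nonneg hξ))).le

theorem K_anti {ξ ζ : ℝ} (hξ : 0 ≤ ξ) (h : ξ ≤ ζ) : P.K ζ ≤ P.K ξ :=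
  one_div_le_one_div_of_le (P.eval_pos (P.root_nonneg hξ))
    (P.eval_mono (P.root_nonneg hξ) (P.root_mono hξ h))

theorem K_le {ξ : ℝ} (hξ : 0 ≤ ξ) : P.K ξ ≤ 1 / P.coeff 0 :=
  one_div_le_one_div_of_le P.coeff_zero_pos (P.coeff_zero_le_eval (P.root_nonneg hξ))

theorem eval_le_mul_rpow {s : ℝ} (hs : 1 ≤ s) : P.eval s ≤ P.eval 1 * s ^ P.deg := by
  unfold eval
  rw [Finset.sum_mul]
  refine Finset.sum_le_sum fun i _ => ?_
  rw [Real.one_rpow, mul_one]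
  exact mul_le_mul_of_nonneg_left (Real.rpow_le_rpow_of_exponent_le hs
    (P.expo_strictMono.monotone (Fin.le_last i))) (P.coeff_nonneg i)

/-- Coercivity of `ξ ↦ K(ξ) ξ²` in the power `ξ ^ β`, up to an arbitrarily small error. -/
theorem rpow_beta_le (hN : 1 ≤ N) {η : ℝ} (hη : 0 < η) :
    ∃ C : ℝ, 0 < C ∧ ∀ ξ : ℝ, 0 ≤ ξ → ξ ^ P.β ≤ η + C * (P.K ξ * ξ ^ 2) := by
  have hβ1 := P.one_lt_beta hN
  have hβ2 := P.beta_lt_two hN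
  have hA : 0 < P.eval 1 := P.eval_pos zero_le_one
  -- The threshold below which `ξ ^ β` is absorbed by `η`.
  set δ := η ^ (1 / P.β) with hδdef
  have hδ : 0 < δ := Real.rpow_pos_of_pos hη _
  have hδη : δ ^ P.β = η := by
    rw [hδdef, ← Real.rpow_mul hη.le, one_div_mul_cancel (by linarith), Real.rpow_one]
  refine ⟨P.eval 1 * δ ^ (P.β - 2) + P.eval 1 ^ (P.β - 1), by positivity, fun ξ hξ => ?_⟩
  have hKn := P.K_nonneg hξ
  have hKK : 0 ≤ P.K ξ * ξ ^ 2 := by positivity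
  rcases le_or_gt ξ δ with h | h
  · have : ξ ^ P.β ≤ η := hδη ▸ Real.rpow_le_rpow hξ h (by linarith)
    have : 0 ≤ (P.eval 1 * δ ^ (P.β - 2) + P.eval 1 ^ (P.β - 1)) * (P.K ξ * ξ ^ 2) := by positivity
    linarith
  have hξ0 : 0 < ξ := hδ.trans h
  obtain ⟨h1, h2⟩ := P.root_spec hξ
  have hKξ : P.K ξ * ξ ^ 2 = P.root ξ * ξ := by rw [pow_two, ← mul_assoc, P.K_mul_self hξ]
  rcases le_total (P.root ξ) 1 with hs | hs
  -- Intermediate regime: here `K` is bounded below, and `ξ ^ (β - 2)` is bounded because `ξ > δ`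
  -- and `β < 2`.
  · have h3 : ξ ≤ P.eval 1 * P.root ξ := by
      calc ξ = P.root ξ * P.eval (P.root ξ) := h2.symm
        _ ≤ P.root ξ * P.eval 1 := mul_le_mul_of_nonneg_left (P.eval_mono h1 hs) h1
        _ = _ := mul_comm _ _
    have h4 : ξ ^ P.β ≤ P.eval 1 * δ ^ (P.β - 2) * (P.K ξ * ξ ^ 2) := by
      calc ξ ^ P.β = ξ ^ (P.β - 2) * (ξ * ξ) := by
            rw [← pow_two, ← Real.rpow_natCast ξ 2, ← Real.rpow_add hξ0]; norm_num
        _ ≤ δ ^ (P.β - 2) * ((P.eval 1 * P.root ξ) * ξ) :=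
            mul_le_mul (Real.rpow_le_rpow_of_nonpos hδ h.le (by linarith))
              (mul_le_mul_of_nonneg_right h3 hξ) (by positivity) (by positivity)
        _ = _ := by rw [hKξ]; ring
    have : 0 ≤ P.eval 1 ^ (P.β - 1) * (P.K ξ * ξ ^ 2) := by positivity
    linarith
  -- Large `ξ`: the leading power governs, so `ξ` is at most a multiple of `s ^ (deg + 1)`. As `β -
  -- 1 = 1 / (deg + 1)`, this makes `ξ ^ (β - 1)` at most a multiple of `s`, and `s ξ = K(ξ) ξ²`.
  · have hd := P.deg_pos hN
    have h3 : ξ ≤ P.eval 1 * P.root ξ ^ (P.deg + 1) := by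
      calc ξ = P.root ξ * P.eval (P.root ξ) := h2.symm
        _ ≤ P.root ξ * (P.eval 1 * P.root ξ ^ P.deg) :=
            mul_le_mul_of_nonneg_left (P.eval_le_mul_rpow hs) h1
        _ = _ := by rw [Real.rpow_add_one (by positivity)]; ring
    have hb : (P.deg + 1) * (P.β - 1) = 1 := by unfold β a; field_simp; ring
    have h4 : ξ ^ P.β ≤ P.eval 1 ^ (P.β - 1) * (P.K ξ * ξ ^ 2) := by
      calc ξ ^ P.β = ξ ^ (P.β - 1) * ξ := by
            rw [← Real.rpow_add_one hξ0.ne']; norm_num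
        _ ≤ (P.eval 1 * P.root ξ ^ (P.deg + 1)) ^ (P.β - 1) * ξ := by
            gcongr
        _ = _ := by
            rw [Real.mul_rpow hA.le (by positivity), ← Real.rpow_mul h1, hb, Real.rpow_one, hKξ]
            ring
    have : 0 ≤ P.eval 1 * δ ^ (P.β - 2) * (P.K ξ * ξ ^ 2) := by positivity
    linarith

/-- The potential `H(v) = 2 ∫₀^{|v|} K(s) s ds` of twice the flux. -/
def potential {E : Type*} [NormedAddCommGroup E] (v : E) : ℝ := 2 * ∫ s in (0 : ℝ)..‖v‖, P.root s

theorem potential_zero {E : Type*} [NormedAddCommGroup E] : P.potential (0 : E) = 0 := by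
  simp [potential]

section Flux

variable {E : Type*} [NormedAddCommGroup E] [InnerProductSpace ℝ E]

/-- The flux `v ↦ K(|v|) v`. -/
def flux (v : E) : E := P.K ‖v‖ • v

theorem flux_zero : P.flux (0 : E) = 0 := smul_zero _

theorem inner_flux_self (v : E) : inner ℝ (P.flux v) v = P.K ‖v‖ * ‖v‖ ^ 2 := by
  rw [flux, real_inner_smul_left, real_inner_self_eq_norm_sq]

theorem norm_flux_sq_le (v : E) : ‖P.flux v‖ ^ 2 ≤ 1 / P.coeff 0 * inner ℝ (P.flux v) v := by
  rw [P.inner_flux_self, flux, norm_smul, Real.norm_of_nonneg (P.K_nonneg (norm_nonneg v))]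
  have h1 := P.K_nonneg (norm_nonneg v)
  have h2 := P.K_le (norm_nonneg v)
  calc (P.K ‖v‖ * ‖v‖) ^ 2 = P.K ‖v‖ * (P.K ‖v‖ * ‖v‖ ^ 2) := by ring
    _ ≤ _ := mul_le_mul_of_nonneg_right h2 (by positivity)

/-- Split the difference into the larger vector's `K` times `v - u` and the variation of `K` along
`u`. Each is at most `‖v - u‖ / a₀`. -/
theorem norm_flux_sub_le_of_norm_le {u v : E} (h : ‖u‖ ≤ ‖v‖) :
    ‖P.flux v - P.flux u‖ ≤ 2 / P.coeff 0 * ‖v - u‖ := by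
  have hu := norm_nonneg u
  have hv := norm_nonneg v
  have hKu := P.K_le hu
  have hKv := P.K_le hv
  have hKv0 := P.K_nonneg hv
  have hKu0 := P.K_nonneg hu
  have hanti := P.K_anti hu h
  have hc := P.coeff_zero_pos
  -- The fall of `K` is limited by the fact that `ξ K(ξ)` increases; no derivative of `K` is needed.
  have key : (P.K ‖u‖ - P.K ‖v‖) * ‖u‖ ≤ P.K ‖u‖ * (‖v‖ - ‖u‖) := by
    rcases hv.eq_or_lt with h0 | h0
    · have : ‖u‖ = 0 := le_antisymm (h0 ▸ h) hu
      rw [this, ← h0]; simp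
    have h1 : P.K ‖u‖ * ‖u‖ ≤ P.K ‖v‖ * ‖v‖ := by
      rw [P.K_mul_self hu, P.K_mul_self hv]; exact P.root_mono hu h
    have h3 : P.K ‖v‖ * ‖u‖ * ‖v‖ ≥ P.K ‖u‖ * ‖u‖ * ‖u‖ := by nlinarith
    have h4 : ((P.K ‖u‖ - P.K ‖v‖) * ‖u‖) * ‖v‖ ≤ (P.K ‖u‖ * (‖v‖ - ‖u‖)) * ‖v‖ := by
      have : P.K ‖u‖ * ‖u‖ * (‖v‖ - ‖u‖) ≤ P.K ‖u‖ * ‖v‖ * (‖v‖ - ‖u‖) :=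
        mul_le_mul_of_nonneg_right (mul_le_mul_of_nonneg_left h hKu0) (by linarith)
      nlinarith
    exact le_of_mul_le_mul_right h4 h0
  have htri : ‖v‖ - ‖u‖ ≤ ‖v - u‖ := norm_sub_norm_le v u
  have hsplit : P.flux v - P.flux u = P.K ‖v‖ • (v - u) - (P.K ‖u‖ - P.K ‖v‖) • u := by
    simp only [flux]; module
  rw [hsplit]
  calc ‖P.K ‖v‖ • (v - u) - (P.K ‖u‖ - P.K ‖v‖) • u‖
      ≤ ‖P.K ‖v‖ • (v - u)‖ + ‖(P.K ‖u‖ - P.K ‖v‖) • u‖ := norm_sub_le _ _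
    _ = P.K ‖v‖ * ‖v - u‖ + (P.K ‖u‖ - P.K ‖v‖) * ‖u‖ := by
        rw [norm_smul, norm_smul, Real.norm_of_nonneg hKv0, Real.norm_of_nonneg (by linarith)]
    _ ≤ 1 / P.coeff 0 * ‖v - u‖ + 1 / P.coeff 0 * ‖v - u‖ := by
        refine add_le_add (mul_le_mul_of_nonneg_right hKv (norm_nonneg _)) (key.trans ?_)
        exact mul_le_mul hKu htri (by linarith) (by positivity)
    _ = _ := by ring

theorem norm_flux_sub_le (u v : E) : ‖P.flux v - P.flux u‖ ≤ 2 / P.coeff 0 * ‖v - u‖ := by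
  rcases le_total ‖u‖ ‖v‖ with h | h
  · exact P.norm_flux_sub_le_of_norm_le h
  · rw [norm_sub_rev, norm_sub_rev v]; exact P.norm_flux_sub_le_of_norm_le h

theorem lipschitzWith_flux :
    LipschitzWith (Real.toNNReal (2 / P.coeff 0)) (P.flux : E → E) := by
  refine LipschitzWith.of_dist_le_mul fun v u => ?_
  rw [dist_eq_norm, dist_eq_norm, Real.coe_toNNReal _ (by have := P.coeff_zero_pos; positivity)]
  exact P.norm_flux_sub_le u v

theorem intervalIntegrable_root {x y : ℝ} (hx : 0 ≤ x) (hy : 0 ≤ y) :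
    IntervalIntegrable P.root volume x y := by
  refine MonotoneOn.intervalIntegrable fun s hs t _ hst => P.root_mono ?_ hst
  exact (le_min hx hy).trans hs.1

/-- Convexity of the potential: twice the flux is a subgradient. -/
theorem two_inner_flux_le (u v : E) :
    2 * inner ℝ (P.flux u) (v - u) ≤ P.potential v - P.potential u := by
  have hu := norm_nonneg u
  have hv := norm_nonneg v
  have h1 : P.root ‖u‖ * (‖v‖ - ‖u‖) ≤ ∫ s in ‖u‖..‖v‖, P.root s := by
    rcases le_total ‖u‖ ‖v‖ with h | h
    · have := intervalIntegral.integral_mono_on h (f := fun _ => P.root ‖u‖) (g := P.root)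
        (by simp) (P.intervalIntegrable_root hu hv) (fun s hs => P.root_mono hu hs.1)
      simp only [intervalIntegral.integral_const, smul_eq_mul] at this
      linarith
    · have := intervalIntegral.integral_mono_on h (f := P.root) (g := fun _ => P.root ‖u‖)
        (P.intervalIntegrable_root hv hu) (by simp) (fun s hs => P.root_mono (hv.trans hs.1) hs.2)
      simp only [intervalIntegral.integral_const, smul_eq_mul] at this
      rw [intervalIntegral.integral_symm]
      linarith
  have h2 : (∫ s in (0 : ℝ)..‖v‖, P.root s) - ∫ s in (0 : ℝ)..‖u‖, P.root s =
      ∫ s in ‖u‖..‖v‖, P.root s :=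
    intervalIntegral.integral_interval_sub_left (P.intervalIntegrable_root le_rfl hv)
      (P.intervalIntegrable_root le_rfl hu)
  have h3 : inner ℝ (P.flux u) (v - u) ≤ P.root ‖u‖ * (‖v‖ - ‖u‖) := by
    have h4 := real_inner_le_norm u v
    have h5 := P.K_nonneg hu
    rw [flux, real_inner_smul_left, inner_sub_right, real_inner_self_eq_norm_sq,
      ← P.K_mul_self hu, mul_assoc]
    exact mul_le_mul_of_nonneg_left (by nlinarith) h5
  unfold potential
  linarith

theorem potential_le (v : E) : P.potential v ≤ 2 * inner ℝ (P.flux v) v := by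
  have := P.two_inner_flux_le v 0
  rw [potential_zero, zero_sub, inner_neg_right] at this
  linarith

/-- Since `K` is decreasing, the integrand `K(s)s` is at least `K(|v|)s` on `[0, |v|]`; the factor 2
in the potential cancels the 1/2 from integrating `s`. -/
theorem inner_flux_le_potential (v : E) : inner ℝ (P.flux v) v ≤ P.potential v := by
  have hv := norm_nonneg v
  have h := intervalIntegral.integral_mono_on hv (f := fun s => P.K ‖v‖ * s) (g := P.root)
    (Continuous.intervalIntegrable (by fun_prop) _ _) (P.intervalIntegrable_root le_rfl hv)
    (fun s hs => by
      rw [← P.K_mul_self hs.1]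
      exact mul_le_mul_of_nonneg_right (P.K_anti hs.1 hs.2) hs.1)
  rw [intervalIntegral.integral_const_mul, integral_id] at h
  rw [inner_flux_self, potential]
  linarith

/-- Convexity used from `v` to `u` gives a bound with the flux at `v`; the Lipschitz estimate moves
it to `u` at a quadratic price. Together with the convexity inequality, this pins down the
first-order expansion of the potential. -/
theorem potential_sub_le (u v : E) :
    P.potential v - P.potential u ≤
      2 * inner ℝ (P.flux u) (v - u) + 4 / P.coeff 0 * ‖v - u‖ ^ 2 := by
  have h1 := P.two_inner_flux_le v u
  have h2 : inner ℝ (P.flux v - P.flux u) (v - u) ≤ 2 / P.coeff 0 * ‖v - u‖ ^ 2 :=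
    (real_inner_le_norm _ _).trans (by
      rw [pow_two, ← mul_assoc]
      exact mul_le_mul_of_nonneg_right (P.norm_flux_sub_le u v) (norm_nonneg _))
  rw [inner_sub_left] at h2
  rw [← neg_sub v u, inner_neg_right] at h1
  have : 4 / P.coeff 0 * ‖v - u‖ ^ 2 = 2 * (2 / P.coeff 0 * ‖v - u‖ ^ 2) := by ring
  linarith

theorem continuous_potential : Continuous (P.potential : E → ℝ) := by
  refine continuous_iff_continuousAt.2 fun u => ?_
  have hz : Tendsto (fun v : E => v - u) (𝓝 u) (𝓝 0) := by
    have : Continuous fun v : E => v - u := by fun_prop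
    simpa using this.tendsto u
  have hc : Continuous fun w : E => 2 * inner ℝ (P.flux u) w := by fun_prop
  have hn : Continuous fun w : E =>
      2 * inner ℝ (P.flux u) w + 4 / P.coeff 0 * ‖w‖ ^ 2 := by fun_prop
  have h1 := (hc.tendsto 0).comp hz
  have h2 := (hn.tendsto 0).comp hz
  simp only [inner_zero_right, norm_zero, mul_zero, ne_eq, OfNat.ofNat_ne_zero, not_false_eq_true,
    zero_pow, add_zero] at h1 h2
  have h3 := tendsto_of_tendsto_of_tendsto_of_le_of_le h1 h2
    (fun v => P.two_inner_flux_le u v) (fun v => P.potential_sub_le u v)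
  simpa [ContinuousAt] using h3.add_const (P.potential u)

end Flux

end GenPoly

end Forchheimer

end

noncomputable section

namespace Forchheimer

/-! ### Scalar differential inequalities -/

/-- A nonnegative function which decreases at a definite rate above the level `M` eventually
stays below `M`. -/
theorem eventually_le_of_deriv_le_neg {z z' : ℝ → ℝ} {M κ t₀ : ℝ} (hκ : 0 < κ)
    (hz : ∀ t, t₀ ≤ t → HasDerivAt z (z' t) t) (h0 : ∀ t, t₀ ≤ t → 0 ≤ z t)
    (h : ∀ t, t₀ ≤ t → M ≤ z t → z' t ≤ -κ) : ∀ᶠ t in atTop, z t ≤ M := by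
  have hcont : ∀ a b, t₀ ≤ a → ContinuousOn z (Icc a b) := fun a b ha t ht =>
    (hz t (ha.trans ht.1)).continuousAt.continuousWithinAt
  obtain ⟨t₁, ht₁, hle⟩ : ∃ t₁, t₀ ≤ t₁ ∧ z t₁ ≤ M := by
    by_contra! hM
    -- If `z` stayed above `M`, the loss over this time span would be at least `z t₀ + 1`, making `z
    -- T` negative.
    set T := t₀ + (z t₀ + 1) / κ with hT
    have hz0 := h0 t₀ le_rfl
    have hTt : t₀ < T := by rw [hT]; have : 0 < (z t₀ + 1) / κ := by positivity
                            linarith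
    obtain ⟨c, hc, hc'⟩ := exists_hasDerivAt_eq_slope z z' hTt (hcont _ _ le_rfl)
      (fun t ht => hz t ht.1.le)
    have h1 := h c hc.1.le (hM c hc.1.le).le
    have h2 := h0 T hTt.le
    rw [hc', div_le_iff₀ (by linarith)] at h1
    have h3 : -κ * (T - t₀) = -(z t₀ + 1) := by rw [hT]; field_simp; ring
    linarith
  filter_upwards [eventually_ge_atTop t₁] with t ht
  refine image_le_of_deriv_right_lt_deriv_boundary (f := z) (f' := z') (B := fun _ => M)
    (B' := fun _ => 0) (a := t₁) (b := t) (hcont _ _ ht₁)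
    (fun s hs => (hz s (ht₁.trans hs.1)).hasDerivWithinAt) hle (fun s => hasDerivAt_const s M)
    (fun s hs hs' => ?_) ⟨ht, le_rfl⟩
  have := h s (ht₁.trans hs.1) hs'.ge
  linarith

/-- Barrier principle on `[0, t]`, for a function differentiable on the open interval only. -/
theorem le_max_of_deriv_neg {z z' : ℝ → ℝ} {M t : ℝ} (ht : 0 ≤ t)
    (hc : ContinuousWithinAt z (Ici 0) 0)
    (hz : ∀ s, 0 < s → HasDerivAt z (z' s) s)
    (h : ∀ s, 0 < s → s ≤ t → M ≤ z s → z' s < 0) : z t ≤ max (z 0) M := by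
  rcases ht.eq_or_lt with rfl | ht
  · exact le_max_left _ _
  -- There is no derivative at `0`, so the barrier argument starts at a small `s > 0`, with barrier
  -- `max (z s) M`, and then `s → 0`.
  have hlim : Tendsto (fun s => max (z s) M) (𝓝[>] 0) (𝓝 (max (z 0) M)) :=
    Tendsto.max (hc.mono_left (nhdsWithin_mono _ Ioi_subset_Ici_self)) tendsto_const_nhds
  refine ge_of_tendsto hlim ?_
  filter_upwards [Ioo_mem_nhdsGT ht] with s hs
  refine image_le_of_deriv_right_lt_deriv_boundary (f := z) (f' := z')
    (B := fun _ => max (z s) M)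
    (B' := fun _ => 0) (a := s) (b := t)
    (fun τ hτ => (hz τ (hs.1.trans_le hτ.1)).continuousAt.continuousWithinAt)
    (fun τ hτ => (hz τ (hs.1.trans_le hτ.1)).hasDerivWithinAt) (le_max_left _ _)
    (fun s => hasDerivAt_const s _)
    (fun τ hτ hτ' => ?_) ⟨hs.2.le, le_rfl⟩
  exact h τ (hs.1.trans_le hτ.1) hτ.2.le (hτ' ▸ le_max_right _ _)

/-- Gronwall's inequality with an integrable right-hand side. -/
theorem le_exp_add_integral_of_deriv_le {z z' k : ℝ → ℝ} {c t : ℝ} (ht : 0 ≤ t)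
    (hc : ContinuousWithinAt z (Ici 0) 0)
    (hz : ∀ s, 0 < s → HasDerivAt z (z' s) s)
    (hk : IntervalIntegrable k volume 0 t)
    (h : ∀ s, 0 < s → s ≤ t → z' s ≤ -c * z s + k s) :
    z t ≤ Real.exp (-c * t) * z 0 + ∫ s in (0 : ℝ)..t, Real.exp (-c * (t - s)) * k s := by
  have hexp : Continuous fun s : ℝ => Real.exp (-c * (t - s)) := by fun_prop
  have hintg : IntervalIntegrable (fun s => Real.exp (-c * (t - s)) * k s) volume 0 t :=
    hk.continuousOn_mul hexp.continuousOn
  have hzc : ContinuousOn z (Icc 0 t) := by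
    intro s hs
    rcases hs.1.eq_or_lt with rfl | hs0
    · exact hc.mono Icc_subset_Ici_self
    · exact (hz s hs0).continuousAt.continuousWithinAt
  -- The integrating factor `exp(-c(t - s))` removes the linear term; the right-hand side is only
  -- integrable, so the integrated form of the mean value inequality is used.
  have key := intervalIntegral.sub_le_integral_of_hasDeriv_right_of_le (a := 0) (b := t)
    (g := fun s => Real.exp (-c * (t - s)) * z s)
    (g' := fun s => Real.exp (-c * (t - s)) * c * z s + Real.exp (-c * (t - s)) * z' s)
    (φ := fun s => Real.exp (-c * (t - s)) * k s) ht (hexp.continuousOn.mul hzc)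
    (fun s hs => by
      have h1 : HasDerivAt (fun s : ℝ => Real.exp (-c * (t - s)))
          (Real.exp (-c * (t - s)) * c) s := by
        have h2 : HasDerivAt (fun s : ℝ => -c * (t - s)) c s := by
          simpa using ((hasDerivAt_id s).const_sub t).const_mul (-c)
        exact h2.exp
      exact (h1.mul (hz s hs.1)).hasDerivWithinAt)
    ((intervalIntegrable_iff_integrableOn_Icc_of_le ht).1 hintg)
    (fun s hs => by
      have := mul_le_mul_of_nonneg_left (h s hs.1 hs.2.le) (Real.exp_pos (-c * (t - s))).le
      linarith)
  simp only [sub_self, mul_zero, Real.exp_zero, one_mul, sub_zero] at key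
  linarith

/-- Young's inequality for `θ a` and `(2 / θ) b` with `θ ^ β = δ`, so that the coefficient of `a ^
β` can be made as small as desired. -/
theorem exists_young_const {β : ℝ} (hβ : 1 < β) {δ : ℝ} (hδ : 0 < δ) :
    ∃ C : ℝ, 0 < C ∧ ∀ a b : ℝ, 0 ≤ a → 0 ≤ b →
      2 * b * a ≤ δ * a ^ β + C * b ^ (β / (β - 1)) := by
  have hβ0 : 0 < β := by linarith
  have hconj : β.HolderConjugate (β / (β - 1)) := Real.HolderConjugate.conjExponent hβ
  have hl : 1 < β / (β - 1) := hconj.symm.lt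
  set θ := δ ^ (1 / β) with hθdef
  have hθ : 0 < θ := Real.rpow_pos_of_pos hδ _
  have hθδ : θ ^ β = δ := by
    rw [hθdef, ← Real.rpow_mul hδ.le, one_div_mul_cancel hβ0.ne', Real.rpow_one]
  refine ⟨(2 / θ) ^ (β / (β - 1)), by positivity, fun a b ha hb => ?_⟩
  have h := Real.young_inequality_of_nonneg (a := θ * a) (b := 2 / θ * b) (by positivity)
    (by positivity) hconj
  have h1 : (θ * a) ^ β / β ≤ δ * a ^ β := by
    rw [Real.mul_rpow hθ.le ha, hθδ]
    exact div_le_self (by positivity) hβ.le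
  have h2 : (2 / θ * b) ^ (β / (β - 1)) / (β / (β - 1)) ≤
      (2 / θ) ^ (β / (β - 1)) * b ^ (β / (β - 1)) := by
    rw [Real.mul_rpow (by positivity) hb]
    exact div_le_self (by positivity) hl.le
  have h3 : θ * a * (2 / θ * b) = 2 * b * a := by field_simp
  linarith

theorem one_add_rpow_le {x p : ℝ} (hx : 0 ≤ x) (hp : 0 ≤ p) :
    (1 + x) ^ p ≤ 2 ^ p * (1 + x ^ p) := by
  have h1 : 1 + x ≤ 2 * max 1 x := by
    have := le_max_left 1 x; have := le_max_right 1 x; linarith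
  have h2 : max 1 x ^ p ≤ 1 + x ^ p := by
    rcases le_total x 1 with h | h
    · rw [max_eq_left h, Real.one_rpow]; have := Real.rpow_nonneg hx p; linarith
    · rw [max_eq_right h]; linarith
  calc (1 + x) ^ p ≤ (2 * max 1 x) ^ p := Real.rpow_le_rpow (by positivity) h1 hp
    _ = 2 ^ p * max 1 x ^ p := Real.mul_rpow (by norm_num) (by positivity)
    _ ≤ _ := mul_le_mul_of_nonneg_left h2 (by positivity)

theorem le_one_add_rpow {x p : ℝ} (hx : 0 ≤ x) (hp : 1 ≤ p) : x ≤ 1 + x ^ p := by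
  rcases le_total x 1 with h | h
  · have := Real.rpow_nonneg hx p; linarith
  · have := Real.self_le_rpow_of_one_le h hp; linarith

/-- The scalar inequalities satisfied by the energies of a semidiscrete solution: `y` is the squared
norm of the oscillating part, `H` the potential energy, `D` the dissipation, `E` the gradient
energy, and `ψ`, `q`, `χ` are norms of the data. -/
structure EnergySystem (β C₁ : ℝ) (Cη : ℝ → ℝ) (y y' H H' D E ψ q χ : ℝ → ℝ) : Prop where
  y_deriv : ∀ t, 0 < t → HasDerivAt y (y' t) t
  H_deriv : ∀ t, 0 < t → HasDerivAt H (H' t) t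
  y_cont : ContinuousWithinAt y (Ici 0) 0
  H_cont : ContinuousWithinAt H (Ici 0) 0
  y_nonneg : ∀ t, 0 ≤ t → 0 ≤ y t
  D_nonneg : ∀ t, 0 ≤ t → 0 ≤ D t
  ψ_nonneg : ∀ t, 0 ≤ t → 0 ≤ ψ t
  q_nonneg : ∀ t, 0 ≤ t → 0 ≤ q t
  χ_nonneg : ∀ t, 0 ≤ t → 0 ≤ χ t
  y_le : ∀ t, 0 < t → y' t ≤ 2 * q t * √(y t) - D t + C₁ * ψ t
  H_le : ∀ t, 0 < t → H' t ≤ q t ^ 2 + D t / 2 + C₁ * χ t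
  D_le_H : ∀ t, 0 ≤ t → D t ≤ H t
  H_le_D : ∀ t, 0 ≤ t → H t ≤ 2 * D t
  y_rpow_le : ∀ η, 0 < η → ∀ t, 0 ≤ t → y t ^ (β / 2) ≤ η + Cη η * (D t + ψ t)
  E_le : ∀ η, 0 < η → ∀ t, 0 ≤ t → E t ≤ η + Cη η * D t

namespace EnergySystem

/-- The two basic differential inequalities, with constants that depend only on those of the
system. -/
theorem exists_deriv_le {β C₁ : ℝ} (hβ : 1 < β) (hβ2 : β < 2) (hC₁ : 0 < C₁) {K₁ : ℝ}
    (hK₁ : 0 < K₁) : ∃ δ C₂ : ℝ, 0 < δ ∧ 0 < C₂ ∧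
      ∀ (Cη : ℝ → ℝ) (y y' H H' D E ψ q χ : ℝ → ℝ), Cη 1 = K₁ →
      EnergySystem β C₁ Cη y y' H H' D E ψ q χ → ∀ t, 0 < t →
        y' t ≤ -δ * y t ^ (β / 2) + C₂ * (1 + (q t ^ (β / (β - 1)) + ψ t)) ∧
        H' t + 4 * y' t ≤ -(1 / 2) * (H t + 4 * y t) + 2 * y t + C₁ * χ t +
          (4 * C₂ + 1) * (1 + (q t ^ (β / (β - 1)) + ψ t)) := by
  have hδ : 0 < 1 / (4 * K₁) := by positivity
  -- Chosen so that `2 δ y ^ (β / 2)` costs at most half of the dissipation. One `δ` absorbs the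
  -- Young term, the other remains as damping.
  set δ := 1 / (4 * K₁) with hδdef
  obtain ⟨Cy, hCy, hyoung⟩ := exists_young_const hβ hδ
  refine ⟨δ, 2 * δ + Cy + C₁ + 1, hδ, by positivity, ?_⟩
  intro Cη y y' H H' D E ψ q χ hK S t ht
  have ht0 := ht.le
  have hy := S.y_nonneg t ht0
  have hD := S.D_nonneg t ht0
  have hψ := S.ψ_nonneg t ht0
  have hq := S.q_nonneg t ht0
  have hyp : 0 ≤ y t ^ (β / 2) := Real.rpow_nonneg hy _
  have hqp : 0 ≤ q t ^ (β / (β - 1)) := Real.rpow_nonneg hq _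
  have h1 := hyoung (√(y t)) (q t) (Real.sqrt_nonneg _) hq
  rw [Real.sqrt_eq_rpow, ← Real.rpow_mul hy, show (1 : ℝ) / 2 * β = β / 2 by ring] at h1
  have h2 := S.y_le t ht
  rw [Real.sqrt_eq_rpow] at h2
  have h3 := S.y_rpow_le 1 one_pos t ht0
  rw [hK] at h3
  have h4 : 2 * δ * y t ^ (β / 2) ≤ 2 * δ + (D t + ψ t) / 2 := by
    have := mul_le_mul_of_nonneg_left h3 (by positivity : 0 ≤ 2 * δ)
    have h5 : 2 * δ * (1 + K₁ * (D t + ψ t)) = 2 * δ + (D t + ψ t) / 2 := by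
      rw [hδdef]; field_simp; ring
    linarith
  set g := q t ^ (β / (β - 1)) + ψ t with hg
  have h6 : 2 * δ + Cy * q t ^ (β / (β - 1)) + C₁ * ψ t + ψ t / 2 ≤
      (2 * δ + Cy + C₁ + 1) * (1 + g) := by
    rw [hg]
    nlinarith [mul_nonneg hδ.le hqp, mul_nonneg hδ.le hψ, mul_nonneg hCy.le hψ,
      mul_nonneg hC₁.le hqp]
  have h7 : y' t ≤ -D t / 2 - δ * y t ^ (β / 2) + (2 * δ + Cy + C₁ + 1) * (1 + g) := by
    linarith
  have h8 : 0 ≤ δ * y t ^ (β / 2) := by positivity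
  refine ⟨by linarith, ?_⟩
  have h9 := S.H_le t ht
  have h10 := S.H_le_D t ht0
  -- The conjugate exponent is at least 2 because `β < 2`, so the quadratic source term fits into
  -- the same data function.
  have h11 : q t ^ 2 ≤ 1 + q t ^ (β / (β - 1)) := by
    have h12 : (2 : ℝ) ≤ β / (β - 1) := by rw [le_div_iff₀ (by linarith)]; linarith
    rcases le_total (q t) 1 with h | h
    · have := pow_le_one₀ (n := 2) hq h; linarith
    · have := Real.rpow_le_rpow_of_exponent_le h h12
      rw [Real.rpow_two] at this
      linarith
  have h13 : 0 ≤ H t := hD.trans (S.D_le_H t ht0)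
  linarith

/-- Bounds for the gradient energy, in terms of an envelope of the data and for large times. -/
theorem exists_bound {β C₁ : ℝ} (hβ : 1 < β) (hβ2 : β < 2) (hC₁ : 0 < C₁) {K₁ : ℝ}
    (hK₁ : 0 < K₁) : ∃ C : ℝ, 0 < C ∧
      ∀ (Cη : ℝ → ℝ) (y y' H H' D E ψ q χ : ℝ → ℝ), Cη 1 = K₁ →
      EnergySystem β C₁ Cη y y' H H' D E ψ q χ →
      (∀ F : ℝ → ℝ, ContinuousOn F (Ici 0) → MonotoneOn F (Ici 0) →
        (∀ t, 0 ≤ t → q t ^ (β / (β - 1)) + ψ t ≤ F t) → ∀ t, 0 ≤ t →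
        IntervalIntegrable χ volume 0 t →
        E t ≤ C * (1 + H 0 + y 0 + ∫ s in (0 : ℝ)..t, Real.exp (-(1 / 2) * (t - s)) *
          (χ s + F s ^ (2 / β)))) ∧
      (∀ G Φ : ℝ, 0 ≤ G → 0 ≤ Φ → (∀ᶠ t in atTop, q t ^ (β / (β - 1)) + ψ t ≤ G) →
        (∀ᶠ t in atTop, χ t ≤ Φ) →
        ∃ Y, (∀ᶠ t in atTop, y t ≤ Y) ∧ ∀ᶠ t in atTop, E t ≤ C * (1 + Φ + G ^ (2 / β))) := by
  obtain ⟨δ, C₂, hδ, hC₂, hderiv⟩ := exists_deriv_le hβ hβ2 hC₁ hK₁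
  have hβ0 : 0 < β := by linarith
  set p := 2 / β with hp
  have hp1 : 1 ≤ p := by rw [hp, le_div_iff₀ hβ0]; linarith
  have hp0 : 0 ≤ p := by linarith
  -- The equilibrium level `(2 C₂ (1 + x) / δ) ^ p` is where the damping equals twice the forcing by
  -- data of size `x`; `C₃` bounds it by a multiple of `1 + x ^ p`.
  set C₃ := (2 * C₂ / δ) ^ p * 2 ^ p with hC₃def
  have hC₃ : 0 < C₃ := by positivity
  set C₄ := 2 + 2 * C₃ + C₁ + 2 * (4 * C₂ + 1) with hC₄def
  have hC₄ : 0 < C₄ := by positivity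
  have hlevel : ∀ x, 0 ≤ x → (2 * C₂ * (1 + x) / δ) ^ p ≤ C₃ * (1 + x ^ p) := by
    intro x hx
    have : 2 * C₂ * (1 + x) / δ = 2 * C₂ / δ * (1 + x) := by ring
    rw [this, Real.mul_rpow (by positivity) (by positivity), hC₃def, mul_assoc]
    exact mul_le_mul_of_nonneg_left (one_add_rpow_le hx hp0) (by positivity)
  have habove : ∀ x z : ℝ, 0 ≤ x → (2 * C₂ * (1 + x) / δ) ^ p ≤ z →
      2 * C₂ * (1 + x) ≤ δ * z ^ (β / 2) := by
    intro x z hx hz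
    have hb : 0 ≤ 2 * C₂ * (1 + x) / δ := by positivity
    have h1 := Real.rpow_le_rpow (by positivity) hz (by positivity : 0 ≤ β / 2)
    have h2 : p * (β / 2) = 1 := by rw [hp]; field_simp
    rw [← Real.rpow_mul hb, h2, Real.rpow_one, div_le_iff₀ hδ] at h1
    linarith
  refine ⟨1 + K₁ * (4 + 2 * C₄), by positivity, ?_⟩
  intro Cη y y' H H' D E ψ q χ hK S
  have hE : ∀ t, 0 ≤ t → E t ≤ 1 + K₁ * (H t + 4 * y t) := by
    intro t ht
    have h1 := S.E_le 1 one_pos t ht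
    rw [hK] at h1
    have h2 := mul_le_mul_of_nonneg_left (S.D_le_H t ht) hK₁.le
    have h3 := mul_nonneg hK₁.le (S.y_nonneg t ht)
    linarith
  have hZ : ∀ t, 0 < t → HasDerivAt (fun t => H t + 4 * y t) (H' t + 4 * y' t) t :=
    fun t ht => (S.H_deriv t ht).add ((S.y_deriv t ht).const_mul 4)
  have hg0 : ∀ t, 0 ≤ t → 0 ≤ q t ^ (β / (β - 1)) + ψ t := fun t ht =>
    add_nonneg (Real.rpow_nonneg (S.q_nonneg t ht) _) (S.ψ_nonneg t ht)
  constructor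
  · intro F hFc hFm hF t ht hχ
    have hF0 : ∀ s, 0 ≤ s → 0 ≤ F s := fun s hs => (hg0 s hs).trans (hF s hs)
    have hy0 := S.y_nonneg 0 le_rfl
    have hH0 : 0 ≤ H 0 := (S.D_nonneg 0 le_rfl).trans (S.D_le_H 0 le_rfl)
    have hybd : ∀ s, 0 ≤ s → y s ≤ y 0 + C₃ * (1 + F s ^ p) := by
      intro s hs
      -- Monotonicity of `F` matters here: on all of `[0, s]` the data are below `F s`, so one
      -- constant barrier serves the whole interval.
      have h1 := le_max_of_deriv_neg (M := (2 * C₂ * (1 + F s) / δ) ^ p) hs S.y_cont S.y_deriv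
        (fun τ hτ hτs hM => by
          have h2 := habove _ _ (hF0 s hs) hM
          have h3 := (hderiv Cη y y' H H' D E ψ q χ hK S τ hτ).1
          have h4 : C₂ * (1 + (q τ ^ (β / (β - 1)) + ψ τ)) ≤ C₂ * (1 + F s) :=
            mul_le_mul_of_nonneg_left
              (by linarith [hF τ hτ.le, hFm (mem_Ici.2 hτ.le) (mem_Ici.2 hs) hτs]) hC₂.le
          have h5 : 0 < C₂ * (1 + F s) := mul_pos hC₂ (by linarith [hF0 s hs])
          linarith)
      have h6 := hlevel _ (hF0 s hs)
      have h7 : 0 ≤ F s ^ p := Real.rpow_nonneg (hF0 s hs) _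
      refine h1.trans (max_le ?_ ?_)
      · have : 0 ≤ C₃ * (1 + F s ^ p) := by positivity
        linarith
      · linarith
    have hFp : ContinuousOn (fun s => F s ^ p) (Icc 0 t) :=
      (hFc.mono Icc_subset_Ici_self).rpow_const fun s _ => Or.inr hp0
    have hFint : IntervalIntegrable (fun s => F s ^ p) volume 0 t :=
      ContinuousOn.intervalIntegrable (by rwa [uIcc_of_le ht])
    have hkint : IntervalIntegrable (fun s => χ s + F s ^ p) volume 0 t := hχ.add hFint
    -- The term `2 y` left over from the coupled inequality is replaced by its pointwise bound. Its
    -- constant part `1 + y 0` integrates to at most twice itself against the exponential kernel.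
    have hgr := le_exp_add_integral_of_deriv_le (z := fun t => H t + 4 * y t)
      (z' := fun t => H' t + 4 * y' t) (c := 1 / 2)
      (k := fun s => C₄ * (1 + y 0) + C₄ * (χ s + F s ^ p)) ht
      (S.H_cont.add (S.y_cont.const_mul 4)) hZ
      ((intervalIntegrable_const).add (hkint.const_mul C₄))
      (fun s hs hst => by
        have h1 := (hderiv Cη y y' H H' D E ψ q χ hK S s hs).2
        have h2 := hybd s hs.le
        have h3 : (4 * C₂ + 1) * (1 + (q s ^ (β / (β - 1)) + ψ s)) ≤
            (4 * C₂ + 1) * (2 + F s ^ p) :=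
          mul_le_mul_of_nonneg_left
            (by linarith [hF s hs.le, le_one_add_rpow (hF0 s hs.le) hp1]) (by positivity)
        have h4 : 0 ≤ F s ^ p := Real.rpow_nonneg (hF0 s hs.le) _
        have h5 := S.χ_nonneg s hs.le
        refine h1.trans ?_
        have h6 : 2 * y s + C₁ * χ s + (4 * C₂ + 1) * (1 + (q s ^ (β / (β - 1)) + ψ s)) ≤
            C₄ * (1 + y 0) + C₄ * (χ s + F s ^ p) := by
          rw [hC₄def]
          nlinarith [mul_nonneg hC₃.le h5, mul_nonneg hC₂.le h5, mul_nonneg hC₁.le h4,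
            mul_nonneg hC₃.le hy0, mul_nonneg hC₂.le hy0, mul_nonneg hC₁.le hy0,
            mul_nonneg hC₃.le h4, mul_nonneg hC₂.le h4]
        linarith)
    set I := ∫ s in (0 : ℝ)..t, Real.exp (-(1 / 2) * (t - s)) * (χ s + F s ^ p) with hI
    have hexp : Continuous fun s : ℝ => Real.exp (-(1 / 2) * (t - s)) := by fun_prop
    have hI0 : 0 ≤ I := intervalIntegral.integral_nonneg ht fun s hs =>
      mul_nonneg (Real.exp_pos _).le
        (add_nonneg (S.χ_nonneg s hs.1) (Real.rpow_nonneg (hF0 s hs.1) _))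
    have hexpint : ∫ s in (0 : ℝ)..t, Real.exp (-(1 / 2) * (t - s)) ≤ 2 := by
      have h1 : ∀ s ∈ uIcc 0 t, HasDerivAt (fun s : ℝ => 2 * Real.exp (-(1 / 2) * (t - s)))
          (Real.exp (-(1 / 2) * (t - s))) s := by
        intro s _
        have h2 : HasDerivAt (fun s : ℝ => -(1 / 2) * (t - s)) (1 / 2) s := by
          simpa using ((hasDerivAt_id s).const_sub t).const_mul (-(1 / 2) : ℝ)
        have h3 := h2.exp.const_mul 2
        rwa [show 2 * (Real.exp (-(1 / 2) * (t - s)) * (1 / 2)) =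
          Real.exp (-(1 / 2) * (t - s)) by ring] at h3
      rw [intervalIntegral.integral_eq_sub_of_hasDerivAt h1 (hexp.intervalIntegrable _ _)]
      have := Real.exp_pos (-(1 / 2) * (t - 0))
      simp only [sub_self, mul_zero, Real.exp_zero]
      linarith
    have hsplit : ∫ s in (0 : ℝ)..t, Real.exp (-(1 / 2) * (t - s)) *
        (C₄ * (1 + y 0) + C₄ * (χ s + F s ^ p)) =
        C₄ * (1 + y 0) * (∫ s in (0 : ℝ)..t, Real.exp (-(1 / 2) * (t - s))) + C₄ * I := by
      rw [hI, ← intervalIntegral.integral_const_mul, ← intervalIntegral.integral_const_mul,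
        ← intervalIntegral.integral_add]
      · refine intervalIntegral.integral_congr fun s _ => ?_
        ring
      · exact (hexp.intervalIntegrable _ _).const_mul _
      · exact (hkint.continuousOn_mul hexp.continuousOn).const_mul _
    have hexp1 : Real.exp (-(1 / 2) * t) ≤ 1 := Real.exp_le_one_iff.2 (by linarith)
    have hZ0 : Real.exp (-(1 / 2) * t) * (H 0 + 4 * y 0) ≤ H 0 + 4 * y 0 :=
      mul_le_of_le_one_left (by linarith) hexp1
    have hfin : H t + 4 * y t ≤ H 0 + 4 * y 0 + (C₄ * (1 + y 0) * 2 + C₄ * I) := by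
      have h1 : C₄ * (1 + y 0) * (∫ s in (0 : ℝ)..t, Real.exp (-(1 / 2) * (t - s))) ≤
          C₄ * (1 + y 0) * 2 := mul_le_mul_of_nonneg_left hexpint (by positivity)
      rw [hsplit] at hgr
      linarith
    have h8 : H t + 4 * y t ≤ (4 + 2 * C₄) * (1 + H 0 + y 0 + I) := by
      nlinarith [mul_nonneg hC₄.le hH0, mul_nonneg hC₄.le hI0]
    have h9 := mul_le_mul_of_nonneg_left h8 hK₁.le
    have h10 := hE t ht
    nlinarith
  · intro G Φ hG hΦ hgG hχΦ
    obtain ⟨t₀, ht₀, h₀⟩ : ∃ t₀, 0 < t₀ ∧ ∀ t, t₀ ≤ t →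
        q t ^ (β / (β - 1)) + ψ t ≤ G ∧ χ t ≤ Φ := by
      obtain ⟨t₁, h₁⟩ := eventually_atTop.1 (hgG.and hχΦ)
      exact ⟨max t₁ 1, by positivity, fun t ht => h₁ t ((le_max_left _ _).trans ht)⟩
    -- Above this level half of the damping already cancels the forcing, and the other half leaves a
    -- rate of decrease of at least `C₂`.
    have hy1 : ∀ᶠ t in atTop, y t ≤ (2 * C₂ * (1 + G) / δ) ^ p := by
      refine eventually_le_of_deriv_le_neg hC₂ (fun t ht => S.y_deriv t (ht₀.trans_le ht))
        (fun t ht => S.y_nonneg t (ht₀.le.trans ht)) (fun t ht hM => ?_)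
      have h2 := habove _ _ hG hM
      have h3 := (hderiv Cη y y' H H' D E ψ q χ hK S t (ht₀.trans_le ht)).1
      have h4 : C₂ * (1 + (q t ^ (β / (β - 1)) + ψ t)) ≤ C₂ * (1 + G) :=
        mul_le_mul_of_nonneg_left (by linarith [(h₀ t ht).1]) hC₂.le
      nlinarith [mul_nonneg hC₂.le hG]
    refine ⟨_, hy1, ?_⟩
    obtain ⟨t₂, h₂⟩ := eventually_atTop.1 hy1
    have hGp : 0 ≤ G ^ p := Real.rpow_nonneg hG _
    -- The level is twice the forcing plus 2: with decay rate `1/2` the derivative above it is at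
    -- most `-1`.
    have hZ1 : ∀ᶠ t in atTop, H t + 4 * y t ≤ 2 * (C₄ * (1 + Φ + G ^ p)) + 2 := by
      refine eventually_le_of_deriv_le_neg (t₀ := max t₀ t₂) one_pos
        (fun t ht => hZ t (ht₀.trans_le ((le_max_left _ _).trans ht)))
        (fun t ht => ?_) (fun t ht hM => ?_)
      · have h0 : 0 ≤ t := ht₀.le.trans ((le_max_left _ _).trans ht)
        have := (S.D_nonneg t h0).trans (S.D_le_H t h0)
        have := S.y_nonneg t h0
        positivity
      · have ht' := (le_max_left _ _).trans ht
        have h1 := (hderiv Cη y y' H H' D E ψ q χ hK S t (ht₀.trans_le ht')).2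
        have h3 : (4 * C₂ + 1) * (1 + (q t ^ (β / (β - 1)) + ψ t)) ≤
            (4 * C₂ + 1) * (2 + G ^ p) :=
          mul_le_mul_of_nonneg_left
            (by linarith [(h₀ t ht').1, le_one_add_rpow hG hp1]) (by positivity)
        have h4 : y t ≤ C₃ * (1 + G ^ p) := (h₂ t ((le_max_right _ _).trans ht)).trans (hlevel G hG)
        have h5 := mul_le_mul_of_nonneg_left (h₀ t ht').2 hC₁.le
        have h6 : 2 * y t + C₁ * χ t + (4 * C₂ + 1) * (1 + (q t ^ (β / (β - 1)) + ψ t)) ≤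
            C₄ * (1 + Φ + G ^ p) := by
          rw [hC₄def]
          nlinarith [mul_nonneg hC₃.le hΦ, mul_nonneg hC₂.le hΦ, mul_nonneg hC₁.le hGp,
            mul_nonneg hC₂.le hGp]
        linarith
    filter_upwards [hZ1, eventually_ge_atTop 0] with t ht ht0
    have h1 := hE t ht0
    have h2 := mul_le_mul_of_nonneg_left ht hK₁.le
    have h3 : K₁ ≤ K₁ * (1 + Φ + G ^ p) := le_mul_of_one_le_right hK₁.le (by linarith)
    have h4 : (1 + K₁ * (4 + 2 * C₄)) * (1 + Φ + G ^ p) = (1 + Φ + G ^ p) +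
      4 * (K₁ * (1 + Φ + G ^ p)) + K₁ * (2 * (C₄ * (1 + Φ + G ^ p))) := by ring
    rw [h4]
    linarith

/-- If the data tend to zero, then so does the gradient energy. -/
theorem eventually_E_le {β C₁ : ℝ} (hβ : 1 < β) {Cη : ℝ → ℝ}
    (hCη : ∀ η, 0 < η → 0 < Cη η) {y y' H H' D E ψ q χ : ℝ → ℝ}
    (S : EnergySystem β C₁ Cη y y' H H' D E ψ q χ) {Y : ℝ} (hY : ∀ᶠ t in atTop, y t ≤ Y)
    (hq : Tendsto q atTop (𝓝 0)) (hψ : Tendsto ψ atTop (𝓝 0)) (hχ : Tendsto χ atTop (𝓝 0))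
    {ε : ℝ} (hε : 0 < ε) : ∀ᶠ t in atTop, E t ≤ ε := by
  have hβ0 : 0 < β := by linarith
  have main : ∀ ε₁ : ℝ, 0 < ε₁ → ∀ᶠ t in atTop, H t + y t ≤ ε₁ := by
    intro ε₁ hε₁
    have hη : 0 < (ε₁ / 4) ^ (β / 2) / 2 := by positivity
    set η := (ε₁ / 4) ^ (β / 2) / 2 with hηdef
    have hC := hCη η hη
    -- If both `D` and `ψ` are at most `δ`, these conditions force `y ≤ ε₁ / 4` and `H ≤ ε₁ / 4`.
    obtain ⟨δ, hδ, hδ1, hδ2⟩ : ∃ δ : ℝ, 0 < δ ∧ Cη η * (2 * δ) ≤ η ∧ 2 * δ ≤ ε₁ / 4 := by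
      refine ⟨min (η / (2 * Cη η)) (ε₁ / 8), by positivity, ?_, ?_⟩
      · calc Cη η * (2 * min (η / (2 * Cη η)) (ε₁ / 8)) ≤ Cη η * (2 * (η / (2 * Cη η))) := by
              gcongr; exact min_le_left _ _
          _ = η := by field_simp
      · linarith [min_le_right (η / (2 * Cη η)) (ε₁ / 8)]
    -- The eventual bound `Y` is needed only here: without it the coupling term `2 q √y` would not
    -- be known to vanish.
    have hsmall : Tendsto (fun t => 2 * q t * √Y + q t ^ 2 + C₁ * ψ t + C₁ * χ t) atTop (𝓝 0) := by
      have := ((((hq.const_mul 2).mul_const √Y).add (hq.pow 2)).add (hψ.const_mul C₁)).add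
        (hχ.const_mul C₁)
      simpa using this
    obtain ⟨t₀, h₀⟩ := eventually_atTop.1 ((hsmall.eventually_le_const
      (by positivity : (0 : ℝ) < δ / 4)).and ((hψ.eventually_le_const hδ).and
        (hY.and (eventually_gt_atTop 0))))
    refine eventually_le_of_deriv_le_neg (z' := fun t => H' t + y' t) (t₀ := t₀) (κ := δ / 4)
      (by positivity) (fun t ht => ?_) (fun t ht => ?_) (fun t ht hM => ?_)
    · exact (S.H_deriv t (h₀ t ht).2.2.2).add (S.y_deriv t (h₀ t ht).2.2.2)
    · have h0 := (h₀ t ht).2.2.2.le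
      exact add_nonneg ((S.D_nonneg t h0).trans (S.D_le_H t h0)) (S.y_nonneg t h0)
    · obtain ⟨h1, h2, h3, h4⟩ := h₀ t ht
      -- While `H + y` is at least `ε₁` the dissipation cannot be small. After absorbing data below
      -- `δ / 4`, the half `-D / 2` left by adding the two inequalities gives the decay rate.
      have hD : δ < D t := by
        by_contra! hD
        have h5 := S.y_rpow_le η hη t h4.le
        have h6 : Cη η * (D t + ψ t) ≤ Cη η * (2 * δ) :=
          mul_le_mul_of_nonneg_left (by linarith) hC.le
        have h7 : y t ^ (β / 2) ≤ (ε₁ / 4) ^ (β / 2) := by linarith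
        have h8 : y t ≤ ε₁ / 4 :=
          (Real.rpow_le_rpow_iff (S.y_nonneg t h4.le) (by positivity) (by positivity)).1 h7
        have h9 := S.H_le_D t h4.le
        linarith
      have h5 := S.y_le t h4
      have h6 := S.H_le t h4
      have h7 : 2 * q t * √(y t) ≤ 2 * q t * √Y :=
        mul_le_mul_of_nonneg_left (Real.sqrt_le_sqrt h3)
          (by have := S.q_nonneg t h4.le; positivity)
      linarith
  have hC := hCη (ε / 2) (by positivity)
  filter_upwards [main (ε / 2 / Cη (ε / 2)) (by positivity), eventually_ge_atTop 0] with t ht ht0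
  have h1 := S.E_le (ε / 2) (by positivity) t ht0
  have h2 : D t ≤ ε / 2 / Cη (ε / 2) := by linarith [S.D_le_H t ht0, S.y_nonneg t ht0]
  rw [le_div_iff₀ hC] at h2
  linarith

end EnergySystem

end Forchheimer

end

noncomputable section

namespace Forchheimer

/-! ### Polynomials on balls -/

section Poly

variable {d : ℕ}

/-- The polynomial function of `p` on Euclidean space. -/
def polyEval (p : MvPolynomial (Fin d) ℝ) (x : EuclideanSpace ℝ (Fin d)) : ℝ :=
  MvPolynomial.eval (fun i => x i) p

/-- The gradient of the polynomial function of `p`. -/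
def polyGrad (p : MvPolynomial (Fin d) ℝ) (x : EuclideanSpace ℝ (Fin d)) :
    EuclideanSpace ℝ (Fin d) :=
  WithLp.toLp 2 fun i => polyEval (MvPolynomial.pderiv i p) x

theorem continuous_polyEval (p : MvPolynomial (Fin d) ℝ) : Continuous (polyEval p) :=
  (MvPolynomial.continuous_eval p).comp (by fun_prop)

theorem continuous_polyGrad (p : MvPolynomial (Fin d) ℝ) : Continuous (polyGrad p) :=
  (PiLp.continuous_toLp 2 _).comp (continuous_pi fun _ => continuous_polyEval _)

theorem polyEval_add (p q : MvPolynomial (Fin d) ℝ) (x : EuclideanSpace ℝ (Fin d)) :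
    polyEval (p + q) x = polyEval p x + polyEval q x := by simp [polyEval]

theorem polyEval_smul (c : ℝ) (p : MvPolynomial (Fin d) ℝ) (x : EuclideanSpace ℝ (Fin d)) :
    polyEval (c • p) x = c * polyEval p x := by simp [polyEval]

theorem polyGrad_add (p q : MvPolynomial (Fin d) ℝ) (x : EuclideanSpace ℝ (Fin d)) :
    polyGrad (p + q) x = polyGrad p x + polyGrad q x := by
  ext i; simp [polyGrad, polyEval]

theorem polyGrad_smul (c : ℝ) (p : MvPolynomial (Fin d) ℝ) (x : EuclideanSpace ℝ (Fin d)) :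
    polyGrad (c • p) x = c • polyGrad p x := by
  ext i; simp [polyGrad, polyEval]

theorem polyGrad_C (c : ℝ) (x : EuclideanSpace ℝ (Fin d)) :
    polyGrad (MvPolynomial.C c) x = 0 := by
  ext i; simp [polyGrad, polyEval]

theorem hasFDerivAt_polyEval (p : MvPolynomial (Fin d) ℝ) (x : EuclideanSpace ℝ (Fin d)) :
    HasFDerivAt (polyEval p) (innerSL ℝ (polyGrad p x)) x := by
  induction p using MvPolynomial.induction_on with
  | C a =>
    rw [polyGrad_C, map_zero]
    have : polyEval (d := d) (MvPolynomial.C a) = fun _ => a := by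
      funext y; simp [polyEval]
    rw [this]
    exact hasFDerivAt_const a x
  | add p q hp hq =>
    have : polyEval (p + q) = fun y => polyEval p y + polyEval q y :=
      funext fun y => polyEval_add p q y
    rw [this, polyGrad_add, map_add]
    exact hp.add hq
  | mul_X p n hp =>
    have : polyEval (p * MvPolynomial.X n) = fun y => polyEval p y * y n := by
      funext y; simp [polyEval]
    rw [this]
    have hX : HasFDerivAt (fun y : EuclideanSpace ℝ (Fin d) => y n)
        (EuclideanSpace.proj n : EuclideanSpace ℝ (Fin d) →L[ℝ] ℝ) x :=
      (EuclideanSpace.proj n : EuclideanSpace ℝ (Fin d) →L[ℝ] ℝ).hasFDerivAt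
    refine (hp.mul hX).congr_fderiv ?_
    ext v
    have hpg : polyGrad (p * MvPolynomial.X n) x =
        x n • polyGrad p x + polyEval p x • EuclideanSpace.single n (1 : ℝ) := by
      ext i
      by_cases h : i = n
      · subst h; simp [polyGrad, polyEval]; ring
      · simp [polyGrad, polyEval, h]
    rw [hpg]
    simp [EuclideanSpace.inner_single_left]
    ring

theorem hasGradientAt_polyEval (p : MvPolynomial (Fin d) ℝ) (x : EuclideanSpace ℝ (Fin d)) :
    HasGradientAt (polyEval p) (polyGrad p x) x := by
  rw [hasGradientAt_iff_hasFDerivAt]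
  exact hasFDerivAt_polyEval p x

theorem totalDegree_pderiv_le (p : MvPolynomial (Fin d) ℝ) (i : Fin d) :
    (MvPolynomial.pderiv i p).totalDegree ≤ p.totalDegree := by
  refine Finset.sup_le fun m hm => ?_
  rw [MvPolynomial.mem_support_iff, MvPolynomial.coeff_pderiv] at hm
  have hm' : m + Finsupp.single i 1 ∈ p.support :=
    MvPolynomial.mem_support_iff.2 (left_ne_zero_of_mul hm)
  have h1 := MvPolynomial.le_totalDegree hm'
  refine le_trans ?_ h1
  rw [Finsupp.sum_add_index' (fun _ => rfl) (fun _ _ _ => rfl)]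
  exact Nat.le_add_right _ _

/-- The polynomial `z ↦ p (x₀ + h z)`. -/
def polyScale (x₀ : EuclideanSpace ℝ (Fin d)) (h : ℝ) (p : MvPolynomial (Fin d) ℝ) :
    MvPolynomial (Fin d) ℝ :=
  MvPolynomial.bind₁ (fun i => MvPolynomial.C (x₀ i) + MvPolynomial.C h * MvPolynomial.X i) p

theorem polyEval_polyScale (x₀ : EuclideanSpace ℝ (Fin d)) (h : ℝ) (p : MvPolynomial (Fin d) ℝ)
    (z : EuclideanSpace ℝ (Fin d)) : polyEval (polyScale x₀ h p) z = polyEval p (x₀ + h • z) := by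
  simp only [polyEval, polyScale, MvPolynomial.eval, MvPolynomial.eval₂Hom_bind₁]
  congr 2
  funext i
  simp

theorem totalDegree_polyScale_le (x₀ : EuclideanSpace ℝ (Fin d)) (h : ℝ)
    (p : MvPolynomial (Fin d) ℝ) : (polyScale x₀ h p).totalDegree ≤ p.totalDegree := by
  rw [polyScale, MvPolynomial.bind₁, MvPolynomial.aeval_def, MvPolynomial.eval₂_eq]
  refine MvPolynomial.totalDegree_finsetSum_le fun m hm => ?_
  refine (MvPolynomial.totalDegree_mul _ _).trans ?_
  have h1 : (algebraMap ℝ (MvPolynomial (Fin d) ℝ) (MvPolynomial.coeff m p)).totalDegree = 0 :=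
    MvPolynomial.totalDegree_C _
  rw [h1, zero_add]
  refine (MvPolynomial.totalDegree_finsetProd _ _).trans ?_
  refine le_trans (Finset.sum_le_sum fun i _ => ?_) (MvPolynomial.le_totalDegree hm)
  refine (MvPolynomial.totalDegree_pow _ _).trans ?_
  have h2 : (MvPolynomial.C (x₀ i) + MvPolynomial.C h * MvPolynomial.X i :
      MvPolynomial (Fin d) ℝ).totalDegree ≤ 1 := by
    refine (MvPolynomial.totalDegree_add _ _).trans (max_le (by simp) ?_)
    refine (MvPolynomial.totalDegree_mul _ _).trans ?_
    simp
  simpa using Nat.mul_le_mul_left (m i) h2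

theorem polyGrad_polyScale (x₀ : EuclideanSpace ℝ (Fin d)) (h : ℝ) (p : MvPolynomial (Fin d) ℝ)
    (z : EuclideanSpace ℝ (Fin d)) :
    polyGrad (polyScale x₀ h p) z = h • polyGrad p (x₀ + h • z) := by
  have h1 : HasFDerivAt (fun z : EuclideanSpace ℝ (Fin d) => x₀ + h • z)
      (h • ContinuousLinearMap.id ℝ (EuclideanSpace ℝ (Fin d))) z :=
    ((hasFDerivAt_id z).const_smul h).const_add x₀
  have h2 := (hasFDerivAt_polyEval p (x₀ + h • z)).comp z h1
  have h3 := hasFDerivAt_polyEval (polyScale x₀ h p) z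
  have h4 : polyEval (polyScale x₀ h p) = polyEval p ∘ fun z => x₀ + h • z :=
    funext fun z => polyEval_polyScale x₀ h p z
  rw [h4] at h3
  have h5 := h3.unique h2
  refine ext_inner_right ℝ fun v => ?_
  have h6 := congrArg (fun L : EuclideanSpace ℝ (Fin d) →L[ℝ] ℝ => L v) h5
  simpa [real_inner_smul_left] using h6

theorem integrableOn_ball_of_continuous {F : Type*} [NormedAddCommGroup F]
    {f : EuclideanSpace ℝ (Fin d) → F} (hf : Continuous f) (x : EuclideanSpace ℝ (Fin d)) (ρ : ℝ) :
    IntegrableOn f (Metric.ball x ρ) :=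
  (hf.continuousOn.integrableOn_compact (isCompact_closedBall x ρ)).mono_set
    Metric.ball_subset_closedBall

/-- A polynomial whose integral over some ball vanishes in absolute value is zero. -/
theorem eq_zero_of_integral_ball_eq_zero {σ : ℝ} (hσ : 0 < σ) {p : MvPolynomial (Fin d) ℝ}
    (h : ∀ᵐ x ∂volume.restrict (Metric.ball (0 : EuclideanSpace ℝ (Fin d)) σ), polyEval p x = 0) :
    p = 0 := by
  have h1 : ∀ x ∈ Metric.ball (0 : EuclideanSpace ℝ (Fin d)) σ, polyEval p x = 0 := by
    have := Measure.eqOn_open_of_ae_eq (f := polyEval p) (g := fun _ => 0) h Metric.isOpen_ball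
      (continuous_polyEval p).continuousOn continuousOn_const
    exact fun x hx => this hx
  have hmem : WithLp.ofLp '' Metric.ball (0 : EuclideanSpace ℝ (Fin d)) σ ∈ 𝓝 (0 : Fin d → ℝ) := by
    have h2 : WithLp.toLp 2 ⁻¹' Metric.ball (0 : EuclideanSpace ℝ (Fin d)) σ ∈
        𝓝 (0 : Fin d → ℝ) :=
      (PiLp.continuous_toLp 2 _).continuousAt.preimage_mem_nhds
        (by simpa using Metric.ball_mem_nhds (0 : EuclideanSpace ℝ (Fin d)) hσ)
    refine Filter.mem_of_superset h2 fun v hv => ⟨WithLp.toLp 2 v, hv, rfl⟩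
  obtain ⟨ε, hε, hball⟩ := Metric.mem_nhds_iff.1 hmem
  -- A sup-norm ball is a product of intervals, and a polynomial vanishing on a product of infinite
  -- sets is zero.
  refine MvPolynomial.funext_set (fun _ => Metric.ball (0 : ℝ) ε)
    (fun _ => infinite_of_mem_nhds 0 (Metric.ball_mem_nhds 0 hε)) fun x hx => ?_
  have hx' : x ∈ Metric.ball (0 : Fin d → ℝ) ε := by
    rw [ball_pi _ hε]
    exact hx
  obtain ⟨z, hz, rfl⟩ := hball hx'
  rw [map_zero]
  exact h1 z hz

/-- On polynomials of bounded degree, every linear map is bounded by the `L¹` norm over a ball. -/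
theorem exists_norm_linearMap_le_integral {σ : ℝ} (hσ : 0 < σ) (r : ℕ) {F : Type*}
    [NormedAddCommGroup F] [NormedSpace ℝ F]
    (Λ : MvPolynomial.restrictTotalDegree (Fin d) ℝ r →ₗ[ℝ] F) :
    ∃ C : ℝ, 0 < C ∧ ∀ q : MvPolynomial.restrictTotalDegree (Fin d) ℝ r,
      ‖Λ q‖ ≤ C * ∫ x in Metric.ball (0 : EuclideanSpace ℝ (Fin d)) σ, |polyEval q x| := by
  set μ := volume.restrict (Metric.ball (0 : EuclideanSpace ℝ (Fin d)) σ) with hμ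
  have hintg : ∀ q : MvPolynomial (Fin d) ℝ, Integrable (polyEval q) μ := fun q =>
    integrableOn_ball_of_continuous (continuous_polyEval q) 0 σ
  let L : MvPolynomial.restrictTotalDegree (Fin d) ℝ r →ₗ[ℝ]
      (EuclideanSpace ℝ (Fin d) →₁[μ] ℝ) :=
    { toFun := fun q => (hintg q).toL1 _
      map_add' := fun p q => by
        rw [← Integrable.toL1_add]
        exact (Integrable.toL1_eq_toL1_iff _ _ _ _).2
          (ae_of_all _ fun x => polyEval_add p.1 q.1 x)
      map_smul' := fun c q => by
        rw [RingHom.id_apply, ← Integrable.toL1_smul]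
        exact (Integrable.toL1_eq_toL1_iff _ _ _ _).2
          (ae_of_all _ fun x => polyEval_smul c q.1 x) }
  have hinj : Function.Injective L := by
    rw [← LinearMap.ker_eq_bot, LinearMap.ker_eq_bot']
    intro q hq
    have h1 : (hintg q).toL1 _ = 0 := hq
    have h2 := (hintg q).coeFn_toL1
    rw [h1] at h2
    refine Subtype.ext (eq_zero_of_integral_ball_eq_zero hσ ?_)
    filter_upwards [h2, Lp.coeFn_zero ℝ 1 μ] with x hx hx'
    rw [← hx, hx', Pi.zero_apply]
  let e := LinearEquiv.ofInjective L hinj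
  -- The embedding into `L¹` is injective with finite-dimensional range, so `Λ` transported to that
  -- range is automatically continuous; its norm is the constant.
  let M : LinearMap.range L →L[ℝ] F := LinearMap.toContinuousLinearMap (Λ ∘ₗ e.symm.toLinearMap)
  refine ⟨‖M‖ + 1, by positivity, fun q => ?_⟩
  have h1 : Λ q = M (e q) := by simp [M]
  have h2 : ‖e q‖ = ∫ x, |polyEval q x| ∂μ := by
    have : ‖e q‖ = ‖(hintg q).toL1 _‖ := rfl
    rw [this, L1.norm_of_fun_eq_integral_norm]
    rfl
  rw [h1, ← h2]
  refine (M.le_opNorm _).trans ?_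
  gcongr
  linarith

theorem integral_ball_comp_scale (x₀ : EuclideanSpace ℝ (Fin d)) {h σ : ℝ} (hh : 0 < h)
    (f : EuclideanSpace ℝ (Fin d) → ℝ) :
    ∫ z in Metric.ball (0 : EuclideanSpace ℝ (Fin d)) σ, f (x₀ + h • z) =
      (h ^ d)⁻¹ * ∫ x in Metric.ball x₀ (σ * h), f x := by
  rw [← integral_indicator measurableSet_ball, ← integral_indicator measurableSet_ball]
  have h1 := Measure.integral_comp_smul_of_nonneg
    (volume : Measure (EuclideanSpace ℝ (Fin d)))
    (fun z => (Metric.ball x₀ (σ * h)).indicator f (x₀ + z)) h (hR := hh.le)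
  rw [integral_add_left_eq_self ((Metric.ball x₀ (σ * h)).indicator f) x₀,
    finrank_euclideanSpace_fin, smul_eq_mul] at h1
  rw [← h1]
  refine integral_congr_ae (ae_of_all _ fun z => ?_)
  have h2 : z ∈ Metric.ball (0 : EuclideanSpace ℝ (Fin d)) σ ↔
      x₀ + h • z ∈ Metric.ball x₀ (σ * h) := by
    rw [mem_ball_zero_iff, mem_ball_iff_norm, add_sub_cancel_left, norm_smul,
      Real.norm_of_nonneg hh.le, mul_comm h, mul_lt_mul_iff_left₀ hh]
  by_cases hz : z ∈ Metric.ball (0 : EuclideanSpace ℝ (Fin d)) σ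
  · simp only [indicator_of_mem hz, indicator_of_mem (h2.1 hz)]
  · simp only [indicator_of_notMem hz, indicator_of_notMem (fun h => hz (h2.2 h))]

/-- Evaluation on the closed unit ball, as a linear map on polynomials of bounded degree. -/
def polyEvalLinear (r : ℕ) : MvPolynomial.restrictTotalDegree (Fin d) ℝ r →ₗ[ℝ]
    C(Metric.closedBall (0 : EuclideanSpace ℝ (Fin d)) 1, ℝ) where
  toFun q := ⟨fun x => polyEval q.1 x, (continuous_polyEval _).comp continuous_subtype_val⟩
  map_add' p q := by ext x; exact polyEval_add _ _ _
  map_smul' c q := by ext x; exact polyEval_smul _ _ _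

/-- The gradient on the closed unit ball, as a linear map on polynomials of bounded degree. -/
def polyGradLinear (r : ℕ) : MvPolynomial.restrictTotalDegree (Fin d) ℝ r →ₗ[ℝ]
    C(Metric.closedBall (0 : EuclideanSpace ℝ (Fin d)) 1, EuclideanSpace ℝ (Fin d)) where
  toFun q := ⟨fun x => polyGrad q.1 x, (continuous_polyGrad _).comp continuous_subtype_val⟩
  map_add' p q := by ext1 x; exact polyGrad_add _ _ _
  map_smul' c q := by ext1 x; exact polyGrad_smul _ _ _

theorem exists_smul_eq_of_dist_le {x₀ x : EuclideanSpace ℝ (Fin d)} {h : ℝ} (hh : 0 < h)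
    (hx : dist x x₀ ≤ h) :
    ∃ z : Metric.closedBall (0 : EuclideanSpace ℝ (Fin d)) 1, x₀ + h • (z : _) = x := by
  refine ⟨⟨h⁻¹ • (x - x₀), ?_⟩, ?_⟩
  · rw [mem_closedBall_zero_iff, norm_smul, norm_inv, Real.norm_of_nonneg hh.le,
      inv_mul_le_iff₀ hh, mul_one, ← dist_eq_norm]
    exact hx
  · simp [smul_smul, hh.ne']

/-- A polynomial of bounded degree is bounded pointwise by its mean over a smaller ball. -/
theorem exists_abs_polyEval_le {σ : ℝ} (hσ : 0 < σ) (d r : ℕ) : ∃ C : ℝ, 0 < C ∧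
    ∀ (x₀ : EuclideanSpace ℝ (Fin d)) (h : ℝ), 0 < h → ∀ p : MvPolynomial (Fin d) ℝ,
      p.totalDegree ≤ r → ∀ x, dist x x₀ ≤ h →
      |polyEval p x| ≤ C * ((h ^ d)⁻¹ * ∫ y in Metric.ball x₀ (σ * h), |polyEval p y|) := by
  -- Applied to the polynomial rescaled by `z ↦ x₀ + h z`; the constant then depends on neither `x₀`
  -- nor `h`, nor on the shape of any element.
  obtain ⟨C, hC, hCq⟩ := exists_norm_linearMap_le_integral (d := d) hσ r (polyEvalLinear r)
  refine ⟨C, hC, fun x₀ h hh p hp x hx => ?_⟩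
  obtain ⟨z, rfl⟩ := exists_smul_eq_of_dist_le hh hx
  have h1 := hCq ⟨polyScale x₀ h p, (MvPolynomial.mem_restrictTotalDegree _ _ _).2
    ((totalDegree_polyScale_le x₀ h p).trans hp)⟩
  have h2 := (ContinuousMap.norm_coe_le_norm _ z).trans h1
  have h3 := integral_ball_comp_scale (σ := σ) x₀ hh (fun x => |polyEval p x|)
  simp only [polyEval_polyScale] at h2
  rw [h3] at h2
  rw [← polyEval_polyScale]
  exact h2

/-- Inverse inequality: the gradient is bounded by the mean of the polynomial over a ball. -/
theorem exists_norm_polyGrad_le {σ : ℝ} (hσ : 0 < σ) (d r : ℕ) : ∃ C : ℝ, 0 < C ∧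
    ∀ (x₀ : EuclideanSpace ℝ (Fin d)) (h : ℝ), 0 < h → ∀ p : MvPolynomial (Fin d) ℝ,
      p.totalDegree ≤ r → ∀ x, dist x x₀ ≤ h →
      h * ‖polyGrad p x‖ ≤ C * ((h ^ d)⁻¹ * ∫ y in Metric.ball x₀ (σ * h), |polyEval p y|) := by
  obtain ⟨C, hC, hCq⟩ := exists_norm_linearMap_le_integral (d := d) hσ r (polyGradLinear r)
  refine ⟨C, hC, fun x₀ h hh p hp x hx => ?_⟩
  obtain ⟨z, rfl⟩ := exists_smul_eq_of_dist_le hh hx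
  have h1 := hCq ⟨polyScale x₀ h p, (MvPolynomial.mem_restrictTotalDegree _ _ _).2
    ((totalDegree_polyScale_le x₀ h p).trans hp)⟩
  have h2 := (ContinuousMap.norm_coe_le_norm _ z).trans h1
  have h3 := integral_ball_comp_scale (σ := σ) x₀ hh (fun x => |polyEval p x|)
  simp only [polyEval_polyScale] at h2
  rw [h3] at h2
  have h4 : ‖polyGrad (polyScale x₀ h p) z‖ = h * ‖polyGrad p (x₀ + h • (z : _))‖ := by
    rw [polyGrad_polyScale, norm_smul, Real.norm_of_nonneg hh.le]
  rw [← h4]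
  exact h2

/-- The gradient of a polynomial is bounded pointwise by its mean over a smaller ball. -/
theorem exists_norm_polyGrad_le_integral_norm {σ : ℝ} (hσ : 0 < σ) (d r : ℕ) : ∃ C : ℝ, 0 < C ∧
    ∀ (x₀ : EuclideanSpace ℝ (Fin d)) (h : ℝ), 0 < h → ∀ p : MvPolynomial (Fin d) ℝ,
      p.totalDegree ≤ r → ∀ x, dist x x₀ ≤ h →
      ‖polyGrad p x‖ ≤ C * ((h ^ d)⁻¹ * ∫ y in Metric.ball x₀ (σ * h), ‖polyGrad p y‖) := by
  obtain ⟨C, hC, hCq⟩ := exists_abs_polyEval_le hσ d r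
  refine ⟨(d + 1) * C, by positivity, fun x₀ h hh p hp x hx => ?_⟩
  set I := (h ^ d)⁻¹ * ∫ y in Metric.ball x₀ (σ * h), ‖polyGrad p y‖ with hI
  have hI0 : 0 ≤ I := by positivity
  -- Partial derivatives are again polynomials of degree at most `r`, so the scalar estimate applies
  -- to each component.
  have hi : ∀ i, |polyGrad p x i| ≤ C * I := fun i => by
    refine (hCq x₀ h hh _ ((totalDegree_pderiv_le p i).trans hp) x hx).trans ?_
    refine mul_le_mul_of_nonneg_left (mul_le_mul_of_nonneg_left
      (integral_mono ?_ ?_ fun y => ?_) (by positivity)) hC.le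
    · exact (integrableOn_ball_of_continuous (continuous_polyEval _) _ _).abs
    · exact (integrableOn_ball_of_continuous (continuous_polyGrad _) _ _).norm
    · exact PiLp.norm_apply_le (polyGrad p _) i
  have h1 : ‖polyGrad p x‖ ≤ ∑ i, |polyGrad p x i| := by
    have h2 : polyGrad p x = ∑ i, EuclideanSpace.single i (polyGrad p x i) := by
      ext j; simp [Finset.sum_apply]
    calc ‖polyGrad p x‖ = ‖∑ i, EuclideanSpace.single i (polyGrad p x i)‖ := by rw [← h2]
      _ ≤ ∑ i, ‖EuclideanSpace.single i (polyGrad p x i)‖ := norm_sum_le _ _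
      _ = _ := by simp
  refine h1.trans ((Finset.sum_le_sum fun i _ => hi i).trans ?_)
  rw [Finset.sum_const, Finset.card_univ, Fintype.card_fin, nsmul_eq_mul]
  nlinarith [mul_nonneg hC.le hI0]

end Poly

end Forchheimer

end

noncomputable section

namespace Forchheimer

/-! ### The Poincaré inequality on star-shaped sets -/

section Poincare

theorem sq_lintegral_le {α : Type*} [MeasurableSpace α] {μ : Measure α} [IsProbabilityMeasure μ]
    {f : α → ENNReal} (hf : AEMeasurable f μ) : (∫⁻ x, f x ∂μ) ^ 2 ≤ ∫⁻ x, f x ^ 2 ∂μ := by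
  have h := ENNReal.lintegral_mul_le_Lp_mul_Lq μ Real.HolderConjugate.two_two hf
    (aemeasurable_const (b := (1 : ENNReal)))
  simp only [Pi.mul_apply, mul_one, lintegral_const, measure_univ, ENNReal.rpow_two, one_pow,
    ENNReal.one_rpow] at h
  calc (∫⁻ x, f x ∂μ) ^ 2 ≤ ((∫⁻ x, f x ^ 2 ∂μ) ^ (1 / 2 : ℝ)) ^ 2 := by gcongr
    _ = _ := by rw [← ENNReal.rpow_natCast, ← ENNReal.rpow_mul]; norm_num

/-- Cauchy–Schwarz against the constant 1 for the probability measure with density `k`. -/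
theorem sq_lintegral_mul_le {α : Type*} [MeasurableSpace α] {μ : Measure α}
    {k f : α → ENNReal} (hk : Measurable k) (hk1 : ∫⁻ x, k x ∂μ = 1) (hf : AEMeasurable f μ) :
    (∫⁻ x, k x * f x ∂μ) ^ 2 ≤ ∫⁻ x, k x * f x ^ 2 ∂μ := by
  have : IsProbabilityMeasure (μ.withDensity k) := ⟨by
    rw [withDensity_apply _ MeasurableSet.univ, Measure.restrict_univ, hk1]⟩
  have hf' : AEMeasurable f (μ.withDensity k) := hf.mono_ac (withDensity_absolutelyContinuous _ _)
  have h := sq_lintegral_le hf'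
  rw [lintegral_withDensity_eq_lintegral_mul₀ hk.aemeasurable hf,
    lintegral_withDensity_eq_lintegral_mul₀ hk.aemeasurable (hf.pow_const 2)] at h
  simpa using h

variable {d : ℕ}

theorem lintegral_comp_smul_add {R : ℝ} (hR : 0 < R) (c : EuclideanSpace ℝ (Fin d))
    {M : EuclideanSpace ℝ (Fin d) → ENNReal} (hM : Measurable M) :
    ∫⁻ x, M (R • x + c) = ENNReal.ofReal ((R ^ d)⁻¹) * ∫⁻ x, M x := by
  have h1 : ∫⁻ x, M (R • x + c) =
      ∫⁻ x, M (x + c) ∂(Measure.map (R • ·) (volume : Measure (EuclideanSpace ℝ (Fin d)))) := by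
    rw [lintegral_map (by fun_prop) (by fun_prop)]
  rw [h1, Measure.map_addHaar_smul _ hR.ne', lintegral_smul_measure,
    lintegral_add_right_eq_self M c, finrank_euclideanSpace_fin, abs_of_pos (by positivity),
    smul_eq_mul]

/-- Integrating along the point at a fixed ratio between two sets costs at most a factor `2 ^ d`
times the measure of the larger set. -/
theorem lintegral_segment_le {M : EuclideanSpace ℝ (Fin d) → ENNReal} (hM : Measurable M)
    {T B : Set (EuclideanSpace ℝ (Fin d))} (hBT : volume B ≤ volume T) (t : ℝ) :
    ∫⁻ x in T, ∫⁻ y in B, M (y + t • (x - y)) ≤ 2 ^ d * volume T * ∫⁻ z, M z := by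
  have hpow : ∀ R : ℝ, 1 / 2 ≤ R → ENNReal.ofReal ((R ^ d)⁻¹) ≤ 2 ^ d := fun R hR => by
    have h1 : (R ^ d)⁻¹ ≤ 2 ^ d := by
      rw [← inv_pow]
      refine pow_le_pow_left₀ (by positivity) ?_ d
      rw [inv_le_comm₀ (by linarith) (by norm_num)]
      linarith
    calc ENNReal.ofReal ((R ^ d)⁻¹) ≤ ENNReal.ofReal (2 ^ d) := ENNReal.ofReal_le_ofReal h1
      _ = 2 ^ d := by rw [ENNReal.ofReal_pow (by norm_num)]; norm_num
  -- Integrate first in the variable whose coefficient in `(1 - t) y + t x` is at least `1/2`: the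
  -- change of variables then costs at most `2 ^ d`, uniformly in `t`.
  rcases le_total t (1 / 2) with h | h
  · have h1 : ∀ x : EuclideanSpace ℝ (Fin d), ∫⁻ y in B, M (y + t • (x - y)) ≤
        2 ^ d * ∫⁻ z, M z := fun x => by
      calc ∫⁻ y in B, M (y + t • (x - y)) ≤ ∫⁻ y, M (y + t • (x - y)) :=
            setLIntegral_le_lintegral _ _
        _ = ∫⁻ y, M ((1 - t) • y + t • x) := by
            refine lintegral_congr fun y => ?_
            congr 1; module
        _ = ENNReal.ofReal (((1 - t) ^ d)⁻¹) * ∫⁻ z, M z :=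
            lintegral_comp_smul_add (by linarith) _ hM
        _ ≤ _ := by gcongr; exact hpow _ (by linarith)
    calc ∫⁻ x in T, ∫⁻ y in B, M (y + t • (x - y)) ≤ ∫⁻ _ in T, 2 ^ d * ∫⁻ z, M z :=
          lintegral_mono fun x => h1 x
      _ = _ := by rw [setLIntegral_const]; ring
  · have h1 : ∀ y : EuclideanSpace ℝ (Fin d), ∫⁻ x in T, M (y + t • (x - y)) ≤
        2 ^ d * ∫⁻ z, M z := fun y => by
      calc ∫⁻ x in T, M (y + t • (x - y)) ≤ ∫⁻ x, M (y + t • (x - y)) :=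
            setLIntegral_le_lintegral _ _
        _ = ∫⁻ x, M (t • x + (1 - t) • y) := by
            refine lintegral_congr fun y => ?_
            congr 1; module
        _ = ENNReal.ofReal ((t ^ d)⁻¹) * ∫⁻ z, M z :=
            lintegral_comp_smul_add (by linarith) _ hM
        _ ≤ _ := by gcongr; exact hpow _ (by linarith)
    rw [lintegral_lintegral_swap (by
      apply Measurable.aemeasurable
      simp only [Function.uncurry_def]
      fun_prop)]
    calc ∫⁻ y in B, ∫⁻ x in T, M (y + t • (x - y)) ≤ ∫⁻ _ in B, 2 ^ d * ∫⁻ z, M z :=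
          lintegral_mono fun x => h1 x
      _ = 2 ^ d * (∫⁻ z, M z) * volume B := by rw [setLIntegral_const]
      _ ≤ 2 ^ d * (∫⁻ z, M z) * volume T := by gcongr
      _ = _ := by ring

theorem gradient_inner (η : EuclideanSpace ℝ (Fin d) → ℝ) (x e : EuclideanSpace ℝ (Fin d)) :
    inner ℝ (gradient η x) e = fderiv ℝ η x e := by
  rw [gradient, InnerProductSpace.toDual_symm_apply]

/-- A test function supported in `T` is also one for `Ω`, and it vanishes off `T` together with its
gradient. -/
theorem HasWeakGradient.mono {Ω T : Set (EuclideanSpace ℝ (Fin d))}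
    {u : EuclideanSpace ℝ (Fin d) → ℝ} {G : EuclideanSpace ℝ (Fin d) → EuclideanSpace ℝ (Fin d)}
    (h : HasWeakGradient Ω u G) (hΩ : MeasurableSet Ω) (hT : T ⊆ Ω) : HasWeakGradient T u G := by
  intro η hη hc hs i
  have h1 := h η hη hc (hs.trans hT) i
  have h0 : ∀ x, x ∉ T → η x = 0 := fun x hx =>
    image_eq_zero_of_notMem_tsupport fun h => hx (hs h)
  have h0' : ∀ x, x ∉ T → gradient η x = 0 := fun x hx => by
    have h2 : fderiv ℝ η x = 0 := by
      by_contra hne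
      exact hx (hs (support_fderiv_subset ℝ hne))
    rw [gradient, h2, map_zero]
  rw [setIntegral_eq_of_subset_of_forall_sdiff_eq_zero hΩ hT
      (f := fun x => u x * gradient η x i) (fun x hx => by simp [h0' x hx.2]),
    setIntegral_eq_of_subset_of_forall_sdiff_eq_zero hΩ hT
      (f := fun x => G x i * η x) (fun x hx => by simp [h0 x hx.2])] at h1
  exact h1

theorem HasWeakGradient.integral_fderiv {T : Set (EuclideanSpace ℝ (Fin d))}
    {u : EuclideanSpace ℝ (Fin d) → ℝ} {G : EuclideanSpace ℝ (Fin d) → EuclideanSpace ℝ (Fin d)}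
    (h : HasWeakGradient T u G) (hu : IntegrableOn u T) (hG : IntegrableOn G T)
    {η : EuclideanSpace ℝ (Fin d) → ℝ} (hη : ContDiff ℝ ∞ η) (hc : HasCompactSupport η)
    (hs : tsupport η ⊆ T) (e : EuclideanSpace ℝ (Fin d)) :
    ∫ x in T, u x * fderiv ℝ η x e = - ∫ x in T, inner ℝ (G x) e * η x := by
  have hbdd : ∀ f : EuclideanSpace ℝ (Fin d) → ℝ, Continuous f → HasCompactSupport f →
      ∀ w : EuclideanSpace ℝ (Fin d) → ℝ, IntegrableOn w T → IntegrableOn (fun x => w x * f x) T := by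
    intro f hf hfc w hw
    obtain ⟨C, hC⟩ := hfc.exists_bound_of_continuous hf
    exact hw.mul_bdd hf.aestronglyMeasurable (ae_of_all _ hC)
  have hdc : Continuous (fderiv ℝ η) := hη.continuous_fderiv (by simp)
  have hgrad : ∀ x (i : Fin d), gradient η x i = fderiv ℝ η x (EuclideanSpace.single i 1) := by
    intro x i
    rw [← gradient_inner, EuclideanSpace.inner_single_right]
    simp
  have hGi : ∀ i : Fin d, IntegrableOn (fun x => G x i) T := fun i =>
    (EuclideanSpace.proj i : EuclideanSpace ℝ (Fin d) →L[ℝ] ℝ).integrable_comp hG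
  have e1 : ∀ x, u x * fderiv ℝ η x e = ∑ i, e i * (u x * gradient η x i) := fun x => by
    rw [← gradient_inner, PiLp.inner_apply, Finset.mul_sum]
    refine Finset.sum_congr rfl fun i _ => ?_
    simp; ring
  have e2 : ∀ x, inner ℝ (G x) e * η x = ∑ i, e i * (G x i * η x) := fun x => by
    rw [PiLp.inner_apply, Finset.sum_mul]
    refine Finset.sum_congr rfl fun i _ => ?_
    simp; ring
  simp_rw [e1, e2]
  rw [integral_finsetSum, integral_finsetSum, ← Finset.sum_neg_distrib]
  · refine Finset.sum_congr rfl fun i _ => ?_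
    rw [integral_const_mul, integral_const_mul, h η hη hc hs i]
    ring
  · intro i _
    exact (hbdd _ hη.continuous hc _ (hGi i)).const_mul _
  · intro i _
    refine Integrable.const_mul ?_ _
    simp_rw [hgrad]
    refine hbdd _ (by fun_prop) ?_ _ hu
    exact hc.fderiv_apply ℝ _

end Poincare

end Forchheimer

end

/-! ### Mollification and weak gradients -/

noncomputable section

namespace Forchheimer

section Mollify

variable {d : ℕ}

/-- The mollification of `u` on `T` by a smooth bump function. -/
def mollify (b : ContDiffBump (0 : EuclideanSpace ℝ (Fin d))) (T : Set (EuclideanSpace ℝ (Fin d)))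
    (u : EuclideanSpace ℝ (Fin d) → ℝ) : EuclideanSpace ℝ (Fin d) → ℝ :=
  convolution (b.normed volume) (T.indicator u) (ContinuousLinearMap.lsmul ℝ ℝ) volume

variable {T : Set (EuclideanSpace ℝ (Fin d))} {u : EuclideanSpace ℝ (Fin d) → ℝ}

theorem contDiff_mollify (b : ContDiffBump (0 : EuclideanSpace ℝ (Fin d))) (hT : MeasurableSet T)
    (hu : IntegrableOn u T) : ContDiff ℝ 1 (mollify b T u) :=
  HasCompactSupport.contDiff_convolution_left (n := 1) _ b.hasCompactSupport_normed b.contDiff_normed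
    (hu.integrable_indicator hT).locallyIntegrable

/-- The derivative falls on the kernel. When the closed ball around `z` lies in `T`, the reflected
kernel `w ↦ k(z - w)` is an admissible test function; the minus sign from the reflection cancels the
one in the weak formulation. -/
theorem fderiv_mollify {G : EuclideanSpace ℝ (Fin d) → EuclideanSpace ℝ (Fin d)}
    (b : ContDiffBump (0 : EuclideanSpace ℝ (Fin d))) (hT : MeasurableSet T)
    (hu : IntegrableOn u T) (hG : IntegrableOn G T) (h : HasWeakGradient T u G)
    {z : EuclideanSpace ℝ (Fin d)} (hz : Metric.closedBall z b.rOut ⊆ T)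
    (e : EuclideanSpace ℝ (Fin d)) :
    fderiv ℝ (mollify b T u) z e = ∫ w in T, inner ℝ (G w) e * b.normed volume (z - w) := by
  set k := b.normed (volume : Measure (EuclideanSpace ℝ (Fin d))) with hk
  have hkc : HasCompactSupport k := b.hasCompactSupport_normed
  have hkd : ContDiff ℝ ∞ k := b.contDiff_normed
  have hkd1 : ContDiff ℝ 1 k := b.contDiff_normed
  have hloc : LocallyIntegrable (T.indicator u) :=
    (hu.integrable_indicator hT).locallyIntegrable
  have h1 := (hkc.hasFDerivAt_convolution_left (ContinuousLinearMap.lsmul ℝ ℝ) hkd1 hloc z).fderiv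
  have hex : ConvolutionExists (fderiv ℝ k) (T.indicator u)
      ((ContinuousLinearMap.lsmul ℝ ℝ).precompL (EuclideanSpace ℝ (Fin d))) volume :=
    (hkc.fderiv ℝ).convolutionExists_left _ (hkd1.continuous_fderiv one_ne_zero) hloc
  unfold mollify
  rw [h1, convolution_eq_swap]
  have hintg := (hex z).integrable_swap
  rw [ContinuousLinearMap.integral_apply hintg]
  have h2 : ∀ w, (((ContinuousLinearMap.lsmul ℝ ℝ).precompL (EuclideanSpace ℝ (Fin d)))
      (fderiv ℝ k (z - w)) (T.indicator u w)) e =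
      T.indicator (fun w => u w * fderiv ℝ k (z - w) e) w := by
    intro w
    by_cases hw : w ∈ T
    · simp [hw, mul_comm]
    · simp [hw]
  simp_rw [h2]
  rw [integral_indicator hT]
  have hθd : ContDiff ℝ ∞ fun w => k (z - w) := hkd.comp (contDiff_const.sub contDiff_id)
  have hθc : HasCompactSupport fun w => k (z - w) :=
    hkc.comp_homeomorph (Homeomorph.subLeft z)
  have hθs : tsupport (fun w => k (z - w)) ⊆ T := by
    refine (closure_minimal (fun w hw => ?_) Metric.isClosed_closedBall).trans hz
    have : z - w ∈ Function.support k := hw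
    rw [hk, b.support_normed_eq, mem_ball_zero_iff] at this
    rw [mem_closedBall_iff_norm, norm_sub_rev]
    exact this.le
  have h3 := h.integral_fderiv hu hG hθd hθc hθs e
  have h4 : ∀ w, fderiv ℝ (fun w => k (z - w)) w e = - fderiv ℝ k (z - w) e := by
    intro w
    have h5 : HasFDerivAt (fun w : EuclideanSpace ℝ (Fin d) => z - w)
        (-ContinuousLinearMap.id ℝ (EuclideanSpace ℝ (Fin d))) w :=
      (hasFDerivAt_id w).const_sub z
    have h6 := ((hkd1.differentiable one_ne_zero (z - w)).hasFDerivAt.comp w h5).fderiv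
    have h7 : (k ∘ fun w => z - w) = fun w => k (z - w) := rfl
    rw [h7] at h6
    rw [h6]
    simp
  simp_rw [h4, mul_neg, integral_neg, neg_inj] at h3
  exact h3

/-- The mollification of a nonnegative function, in `[0, ∞]`. -/
def lmollify (b : ContDiffBump (0 : EuclideanSpace ℝ (Fin d)))
    (g : EuclideanSpace ℝ (Fin d) → ENNReal) (z : EuclideanSpace ℝ (Fin d)) : ENNReal :=
  ∫⁻ w, ENNReal.ofReal (b.normed volume (z - w)) * g w

theorem measurable_lmollify (b : ContDiffBump (0 : EuclideanSpace ℝ (Fin d)))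
    {g : EuclideanSpace ℝ (Fin d) → ENNReal} (hg : Measurable g) : Measurable (lmollify b g) := by
  have hk : Measurable (b.normed (volume : Measure (EuclideanSpace ℝ (Fin d)))) :=
    (b.continuous_normed).measurable
  unfold lmollify
  refine Measurable.lintegral_prod_right' (f := fun p : EuclideanSpace ℝ (Fin d) ×
    EuclideanSpace ℝ (Fin d) => ENNReal.ofReal (b.normed volume (p.1 - p.2)) * g p.2) ?_
  fun_prop

theorem lintegral_normed (b : ContDiffBump (0 : EuclideanSpace ℝ (Fin d))) :
    ∫⁻ w, ENNReal.ofReal (b.normed volume w) = 1 := by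
  rw [← ofReal_integral_eq_lintegral_ofReal b.integrable_normed (ae_of_all _ b.nonneg_normed),
    b.integral_normed, ENNReal.ofReal_one]

theorem lintegral_lmollify (b : ContDiffBump (0 : EuclideanSpace ℝ (Fin d)))
    {g : EuclideanSpace ℝ (Fin d) → ENNReal} (hg : Measurable g) :
    ∫⁻ z, lmollify b g z = ∫⁻ w, g w := by
  have hk : Measurable (b.normed (volume : Measure (EuclideanSpace ℝ (Fin d)))) :=
    (b.continuous_normed).measurable
  unfold lmollify
  rw [lintegral_lintegral_swap (by
    apply Measurable.aemeasurable
    simp only [Function.uncurry_def]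
    fun_prop)]
  refine lintegral_congr fun w => ?_
  rw [lintegral_mul_const _ (by fun_prop),
    lintegral_sub_right_eq_self (fun z => ENNReal.ofReal (b.normed volume z)) w,
    lintegral_normed, one_mul]

/-- The derivative is an average of the weak gradient against a kernel of mass one, so its square is
at most the average of the squares. The measurable representative `g` allows later use of Tonelli's
theorem. -/
theorem enorm_fderiv_mollify_sq_le {G : EuclideanSpace ℝ (Fin d) → EuclideanSpace ℝ (Fin d)}
    (b : ContDiffBump (0 : EuclideanSpace ℝ (Fin d))) (hT : MeasurableSet T)
    (hu : IntegrableOn u T) (hG : IntegrableOn G T) (h : HasWeakGradient T u G)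
    {g : EuclideanSpace ℝ (Fin d) → ENNReal} (hg : Measurable g)
    (hgG : (T.indicator fun w => ‖G w‖ₑ) =ᵐ[volume] g)
    {z : EuclideanSpace ℝ (Fin d)} (hz : Metric.closedBall z b.rOut ⊆ T)
    (e : EuclideanSpace ℝ (Fin d)) :
    ‖fderiv ℝ (mollify b T u) z e‖ₑ ^ 2 ≤ ‖e‖ₑ ^ 2 * lmollify b (fun w => g w ^ 2) z := by
  have hk : Measurable (b.normed (volume : Measure (EuclideanSpace ℝ (Fin d)))) :=
    (b.continuous_normed).measurable
  rw [fderiv_mollify b hT hu hG h hz e]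
  have h1 : ‖∫ w in T, inner ℝ (G w) e * b.normed volume (z - w)‖ₑ ≤
      ‖e‖ₑ * ∫⁻ w, ENNReal.ofReal (b.normed volume (z - w)) * g w := by
    calc ‖∫ w in T, inner ℝ (G w) e * b.normed volume (z - w)‖ₑ
        ≤ ∫⁻ w in T, ‖inner ℝ (G w) e * b.normed volume (z - w)‖ₑ :=
          enorm_integral_le_lintegral_enorm _
      _ ≤ ∫⁻ w in T, ‖e‖ₑ * (ENNReal.ofReal (b.normed volume (z - w)) * ‖G w‖ₑ) := by
          refine lintegral_mono fun w => ?_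
          rw [enorm_mul, Real.enorm_of_nonneg (b.nonneg_normed _)]
          have h2 : ‖inner ℝ (G w) e‖ₑ ≤ ‖G w‖ₑ * ‖e‖ₑ := by
            rw [← ofReal_norm, ← ofReal_norm, ← ofReal_norm, ← ENNReal.ofReal_mul (norm_nonneg _)]
            exact ENNReal.ofReal_le_ofReal (norm_inner_le_norm _ _)
          calc _ ≤ ‖G w‖ₑ * ‖e‖ₑ * ENNReal.ofReal (b.normed volume (z - w)) := by gcongr
            _ = _ := by ring
      _ = ∫⁻ w, ‖e‖ₑ * (ENNReal.ofReal (b.normed volume (z - w)) *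
            T.indicator (fun w => ‖G w‖ₑ) w) := by
          rw [← lintegral_indicator hT]
          refine lintegral_congr fun w => ?_
          by_cases hw : w ∈ T <;> simp [hw]
      _ = ∫⁻ w, ‖e‖ₑ * (ENNReal.ofReal (b.normed volume (z - w)) * g w) := by
          refine lintegral_congr_ae ?_
          filter_upwards [hgG] with w hw
          rw [hw]
      _ = _ := by rw [lintegral_const_mul _ (by fun_prop)]
  calc ‖∫ w in T, inner ℝ (G w) e * b.normed volume (z - w)‖ₑ ^ 2
      ≤ (‖e‖ₑ * ∫⁻ w, ENNReal.ofReal (b.normed volume (z - w)) * g w) ^ 2 := by gcongr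
    _ = ‖e‖ₑ ^ 2 * (∫⁻ w, ENNReal.ofReal (b.normed volume (z - w)) * g w) ^ 2 := by rw [mul_pow]
    _ ≤ _ := by
        gcongr
        refine sq_lintegral_mul_le (by fun_prop) ?_ hg.aemeasurable
        rw [lintegral_sub_left_eq_self (fun w => ENNReal.ofReal (b.normed volume w)) z,
          lintegral_normed]

/-- The increment of a `C¹` function between two points, bounded by the mean of the squared
directional derivative over the segment. -/
theorem enorm_sub_sq_le_lintegral {v : EuclideanSpace ℝ (Fin d) → ℝ} (hv : ContDiff ℝ 1 v)
    (x y : EuclideanSpace ℝ (Fin d)) :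
    ‖v x - v y‖ₑ ^ 2 ≤ ∫⁻ t in Icc (0 : ℝ) 1, ‖fderiv ℝ v (y + t • (x - y)) (x - y)‖ₑ ^ 2 := by
  have hc : Continuous fun t : ℝ => fderiv ℝ v (y + t • (x - y)) (x - y) := by
    have := hv.continuous_fderiv one_ne_zero
    fun_prop
  have h1 : ∀ t ∈ uIcc (0 : ℝ) 1, HasDerivAt (fun t : ℝ => v (y + t • (x - y)))
      (fderiv ℝ v (y + t • (x - y)) (x - y)) t := by
    intro t _
    have h2 : HasDerivAt (fun t : ℝ => y + t • (x - y)) (x - y) t := by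
      simpa using ((hasDerivAt_id t).smul_const (x - y)).const_add y
    exact (hv.differentiable one_ne_zero _).hasFDerivAt.comp_hasDerivAt t h2
  have h3 := intervalIntegral.integral_eq_sub_of_hasDerivAt h1 (hc.intervalIntegrable _ _)
  simp only [one_smul, zero_smul, add_zero, add_sub_cancel] at h3
  rw [← h3, intervalIntegral.integral_of_le zero_le_one, ← integral_Icc_eq_integral_Ioc]
  have : IsProbabilityMeasure (volume.restrict (Icc (0 : ℝ) 1)) := ⟨by simp⟩
  calc ‖∫ t in Icc (0 : ℝ) 1, fderiv ℝ v (y + t • (x - y)) (x - y)‖ₑ ^ 2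
      ≤ (∫⁻ t in Icc (0 : ℝ) 1, ‖fderiv ℝ v (y + t • (x - y)) (x - y)‖ₑ) ^ 2 := by
        gcongr; exact enorm_integral_le_lintegral_enorm _
    _ ≤ _ := sq_lintegral_le hc.measurable.enorm.aemeasurable

end Mollify

end Forchheimer

end

/-! ### Poincaré inequality by averaging over segments -/

noncomputable section

namespace Forchheimer

section PoincareStar

variable {d : ℕ}

/-- Poincaré inequality in double-integral form on a set star-shaped with respect to `B`. -/
theorem lintegral_prod_sub_sq_le {T B : Set (EuclideanSpace ℝ (Fin d))} (hT : IsOpen T)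
    (hB : MeasurableSet B) (hBT : B ⊆ T) (hstar : ∀ y ∈ B, StarConvex ℝ y T) {h : ℝ}
    (hdiam : ∀ x ∈ T, ∀ y ∈ B, ‖x - y‖ ≤ h) {u : EuclideanSpace ℝ (Fin d) → ℝ}
    {G : EuclideanSpace ℝ (Fin d) → EuclideanSpace ℝ (Fin d)}
    (hu : IntegrableOn u T) (hG : IntegrableOn G T) (hw : HasWeakGradient T u G) :
    ∫⁻ p, ‖u p.1 - u p.2‖ₑ ^ 2 ∂((volume.restrict T).prod (volume.restrict B)) ≤
      ENNReal.ofReal h ^ 2 * (2 ^ d * volume T * ∫⁻ x in T, ‖G x‖ₑ ^ 2) := by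
  have hTm := hT.measurableSet
  have hae : AEMeasurable (T.indicator fun w => ‖G w‖ₑ) volume :=
    (aemeasurable_indicator_iff hTm).2 hG.aestronglyMeasurable.enorm
  set g := hae.mk _ with hgdef
  have hg : Measurable g := hae.measurable_mk
  have hgG : (T.indicator fun w => ‖G w‖ₑ) =ᵐ[volume] g := hae.ae_eq_mk
  have hgint : ∫⁻ w, g w ^ 2 = ∫⁻ x in T, ‖G x‖ₑ ^ 2 := by
    rw [← lintegral_indicator hTm]
    refine lintegral_congr_ae ?_
    filter_upwards [hgG] with w hw'
    rw [← hw']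
    by_cases hwT : w ∈ T <;> simp [hwT]
  let ε : ℕ → ℝ := fun n => 1 / ((n : ℝ) + 1)
  have hε : ∀ n, 0 < ε n := fun n => Nat.one_div_pos_of_nat
  have hε0 : Tendsto ε atTop (𝓝 0) := tendsto_one_div_add_atTop_nhds_zero_nat
  let b : ℕ → ContDiffBump (0 : EuclideanSpace ℝ (Fin d)) := fun n =>
    ⟨ε n / 2, ε n, half_pos (hε n), half_lt_self (hε n)⟩
  let v : ℕ → EuclideanSpace ℝ (Fin d) → ℝ := fun n => mollify (b n) T u
  have hv : ∀ n, ContDiff ℝ 1 (v n) := fun n => contDiff_mollify (b n) hTm hu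
  let M : ℕ → EuclideanSpace ℝ (Fin d) → ENNReal := fun n => lmollify (b n) fun w => g w ^ 2
  have hM : ∀ n, Measurable (M n) := fun n => measurable_lmollify _ (hg.pow_const 2)
  -- Pairs whose joining segment keeps distance `2 ε n` from the complement of `T`, so that balls of
  -- radius `ε n` about its points lie inside. Only for these pairs is the derivative of the
  -- mollification controlled along the segment.
  let A : ℕ → Set (EuclideanSpace ℝ (Fin d) × EuclideanSpace ℝ (Fin d)) := fun n =>
    {p | ∀ t ∈ Icc (0 : ℝ) 1, ∀ w, w ∉ T → 2 * ε n ≤ dist (p.2 + t • (p.1 - p.2)) w}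
  have hA : ∀ n, IsClosed (A n) := fun n => by
    simp only [A, ofPred_forall]
    refine isClosed_iInter fun t => isClosed_iInter fun _ => isClosed_iInter fun w =>
      isClosed_iInter fun _ => isClosed_le (by fun_prop) (by fun_prop)
  set μ := (volume.restrict T).prod (volume.restrict B) with hμ
  let F : ℕ → EuclideanSpace ℝ (Fin d) × EuclideanSpace ℝ (Fin d) → ENNReal := fun n =>
    (A n).indicator fun p => ‖v n p.1 - v n p.2‖ₑ ^ 2
  have hF : ∀ n, Measurable (F n) := fun n => by
    refine Measurable.indicator ?_ (hA n).measurableSet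
    have := (hv n).continuous
    exact (Continuous.measurable (by fun_prop)).enorm.pow_const 2
  have hμmem : ∀ᵐ p ∂μ, p.1 ∈ T ∧ p.2 ∈ B := by
    have h1 := Measure.quasiMeasurePreserving_fst (μ := volume.restrict T)
      (ν := volume.restrict B) |>.ae (ae_restrict_mem hTm)
    have h2 := Measure.quasiMeasurePreserving_snd (μ := volume.restrict T)
      (ν := volume.restrict B) |>.ae (ae_restrict_mem hB)
    exact h1.and h2
  have hlim : ∀ᵐ x, Tendsto (fun n => v n x) atTop (𝓝 (T.indicator u x)) :=
    ContDiffBump.ae_convolution_tendsto_right_of_locallyIntegrable (K := 2) hε0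
      (Eventually.of_forall fun n => by
        change ε n ≤ 2 * (ε n / 2)
        linarith)
      (hu.integrable_indicator hTm).locallyIntegrable
  have hlim1 : ∀ᵐ p ∂μ, Tendsto (fun n => v n p.1) atTop (𝓝 (T.indicator u p.1)) :=
    Measure.quasiMeasurePreserving_fst.ae (ae_restrict_of_ae hlim)
  have hlim2 : ∀ᵐ p ∂μ, Tendsto (fun n => v n p.2) atTop (𝓝 (T.indicator u p.2)) :=
    Measure.quasiMeasurePreserving_snd.ae (ae_restrict_of_ae hlim)
  have hbound : ∀ n, ∫⁻ p, F n p ∂μ ≤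
      ENNReal.ofReal h ^ 2 * (2 ^ d * volume T * ∫⁻ x in T, ‖G x‖ₑ ^ 2) := by
    intro n
    have hpt : ∀ᵐ p ∂μ, F n p ≤
        ∫⁻ t in Icc (0 : ℝ) 1, ENNReal.ofReal h ^ 2 * M n (p.2 + t • (p.1 - p.2)) := by
      filter_upwards [hμmem] with p hp
      by_cases hpA : p ∈ A n
      · simp only [F, indicator_of_mem hpA]
        refine (enorm_sub_sq_le_lintegral (hv n) p.1 p.2).trans ?_
        refine setLIntegral_mono' measurableSet_Icc fun t ht => ?_
        have hz : Metric.closedBall (p.2 + t • (p.1 - p.2)) (b n).rOut ⊆ T := by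
          intro w hwb
          by_contra hwT
          have h1 := hpA t ht w hwT
          have h2 : dist w (p.2 + t • (p.1 - p.2)) ≤ ε n := hwb
          rw [dist_comm] at h2
          linarith [hε n]
        refine (enorm_fderiv_mollify_sq_le (b n) hTm hu hG hw hg hgG hz _).trans ?_
        have h3 : ‖p.1 - p.2‖ₑ ≤ ENNReal.ofReal h := by
          rw [← ofReal_norm]
          exact ENNReal.ofReal_le_ofReal (hdiam _ hp.1 _ hp.2)
        gcongr
      · simp only [F, indicator_of_notMem hpA, zero_le]
    have hjoint : Measurable fun q : (EuclideanSpace ℝ (Fin d) × EuclideanSpace ℝ (Fin d)) × ℝ =>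
        ENNReal.ofReal h ^ 2 * M n (q.1.2 + q.2 • (q.1.1 - q.1.2)) := by
      have := hM n
      fun_prop
    calc ∫⁻ p, F n p ∂μ
        ≤ ∫⁻ p, (∫⁻ t in Icc (0 : ℝ) 1, ENNReal.ofReal h ^ 2 * M n (p.2 + t • (p.1 - p.2))) ∂μ :=
          lintegral_mono_ae hpt
      _ = ∫⁻ t in Icc (0 : ℝ) 1, ∫⁻ p, ENNReal.ofReal h ^ 2 * M n (p.2 + t • (p.1 - p.2)) ∂μ :=
          lintegral_lintegral_swap hjoint.aemeasurable
      _ ≤ ∫⁻ _ in Icc (0 : ℝ) 1, ENNReal.ofReal h ^ 2 * (2 ^ d * volume T * ∫⁻ z, M n z) := by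
          refine lintegral_mono fun t => ?_
          have hm : Measurable fun p : EuclideanSpace ℝ (Fin d) × EuclideanSpace ℝ (Fin d) =>
              M n (p.2 + t • (p.1 - p.2)) := by
            have := hM n
            fun_prop
          simp only
          rw [lintegral_const_mul _ hm, hμ, lintegral_prod _ hm.aemeasurable]
          gcongr
          exact lintegral_segment_le (hM n) (measure_mono hBT) t
      _ = _ := by
          rw [setLIntegral_const, Real.volume_Icc, sub_zero, ENNReal.ofReal_one, mul_one,
            lintegral_lmollify (b n) (hg.pow_const 2), hgint]
  -- By star-shapedness the segment is a compact subset of the open set `T`, hence every such pair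
  -- eventually belongs to `A n`. Fatou's lemma then carries the uniform bound to the limit.
  have hconv : ∀ᵐ p ∂μ, ‖u p.1 - u p.2‖ₑ ^ 2 = liminf (fun n => F n p) atTop := by
    filter_upwards [hμmem, hlim1, hlim2] with p hp h1 h2
    rw [indicator_of_mem hp.1] at h1
    rw [indicator_of_mem (hBT hp.2)] at h2
    have hK : IsCompact ((fun t : ℝ => p.2 + t • (p.1 - p.2)) '' Icc 0 1) :=
      isCompact_Icc.image (by fun_prop)
    have hKT : (fun t : ℝ => p.2 + t • (p.1 - p.2)) '' Icc 0 1 ⊆ T := by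
      rintro _ ⟨t, ht, rfl⟩
      have h3 := hstar p.2 hp.2 hp.1 (sub_nonneg.2 ht.2) ht.1 (sub_add_cancel 1 t)
      convert h3 using 1
      module
    obtain ⟨δ, hδ, hδT⟩ := hK.exists_thickening_subset_open hT hKT
    have hev : ∀ᶠ n in atTop, p ∈ A n := by
      filter_upwards [hε0.eventually_lt_const (half_pos hδ)] with n hn t ht w hwT
      by_contra! hlt
      refine hwT (hδT (Metric.mem_thickening_iff.2 ⟨_, ⟨t, ht, rfl⟩, ?_⟩))
      rw [dist_comm]
      simp only
      linarith
    refine (Tendsto.liminf_eq ?_).symm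
    have h4 : Tendsto (fun n => ‖v n p.1 - v n p.2‖ₑ ^ 2) atTop (𝓝 (‖u p.1 - u p.2‖ₑ ^ 2)) :=
      ((ENNReal.continuous_pow 2).tendsto _).comp ((continuous_enorm.tendsto _).comp (h1.sub h2))
    refine h4.congr' ?_
    filter_upwards [hev] with n hn
    simp only [F, indicator_of_mem hn]
  calc ∫⁻ p, ‖u p.1 - u p.2‖ₑ ^ 2 ∂μ = ∫⁻ p, liminf (fun n => F n p) atTop ∂μ :=
        lintegral_congr_ae hconv
    _ ≤ liminf (fun n => ∫⁻ p, F n p ∂μ) atTop := lintegral_liminf_le hF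
    _ ≤ _ := liminf_le_of_le (by isBoundedDefault) fun a ha =>
        (ha.exists.elim fun n hn => hn.trans (hbound n))

/-- Poincaré inequality: an `H¹` function on a set of diameter `h`, star-shaped with respect to a
ball, is close to some constant. -/
theorem exists_const_lintegral_sub_sq_le {T : Set (EuclideanSpace ℝ (Fin d))} (hT : IsOpen T)
    {x₀ : EuclideanSpace ℝ (Fin d)} {ρ h : ℝ} (hρ : 0 < ρ)
    (hstar : ∀ y ∈ Metric.ball x₀ ρ, y ∈ T ∧ StarConvex ℝ y T)
    (hdiam : ∀ x ∈ T, ∀ y ∈ T, ‖x - y‖ ≤ h) {u : EuclideanSpace ℝ (Fin d) → ℝ}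
    {G : EuclideanSpace ℝ (Fin d) → EuclideanSpace ℝ (Fin d)}
    (hu : IntegrableOn u T) (hG : IntegrableOn G T) (hw : HasWeakGradient T u G) :
    ∃ c : ℝ, volume (Metric.ball x₀ ρ) * ∫⁻ x in T, ‖u x - c‖ₑ ^ 2 ≤
      ENNReal.ofReal h ^ 2 * (2 ^ d * volume T * ∫⁻ x in T, ‖G x‖ₑ ^ 2) := by
  have hBT : Metric.ball x₀ ρ ⊆ T := fun y hy => (hstar y hy).1
  have hB0 : volume (Metric.ball x₀ ρ) ≠ 0 := (Metric.measure_ball_pos volume x₀ hρ).ne'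
  have hBtop : volume (Metric.ball x₀ ρ) ≠ ⊤ := measure_ball_lt_top.ne
  have h1 := lintegral_prod_sub_sq_le hT measurableSet_ball hBT (fun y hy => (hstar y hy).2)
    (fun x hx y hy => hdiam x hx y (hBT hy)) hu hG hw
  have hm1 : AEMeasurable (fun p : EuclideanSpace ℝ (Fin d) × EuclideanSpace ℝ (Fin d) => u p.1)
      ((volume.restrict T).prod (volume.restrict (Metric.ball x₀ ρ))) :=
    hu.aestronglyMeasurable.aemeasurable.comp_quasiMeasurePreserving
      Measure.quasiMeasurePreserving_fst
  have hm2 : AEMeasurable (fun p : EuclideanSpace ℝ (Fin d) × EuclideanSpace ℝ (Fin d) => u p.2)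
      ((volume.restrict T).prod (volume.restrict (Metric.ball x₀ ρ))) :=
    (hu.mono_set hBT).aestronglyMeasurable.aemeasurable.comp_quasiMeasurePreserving
      Measure.quasiMeasurePreserving_snd
  have hm : AEMeasurable (fun p : EuclideanSpace ℝ (Fin d) × EuclideanSpace ℝ (Fin d) =>
      ‖u p.1 - u p.2‖ₑ ^ 2) ((volume.restrict T).prod (volume.restrict (Metric.ball x₀ ρ))) :=
    (hm1.sub hm2).enorm.pow_const 2
  rw [lintegral_prod_symm _ hm] at h1
  have hmB : AEMeasurable (fun y => ∫⁻ x in T, ‖u x - u y‖ₑ ^ 2)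
      (volume.restrict (Metric.ball x₀ ρ)) := hm.prod_swap.lintegral_prod_right'
  -- Some `y` in the ball does no worse than the average over the ball; the constant is `u y`.
  obtain ⟨y, -, hy⟩ := exists_le_setLAverage hB0 hBtop hmB
  refine ⟨u y, ?_⟩
  rw [setLAverage_eq, ENNReal.le_div_iff_mul_le (Or.inl hB0) (Or.inl hBtop), mul_comm] at hy
  exact hy.trans h1

end PoincareStar

end Forchheimer

end

noncomputable section

namespace Forchheimer

/-! ### Inequalities on one element -/

theorem rpow_integral_le {α : Type*} [MeasurableSpace α] {μ : Measure α} [IsFiniteMeasure μ]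
    {p : ℝ} (hp : 1 < p) {f : α → ℝ} (hf0 : ∀ x, 0 ≤ f x) (hf : MemLp f (ENNReal.ofReal p) μ) :
    (∫ x, f x ∂μ) ^ p ≤ μ.real univ ^ (p - 1) * ∫ x, f x ^ p ∂μ := by
  have hp0 : 0 < p := by linarith
  have hconj : p.HolderConjugate (p / (p - 1)) := Real.HolderConjugate.conjExponent hp
  have h := integral_mul_le_Lp_mul_Lq_of_nonneg hconj (ae_of_all μ hf0)
    (ae_of_all μ fun _ => zero_le_one (α := ℝ)) hf (memLp_const 1)
  simp only [mul_one, Real.one_rpow, integral_const, smul_eq_mul] at h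
  have hI : 0 ≤ ∫ x, f x ^ p ∂μ := integral_nonneg fun x => Real.rpow_nonneg (hf0 x) _
  have h2 := Real.rpow_le_rpow (integral_nonneg hf0) h hp0.le
  rw [Real.mul_rpow (by positivity) (by positivity), ← Real.rpow_mul hI, ← Real.rpow_mul (by simp),
    one_div_mul_cancel hp0.ne', Real.rpow_one, one_div_div, div_mul_cancel₀ _ hp0.ne'] at h2
  linarith

section Element

variable {d : ℕ}

/-- The measure of the unit ball. -/
def unitBallVolume (d : ℕ) : ℝ :=
  (volume : Measure (EuclideanSpace ℝ (Fin d))).real (Metric.ball 0 1)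

theorem unitBallVolume_pos (d : ℕ) : 0 < unitBallVolume d :=
  ENNReal.toReal_pos (Metric.measure_ball_pos volume _ one_pos).ne' measure_ball_lt_top.ne

theorem volume_real_le {T : Set (EuclideanSpace ℝ (Fin d))} {x₀ : EuclideanSpace ℝ (Fin d)} {h : ℝ}
    (hh : 0 ≤ h) (hT : T ⊆ Metric.closedBall x₀ h) : volume.real T ≤ h ^ d * unitBallVolume d := by
  have h1 := Measure.addHaar_real_closedBall (volume : Measure (EuclideanSpace ℝ (Fin d))) x₀ hh
  rw [finrank_euclideanSpace_fin] at h1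
  rw [unitBallVolume, ← h1]
  exact measureReal_mono hT measure_closedBall_lt_top.ne

theorem integrableOn_of_continuous {F : Type*} [NormedAddCommGroup F]
    {f : EuclideanSpace ℝ (Fin d) → F} (hf : Continuous f) {T : Set (EuclideanSpace ℝ (Fin d))}
    {x₀ : EuclideanSpace ℝ (Fin d)} {h : ℝ} (hT : T ⊆ Metric.closedBall x₀ h) : IntegrableOn f T :=
  (hf.continuousOn.integrableOn_compact (isCompact_closedBall x₀ h)).mono_set hT

theorem memLp_of_continuous {F : Type*} [NormedAddCommGroup F]
    {f : EuclideanSpace ℝ (Fin d) → F} (hf : Continuous f) {T : Set (EuclideanSpace ℝ (Fin d))}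
    {x₀ : EuclideanSpace ℝ (Fin d)} {h : ℝ} (hT : T ⊆ Metric.closedBall x₀ h)
    (hTm : MeasurableSet T) (p : ENNReal) : MemLp f p (volume.restrict T) := by
  have hfin : IsFiniteMeasure (volume.restrict T) :=
    isFiniteMeasure_restrict.2 ((measure_mono hT).trans_lt measure_closedBall_lt_top).ne
  obtain ⟨C, hC⟩ := (isCompact_closedBall x₀ h).exists_bound_of_continuousOn hf.continuousOn
  exact MemLp.of_bound hf.aestronglyMeasurable C
    ((ae_restrict_iff' hTm).2 (ae_of_all _ fun x hx => hC x (hT hx)))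

/-- Inverse inequality on an element. -/
theorem exists_inverse_inequality {σ : ℝ} (hσ : 0 < σ) (d r : ℕ) : ∃ C : ℝ, 0 < C ∧
    ∀ (T : Set (EuclideanSpace ℝ (Fin d))) (x₀ : EuclideanSpace ℝ (Fin d)) (h : ℝ), 0 < h →
      MeasurableSet T → T ⊆ Metric.closedBall x₀ h → Metric.ball x₀ (σ * h) ⊆ T →
      ∀ p : MvPolynomial (Fin d) ℝ, p.totalDegree ≤ r →
      h ^ 2 * ∫ x in T, ‖polyGrad p x‖ ^ 2 ≤ C * ∫ x in T, ‖polyEval p x‖ ^ 2 := by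
  obtain ⟨C, hC, hCp⟩ := exists_norm_polyGrad_le hσ d r
  have hω := unitBallVolume_pos d
  refine ⟨C ^ 2 * unitBallVolume d ^ 2, by positivity, ?_⟩
  intro T x₀ h hh hTm hT hB p hp
  have : IsFiniteMeasure (volume.restrict (Metric.ball x₀ (σ * h))) :=
    isFiniteMeasure_restrict.2 measure_ball_lt_top.ne
  set B := Metric.ball x₀ (σ * h) with hBdef
  have hTvol := volume_real_le hh.le hT
  have hBvol := volume_real_le hh.le (hB.trans hT)
  have hc := continuous_polyEval p
  have hI : (∫ y in B, |polyEval p y|) ^ 2 ≤ volume.real B * ∫ y in T, ‖polyEval p y‖ ^ 2 := by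
    have h1 := rpow_integral_le (μ := volume.restrict B) one_lt_two
      (f := fun y => |polyEval p y|) (fun _ => abs_nonneg _)
      (memLp_of_continuous hc.abs (hB.trans hT) measurableSet_ball _)
    norm_num at h1
    refine h1.trans ?_
    gcongr
    simp only [Real.norm_eq_abs, sq_abs]
    exact setIntegral_mono_set (integrableOn_of_continuous (by fun_prop) hT)
      (ae_of_all _ fun y => sq_nonneg _) hB.eventuallyLE
  have hJ0 : 0 ≤ ∫ y in T, ‖polyEval p y‖ ^ 2 := integral_nonneg fun _ => sq_nonneg _
  set J := ∫ y in T, ‖polyEval p y‖ ^ 2 with hJ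
  -- The pointwise gradient bound by an `L¹` mean, followed by Cauchy–Schwarz on the ball.
  -- Integrating over `T` supplies the power of `h` that cancels the normalization.
  have hpt : ∀ x ∈ T, h ^ 2 * ‖polyGrad p x‖ ^ 2 ≤
      C ^ 2 * (h ^ d)⁻¹ ^ 2 * (volume.real B * J) := by
    intro x hx
    have h1 := hCp x₀ h hh p hp x (hT hx)
    have h2 := pow_le_pow_left₀ (by positivity) h1 2
    calc h ^ 2 * ‖polyGrad p x‖ ^ 2 = (h * ‖polyGrad p x‖) ^ 2 := by ring
      _ ≤ _ := h2
      _ = C ^ 2 * (h ^ d)⁻¹ ^ 2 * (∫ y in B, |polyEval p y|) ^ 2 := by ring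
      _ ≤ _ := by gcongr
  have hcg := continuous_polyGrad p
  have hfin : volume T ≠ ⊤ := ((measure_mono hT).trans_lt measure_closedBall_lt_top).ne
  calc h ^ 2 * ∫ x in T, ‖polyGrad p x‖ ^ 2 = ∫ x in T, h ^ 2 * ‖polyGrad p x‖ ^ 2 := by
        rw [integral_const_mul]
    _ ≤ ∫ _ in T, C ^ 2 * (h ^ d)⁻¹ ^ 2 * (volume.real B * J) :=
        setIntegral_mono_on (integrableOn_of_continuous (by fun_prop) hT)
          (integrableOn_const hfin) hTm hpt
    _ = volume.real T * (C ^ 2 * (h ^ d)⁻¹ ^ 2 * (volume.real B * J)) := by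
        rw [setIntegral_const, smul_eq_mul]
    _ ≤ (h ^ d * unitBallVolume d) * (C ^ 2 * (h ^ d)⁻¹ ^ 2 * ((h ^ d * unitBallVolume d) * J)) := by
        gcongr
    _ = C ^ 2 * unitBallVolume d ^ 2 * J := by field_simp

/-- Poincaré–Sobolev inequality for polynomials on an element. -/
theorem exists_poincare_sobolev {σ : ℝ} (hσ : 0 < σ) (d r : ℕ) {β : ℝ} (hβ : 1 < β)
    (hdβ : 0 ≤ β * (1 + d / 2) - d) {R : ℝ} (hR : 0 < R) : ∃ C : ℝ, 0 < C ∧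
    ∀ (T : Set (EuclideanSpace ℝ (Fin d))) (x₀ : EuclideanSpace ℝ (Fin d)) (h : ℝ), 0 < h → h ≤ R →
      MeasurableSet T → T ⊆ Metric.closedBall x₀ h → Metric.ball x₀ (σ * h) ⊆ T →
      ∀ p : MvPolynomial (Fin d) ℝ, p.totalDegree ≤ r →
      (∫ x in T, ‖polyEval p x - polyEval p x₀‖ ^ 2) ^ (β / 2) ≤
        C * ∫ x in T, ‖polyGrad p x‖ ^ β := by
  obtain ⟨C, hC, hCp⟩ := exists_norm_polyGrad_le_integral_norm hσ d r
  have hω := unitBallVolume_pos d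
  have hβ0 : 0 < β := by linarith
  refine ⟨unitBallVolume d ^ (β / 2) * (C ^ β * unitBallVolume d ^ (β - 1)) *
    R ^ (β * (1 + d / 2) - d), by positivity, ?_⟩
  intro T x₀ h hh hhR hTm hT hB p hp
  set v₁ := unitBallVolume d with hv₁def
  have : IsFiniteMeasure (volume.restrict (Metric.ball x₀ (σ * h))) :=
    isFiniteMeasure_restrict.2 measure_ball_lt_top.ne
  set B := Metric.ball x₀ (σ * h) with hBdef
  have hTvol := volume_real_le hh.le hT
  have hBvol := volume_real_le hh.le (hB.trans hT)
  have hc := continuous_polyEval p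
  have hcg := continuous_polyGrad p
  have hJ0 : 0 ≤ ∫ y in T, ‖polyGrad p y‖ ^ β := integral_nonneg fun _ => by positivity
  set I := ∫ y in B, ‖polyGrad p y‖ with hIdef
  have hI0 : 0 ≤ I := integral_nonneg fun _ => norm_nonneg _
  have hI : I ^ β ≤ volume.real B ^ (β - 1) * ∫ y in T, ‖polyGrad p y‖ ^ β := by
    have h1 := rpow_integral_le (μ := volume.restrict B) hβ
      (f := fun y => ‖polyGrad p y‖) (fun _ => norm_nonneg _)
      (memLp_of_continuous hcg.norm (hB.trans hT) measurableSet_ball _)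
    rw [measureReal_restrict_apply_univ] at h1
    refine h1.trans ?_
    refine mul_le_mul_of_nonneg_left ?_ (by positivity)
    exact setIntegral_mono_set
      (integrableOn_of_continuous (hcg.norm.rpow_const fun _ => Or.inr hβ0.le) hT)
      (ae_of_all _ fun y => by positivity) hB.eventuallyLE
  set J := ∫ y in T, ‖polyGrad p y‖ ^ β with hJ
  have hx₀ : x₀ ∈ Metric.closedBall x₀ h := Metric.mem_closedBall_self hh.le
  -- Mean value inequality on the convex ball of radius `h` rather than on `T`: the polynomial and
  -- its gradient bound make sense on the whole ball, so convexity of the element is not required.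
  have hpt : ∀ x ∈ T, ‖polyEval p x - polyEval p x₀‖ ^ 2 ≤ (C * ((h ^ d)⁻¹ * I) * h) ^ 2 := by
    intro x hx
    refine pow_le_pow_left₀ (norm_nonneg _) ?_ 2
    refine (Convex.norm_image_sub_le_of_norm_hasFDerivWithin_le (s := Metric.closedBall x₀ h)
      (f' := fun x => innerSL ℝ (polyGrad p x)) (C := C * ((h ^ d)⁻¹ * I))
      (fun y _ => (hasFDerivAt_polyEval p y).hasFDerivWithinAt) (fun y hy => ?_)
      (convex_closedBall x₀ h) hx₀ (hT hx)).trans ?_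
    · rw [innerSL_apply_norm]
      exact hCp x₀ h hh p hp y hy
    · have h2 : ‖x - x₀‖ ≤ h := by rw [← dist_eq_norm]; exact hT hx
      gcongr
  have hfin : volume T ≠ ⊤ := ((measure_mono hT).trans_lt measure_closedBall_lt_top).ne
  have h3 : ∫ x in T, ‖polyEval p x - polyEval p x₀‖ ^ 2 ≤
      (h ^ d * v₁) * (C * ((h ^ d)⁻¹ * I) * h) ^ 2 := by
    calc ∫ x in T, ‖polyEval p x - polyEval p x₀‖ ^ 2
        ≤ ∫ _ in T, (C * ((h ^ d)⁻¹ * I) * h) ^ 2 :=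
          setIntegral_mono_on (integrableOn_of_continuous (by fun_prop) hT)
            (integrableOn_const hfin) hTm hpt
      _ = volume.real T * (C * ((h ^ d)⁻¹ * I) * h) ^ 2 := by rw [setIntegral_const, smul_eq_mul]
      _ ≤ _ := by gcongr
  have hIh : I ^ β ≤ (h ^ d * v₁) ^ (β - 1) * J :=
    hI.trans (by gcongr)
  -- Scaling count: `dβ/2 - dβ + d(β - 1) + β = β(1 + d/2) - d`. This exponent is nonnegative by
  -- assumption, so its power of `h` is bounded by that of `R`.
  have hpow : (h ^ d * v₁) ^ (β / 2) * (C ^ β * ((h ^ d)⁻¹ ^ β * ((h ^ d * v₁) ^ (β - 1) * J)) * h ^ β) =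
      v₁ ^ (β / 2) * (C ^ β * v₁ ^ (β - 1)) * h ^ (β * (1 + d / 2) - d) * J := by
    have e1 : (h ^ d : ℝ) = h ^ (d : ℝ) := (Real.rpow_natCast h d).symm
    have e2 : h ^ (β * (1 + d / 2) - d) = h ^ ((d : ℝ) * (β / 2)) * (h ^ (-(d : ℝ) * β) *
        h ^ ((d : ℝ) * (β - 1))) * h ^ β := by
      rw [← Real.rpow_add hh, ← Real.rpow_add hh, ← Real.rpow_add hh]
      congr 1; ring
    rw [Real.mul_rpow (by positivity) hω.le, Real.mul_rpow (by positivity) hω.le, e1,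
      ← Real.rpow_neg hh.le, ← Real.rpow_mul hh.le, ← Real.rpow_mul hh.le, ← Real.rpow_mul hh.le, e2]
    ring
  calc (∫ x in T, ‖polyEval p x - polyEval p x₀‖ ^ 2) ^ (β / 2)
      ≤ ((h ^ d * v₁) * (C * ((h ^ d)⁻¹ * I) * h) ^ 2) ^ (β / 2) :=
        Real.rpow_le_rpow (integral_nonneg fun _ => by positivity) h3 (by positivity)
    _ = (h ^ d * v₁) ^ (β / 2) * (C * ((h ^ d)⁻¹ * I) * h) ^ β := by
        rw [Real.mul_rpow (by positivity) (by positivity), ← Real.rpow_natCast _ 2,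
          ← Real.rpow_mul (by positivity) _ (β / 2)]
        congr 2
        push_cast; ring
    _ = (h ^ d * v₁) ^ (β / 2) * (C ^ β * ((h ^ d)⁻¹ ^ β * I ^ β) * h ^ β) := by
        rw [Real.mul_rpow (by positivity) hh.le, Real.mul_rpow hC.le (by positivity),
          Real.mul_rpow (by positivity) hI0]
    _ ≤ (h ^ d * v₁) ^ (β / 2) * (C ^ β * ((h ^ d)⁻¹ ^ β * ((h ^ d * v₁) ^ (β - 1) * J)) * h ^ β) := by
        gcongr
    _ = v₁ ^ (β / 2) * (C ^ β * v₁ ^ (β - 1)) * h ^ (β * (1 + d / 2) - d) * J := hpow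
    _ ≤ _ := by gcongr

end Element

end Forchheimer

end

noncomputable section

namespace Forchheimer

/-! ### Meshes -/

theorem norm_sq_eq_integral {α F : Type*} [MeasurableSpace α] {μ : Measure α}
    [NormedAddCommGroup F] [InnerProductSpace ℝ F] (f : Lp F 2 μ) :
    ‖f‖ ^ 2 = ∫ x, ‖f x‖ ^ 2 ∂μ := by
  rw [← real_inner_self_eq_norm_sq, L2.inner_def]
  simp only [real_inner_self_eq_norm_sq]

theorem lpNorm_eq_norm {α F : Type*} [MeasurableSpace α] {μ : Measure α}
    [NormedAddCommGroup F] {f : α → F} {g : Lp F 2 μ} (h : f =ᵐ[μ] g) : lpNorm f 2 μ = ‖g‖ := by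
  have hf : AEStronglyMeasurable f μ := (Lp.aestronglyMeasurable g).congr h.symm
  rw [← toReal_eLpNorm hf, Lp.norm_def, eLpNorm_congr_ae h]

section Mesh

variable {d : ℕ} {Ω : Set (EuclideanSpace ℝ (Fin d))} {σ h : ℝ}
  {𝒯 : Finset (Set (EuclideanSpace ℝ (Fin d)))}

namespace IsQuasiUniformMesh

/-- A nonempty open set in positive dimension has two distinct points; boundedness excludes the
default value 0 that `Metric.diam` takes on unbounded sets. -/
theorem h_pos (hm : IsQuasiUniformMesh Ω σ h 𝒯) (hd : 1 ≤ d) (hΩ : Bornology.IsBounded Ω) :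
    0 < h := by
  obtain ⟨T, hT, rfl⟩ := hm.size.1
  obtain ⟨x, hx⟩ := hm.nonempty T hT
  have : Nontrivial (EuclideanSpace ℝ (Fin d)) :=
    Module.nontrivial_of_finrank_pos (R := ℝ) (by rw [finrank_euclideanSpace_fin]; omega)
  have hn : (𝓝[≠] x).NeBot := Module.punctured_nhds_neBot ℝ (EuclideanSpace ℝ (Fin d)) x
  exact Metric.diam_pos (infinite_of_mem_nhds x ((hm.isOpen T hT).mem_nhds hx)).nontrivial
    (hΩ.subset (hm.subset T hT))

theorem h_le (hm : IsQuasiUniformMesh Ω σ h 𝒯) (hΩ : Bornology.IsBounded Ω) :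
    h ≤ Metric.diam Ω := by
  obtain ⟨T, hT, rfl⟩ := hm.size.1
  exact Metric.diam_mono (hm.subset T hT) hΩ

theorem norm_sub_le (hm : IsQuasiUniformMesh Ω σ h 𝒯) (hΩ : Bornology.IsBounded Ω)
    {T : Set (EuclideanSpace ℝ (Fin d))} (hT : T ∈ 𝒯) : ∀ x ∈ T, ∀ y ∈ T, ‖x - y‖ ≤ h := by
  intro x hx y hy
  rw [← dist_eq_norm]
  exact (Metric.dist_le_diam_of_mem (hΩ.subset (hm.subset T hT)) hx hy).trans
    (hm.size.2 ⟨T, hT, rfl⟩)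

theorem exists_center (hm : IsQuasiUniformMesh Ω σ h 𝒯) (hd : 1 ≤ d) (hΩ : Bornology.IsBounded Ω)
    (hσ : 0 < σ) {T : Set (EuclideanSpace ℝ (Fin d))} (hT : T ∈ 𝒯) :
    ∃ x₀, T ⊆ Metric.closedBall x₀ h ∧ Metric.ball x₀ (σ * h) ⊆ T ∧
      ∀ y ∈ Metric.ball x₀ (σ * h), y ∈ T ∧ StarConvex ℝ y T := by
  obtain ⟨x₀, hx₀⟩ := hm.star T hT
  have h0 : x₀ ∈ T := (hx₀ x₀ (Metric.mem_ball_self (mul_pos hσ (hm.h_pos hd hΩ)))).1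
  refine ⟨x₀, fun x hx => ?_, fun y hy => (hx₀ y hy).1, hx₀⟩
  rw [mem_closedBall_iff_norm]
  exact hm.norm_sub_le hΩ hT x hx x₀ h0

theorem restrict_eq (hm : IsQuasiUniformMesh Ω σ h 𝒯) :
    volume.restrict Ω = volume.restrict (⋃ T ∈ 𝒯, T) := by
  refine Measure.restrict_congr_set (eventuallyLE_antisymm_iff.2 ⟨?_, ?_⟩)
  · exact ae_le_set.2 hm.cover
  · exact (iUnion₂_subset hm.subset).eventuallyLE

theorem ae_mem (hm : IsQuasiUniformMesh Ω σ h 𝒯) :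
    ∀ᵐ x ∂volume.restrict Ω, ∃ T ∈ 𝒯, x ∈ T := by
  rw [hm.restrict_eq]
  have hmeas : MeasurableSet (⋃ T ∈ 𝒯, T) :=
    Finset.measurableSet_biUnion _ fun T hT => (hm.isOpen T hT).measurableSet
  filter_upwards [ae_restrict_mem hmeas] with x hx
  simpa using hx

theorem integral_eq_sum (hm : IsQuasiUniformMesh Ω σ h 𝒯) {f : EuclideanSpace ℝ (Fin d) → ℝ}
    {g : 𝒯 → EuclideanSpace ℝ (Fin d) → ℝ} (hfg : ∀ T : 𝒯, f =ᵐ[volume.restrict T.1] g T)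
    (hg : ∀ T : 𝒯, IntegrableOn (g T) T.1) :
    ∫ x in Ω, f x = ∑ T : 𝒯, ∫ x in T.1, g T x := by
  rw [hm.restrict_eq, integral_biUnion_finset 𝒯
    (fun T hT => (hm.isOpen T hT).measurableSet)
    (fun T hT T' hT' hne => hm.disjoint T hT T' hT' hne)
    (fun T hT => (hg ⟨T, hT⟩).congr (hfg ⟨T, hT⟩).symm), ← Finset.sum_coe_sort]
  exact Finset.sum_congr rfl fun T _ => integral_congr_ae (hfg T)

end IsQuasiUniformMesh

/-! ### Piecewise polynomials as a finite-dimensional space -/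

variable {r : ℕ}

/-- The piecewise function with the values `f T` on the elements `T`. -/
def piecewise {F : Type*} [AddCommMonoid F] (f : 𝒯 → EuclideanSpace ℝ (Fin d) → F)
    (x : EuclideanSpace ℝ (Fin d)) : F :=
  ∑ T : 𝒯, (T.1).indicator (f T) x

theorem piecewise_of_mem {F : Type*} [AddCommMonoid F] (hm : IsQuasiUniformMesh Ω σ h 𝒯)
    (f : 𝒯 → EuclideanSpace ℝ (Fin d) → F) (T : 𝒯) {x : EuclideanSpace ℝ (Fin d)} (hx : x ∈ T.1) :
    piecewise f x = f T x := by
  rw [piecewise, Finset.sum_eq_single T]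
  · exact indicator_of_mem hx _
  · intro T' _ hne
    refine indicator_of_notMem (fun hx' => ?_) _
    exact (hm.disjoint T'.1 T'.2 T.1 T.2 (fun h => hne (Subtype.ext h))).le_bot ⟨hx', hx⟩
  · simp

theorem memLp_piecewise {F : Type*} [NormedAddCommGroup F] (hm : IsQuasiUniformMesh Ω σ h 𝒯)
    {p : ENNReal} {f : 𝒯 → EuclideanSpace ℝ (Fin d) → F}
    (hf : ∀ T : 𝒯, MemLp (f T) p (volume.restrict T.1)) :
    MemLp (piecewise f) p (volume.restrict Ω) := by
  unfold piecewise
  refine memLp_finsetSum _ fun T _ => ?_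
  rw [memLp_indicator_iff_restrict (hm.isOpen T.1 T.2).measurableSet,
    Measure.restrict_restrict (hm.isOpen T.1 T.2).measurableSet,
    inter_eq_left.2 (hm.subset T.1 T.2)]
  exact hf T

/-- Families of polynomials of degree at most `r`, one for each element. -/
abbrev PolyFamily (𝒯 : Finset (Set (EuclideanSpace ℝ (Fin d)))) (r : ℕ) : Type :=
  𝒯 → MvPolynomial.restrictTotalDegree (Fin d) ℝ r

theorem memLp_feVal (hm : IsQuasiUniformMesh Ω σ h 𝒯) (hd : 1 ≤ d) (hΩ : Bornology.IsBounded Ω)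
    (hσ : 0 < σ) (m : PolyFamily 𝒯 r) :
    MemLp (piecewise fun T => polyEval (m T).1) 2 (volume.restrict Ω) :=
  memLp_piecewise hm fun T => by
    obtain ⟨x₀, hx₀, -⟩ := hm.exists_center hd hΩ hσ T.2
    exact memLp_of_continuous (continuous_polyEval _) hx₀ (hm.isOpen T.1 T.2).measurableSet _

theorem memLp_feGrad (hm : IsQuasiUniformMesh Ω σ h 𝒯) (hd : 1 ≤ d) (hΩ : Bornology.IsBounded Ω)
    (hσ : 0 < σ) (m : PolyFamily 𝒯 r) :
    MemLp (piecewise fun T => polyGrad (m T).1) 2 (volume.restrict Ω) :=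
  memLp_piecewise hm fun T => by
    obtain ⟨x₀, hx₀, -⟩ := hm.exists_center hd hΩ hσ T.2
    exact memLp_of_continuous (continuous_polyGrad _) hx₀ (hm.isOpen T.1 T.2).measurableSet _

theorem piecewise_add {F : Type*} [AddCommMonoid F] (f g : 𝒯 → EuclideanSpace ℝ (Fin d) → F)
    (x : EuclideanSpace ℝ (Fin d)) :
    piecewise (fun T x => f T x + g T x) x = piecewise f x + piecewise g x := by
  simp only [piecewise, ← Finset.sum_add_distrib]
  refine Finset.sum_congr rfl fun T _ => ?_
  by_cases hx : x ∈ T.1 <;> simp [hx]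

theorem piecewise_smul {F : Type*} [AddCommMonoid F] [Module ℝ F] (c : ℝ)
    (f : 𝒯 → EuclideanSpace ℝ (Fin d) → F) (x : EuclideanSpace ℝ (Fin d)) :
    piecewise (fun T x => c • f T x) x = c • piecewise f x := by
  simp only [piecewise, Finset.smul_sum]
  refine Finset.sum_congr rfl fun T _ => ?_
  by_cases hx : x ∈ T.1 <;> simp [hx]

/-- The piecewise polynomial of a family, in `L²(Ω)`. -/
def feVal (hm : IsQuasiUniformMesh Ω σ h 𝒯) (hd : 1 ≤ d) (hΩ : Bornology.IsBounded Ω)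
    (hσ : 0 < σ) (r : ℕ) : PolyFamily 𝒯 r →ₗ[ℝ] Lp ℝ 2 (volume.restrict Ω) where
  toFun m := (memLp_feVal hm hd hΩ hσ m).toLp
  map_add' m n := by
    rw [← MemLp.toLp_add, MemLp.toLp_eq_toLp_iff]
    refine ae_of_all _ fun x => ?_
    simp only [Pi.add_apply, ← piecewise_add, ← polyEval_add]
    rfl
  map_smul' c m := by
    rw [RingHom.id_apply, ← MemLp.toLp_const_smul, MemLp.toLp_eq_toLp_iff]
    refine ae_of_all _ fun x => ?_
    simp only [Pi.smul_apply, ← piecewise_smul]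
    simp only [smul_eq_mul, ← polyEval_smul]
    rfl

/-- The elementwise gradient of the piecewise polynomial of a family, in `L²(Ω)`. -/
def feGrad (hm : IsQuasiUniformMesh Ω σ h 𝒯) (hd : 1 ≤ d) (hΩ : Bornology.IsBounded Ω)
    (hσ : 0 < σ) (r : ℕ) :
    PolyFamily 𝒯 r →ₗ[ℝ] Lp (EuclideanSpace ℝ (Fin d)) 2 (volume.restrict Ω) where
  toFun m := (memLp_feGrad hm hd hΩ hσ m).toLp
  map_add' m n := by
    rw [← MemLp.toLp_add, MemLp.toLp_eq_toLp_iff]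
    refine ae_of_all _ fun x => ?_
    simp only [Pi.add_apply, ← piecewise_add, ← polyGrad_add]
    rfl
  map_smul' c m := by
    rw [RingHom.id_apply, ← MemLp.toLp_const_smul, MemLp.toLp_eq_toLp_iff]
    refine ae_of_all _ fun x => ?_
    simp only [Pi.smul_apply, ← piecewise_smul, ← polyGrad_smul]
    rfl

theorem feVal_ae (hm : IsQuasiUniformMesh Ω σ h 𝒯) (hd : 1 ≤ d) (hΩ : Bornology.IsBounded Ω)
    (hσ : 0 < σ) (m : PolyFamily 𝒯 r) (T : 𝒯) :
    feVal hm hd hΩ hσ r m =ᵐ[volume.restrict T.1] polyEval (m T).1 := by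
  have h1 := ae_restrict_of_ae_restrict_of_subset (hm.subset T.1 T.2)
    (memLp_feVal hm hd hΩ hσ m).coeFn_toLp
  filter_upwards [h1, ae_restrict_mem (hm.isOpen T.1 T.2).measurableSet] with x hx hxT
  exact hx.trans (piecewise_of_mem hm _ T hxT)

theorem feGrad_ae (hm : IsQuasiUniformMesh Ω σ h 𝒯) (hd : 1 ≤ d) (hΩ : Bornology.IsBounded Ω)
    (hσ : 0 < σ) (m : PolyFamily 𝒯 r) (T : 𝒯) :
    feGrad hm hd hΩ hσ r m =ᵐ[volume.restrict T.1] polyGrad (m T).1 := by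
  have h1 := ae_restrict_of_ae_restrict_of_subset (hm.subset T.1 T.2)
    (memLp_feGrad hm hd hΩ hσ m).coeFn_toLp
  filter_upwards [h1, ae_restrict_mem (hm.isOpen T.1 T.2).measurableSet] with x hx hxT
  exact hx.trans (piecewise_of_mem hm _ T hxT)

theorem integral_comp_feGrad (hm : IsQuasiUniformMesh Ω σ h 𝒯) (hd : 1 ≤ d)
    (hΩ : Bornology.IsBounded Ω) (hσ : 0 < σ) (m : PolyFamily 𝒯 r)
    {Ψ : EuclideanSpace ℝ (Fin d) → ℝ} (hΨ : Continuous Ψ) :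
    ∫ x in Ω, Ψ (feGrad hm hd hΩ hσ r m x) = ∑ T : 𝒯, ∫ x in T.1, Ψ (polyGrad (m T).1 x) := by
  refine hm.integral_eq_sum (g := fun T x => Ψ (polyGrad (m T).1 x)) (fun T => ?_) (fun T => ?_)
  · filter_upwards [feGrad_ae hm hd hΩ hσ m T] with x hx
    rw [hx]
  · obtain ⟨x₀, hx₀, -⟩ := hm.exists_center hd hΩ hσ T.2
    exact integrableOn_of_continuous (hΨ.comp (continuous_polyGrad _)) hx₀

theorem integral_comp_feVal (hm : IsQuasiUniformMesh Ω σ h 𝒯) (hd : 1 ≤ d)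
    (hΩ : Bornology.IsBounded Ω) (hσ : 0 < σ) (m : PolyFamily 𝒯 r)
    {Ψ : ℝ → ℝ} (hΨ : Continuous Ψ) :
    ∫ x in Ω, Ψ (feVal hm hd hΩ hσ r m x) = ∑ T : 𝒯, ∫ x in T.1, Ψ (polyEval (m T).1 x) := by
  refine hm.integral_eq_sum (g := fun T x => Ψ (polyEval (m T).1 x)) (fun T => ?_) (fun T => ?_)
  · filter_upwards [feVal_ae hm hd hΩ hσ m T] with x hx
    rw [hx]
  · obtain ⟨x₀, hx₀, -⟩ := hm.exists_center hd hΩ hσ T.2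
    exact integrableOn_of_continuous (hΨ.comp (continuous_polyEval _)) hx₀

/-- The family of constant polynomials with given values. -/
def constFamily (𝒯 : Finset (Set (EuclideanSpace ℝ (Fin d)))) (r : ℕ) :
    (𝒯 → ℝ) →ₗ[ℝ] PolyFamily 𝒯 r :=
  LinearMap.pi fun T => (LinearMap.proj T).smulRight
    ⟨1, (MvPolynomial.mem_restrictTotalDegree _ _ _).2 (by simp)⟩

theorem coe_constFamily (c : 𝒯 → ℝ) (T : 𝒯) :
    (constFamily 𝒯 r c T).1 = MvPolynomial.C (c T) := by
  simp [constFamily, MvPolynomial.smul_eq_C_mul]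

theorem polyEval_C (c : ℝ) (x : EuclideanSpace ℝ (Fin d)) :
    polyEval (MvPolynomial.C c) x = c := by simp [polyEval]

end Mesh

end Forchheimer

end

/-! ### The discrete gradient and its mesh-independent inequalities -/

noncomputable section

namespace Forchheimer

section DiscreteGradient

variable {d : ℕ}

/-- `S` is the space of piecewise polynomials as a subspace of `L²(Ω)`, `S₀` contains piecewise
constants, and `G` is the elementwise gradient on `S`, with the inverse inequality and the
Poincaré inequalities relating them. -/
structure IsDiscreteGradient (Ω : Set (EuclideanSpace ℝ (Fin d)))
    (𝒯 : Finset (Set (EuclideanSpace ℝ (Fin d)))) (r : ℕ) (β C h : ℝ)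
    (S S₀ : Submodule ℝ (Lp ℝ 2 (volume.restrict Ω)))
    (G : Lp ℝ 2 (volume.restrict Ω) →L[ℝ]
      Lp (EuclideanSpace ℝ (Fin d)) 2 (volume.restrict Ω)) : Prop where
  finite : FiniteDimensional ℝ S
  finite_const : FiniteDimensional ℝ S₀
  const_le : S₀ ≤ S
  exists_class : ∀ w ∈ feSpace 𝒯 r, ∃ s ∈ S, w =ᵐ[volume.restrict Ω] s ∧
    gradient w =ᵐ[volume.restrict Ω] G s
  exists_rep : ∀ s ∈ S, ∃ w ∈ feSpace 𝒯 r, w =ᵐ[volume.restrict Ω] s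
  map_const : ∀ c ∈ S₀, G c = 0
  inverse : ∀ s ∈ S, h * ‖G s‖ ≤ C * ‖s‖
  sobolev : ∀ s ∈ S, ∃ c ∈ S₀, ‖s - c‖ ^ β ≤ C * ∫ x in Ω, ‖G s x‖ ^ β
  poincare : ∀ (u : EuclideanSpace ℝ (Fin d) → ℝ)
    (g : EuclideanSpace ℝ (Fin d) → EuclideanSpace ℝ (Fin d)), MemLp g 2 (volume.restrict Ω) →
    HasWeakGradient Ω u g → ∀ s : Lp ℝ 2 (volume.restrict Ω), u =ᵐ[volume.restrict Ω] s →
    ∃ c ∈ S₀, ‖s - c‖ ≤ C * h * lpNorm g 2 (volume.restrict Ω)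

/-- Subadditivity of concave powers. With `p = β / 2 ≤ 1` it sums the elementwise Sobolev estimates
without a factor depending on the number of elements. -/
theorem rpow_sum_le_sum_rpow {ι : Type*} (s : Finset ι) {f : ι → ℝ} (hf : ∀ i ∈ s, 0 ≤ f i) {p : ℝ}
    (hp : 0 < p) (hp1 : p ≤ 1) : (∑ i ∈ s, f i) ^ p ≤ ∑ i ∈ s, f i ^ p := by
  classical
  induction s using Finset.induction_on with
  | empty => simp [Real.zero_rpow hp.ne']
  | insert a s ha ih =>
    rw [Finset.sum_insert ha, Finset.sum_insert ha]
    have h1 := ih fun i hi => hf i (Finset.mem_insert_of_mem hi)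
    have h2 := Real.rpow_add_le_add_rpow (hf a (Finset.mem_insert_self a s))
      (Finset.sum_nonneg fun i hi => hf i (Finset.mem_insert_of_mem hi)) hp.le hp1
    linarith

/-- A linear map factors boundedly through another one with smaller kernel. -/
theorem exists_clm_factor {M X Y : Type*} [AddCommGroup M] [Module ℝ M] [FiniteDimensional ℝ M]
    [NormedAddCommGroup X] [InnerProductSpace ℝ X] [NormedAddCommGroup Y] [NormedSpace ℝ Y]
    (A : M →ₗ[ℝ] X) (B : M →ₗ[ℝ] Y) (h : ∀ m, A m = 0 → B m = 0) :
    ∃ G : X →L[ℝ] Y, ∀ m, G (A m) = B m := by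
  obtain ⟨g, hg⟩ := LinearMap.exists_rightInverse_of_surjective A.rangeRestrict
    (LinearMap.range_rangeRestrict A)
  -- Defined on the finite-dimensional range of `A`, then extended by zero to its orthogonal
  -- complement; the kernel condition makes the choice of preimage irrelevant.
  let G₀ : LinearMap.range A →L[ℝ] Y := LinearMap.toContinuousLinearMap (B ∘ₗ g)
  refine ⟨G₀ ∘L (LinearMap.range A).orthogonalProjectionOnto, fun m => ?_⟩
  have h1 : (LinearMap.range A).orthogonalProjectionOnto (A m) = A.rangeRestrict m :=
    Submodule.orthogonalProjectionOnto_mem_subspace_eq_self (A.rangeRestrict m)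
  rw [ContinuousLinearMap.comp_apply, h1]
  have h2 : A (g (A.rangeRestrict m) - m) = 0 := by
    have h3 := LinearMap.congr_fun hg (A.rangeRestrict m)
    have h4 : A (g (A.rangeRestrict m)) = A m := congrArg Subtype.val h3
    rw [map_sub, h4, sub_self]
  have h5 := h _ h2
  rw [map_sub, sub_eq_zero] at h5
  exact h5

variable {Ω : Set (EuclideanSpace ℝ (Fin d))} {σ h : ℝ}
  {𝒯 : Finset (Set (EuclideanSpace ℝ (Fin d)))}

/-- Poincaré inequality on a mesh: approximation of `H¹` functions by piecewise constants. -/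
theorem exists_const_norm_sub_le (hm : IsQuasiUniformMesh Ω σ h 𝒯) (hd : 1 ≤ d) (hΩo : IsOpen Ω)
    (hΩ : Bornology.IsBounded Ω) (hσ : 0 < σ) (r : ℕ) {u : EuclideanSpace ℝ (Fin d) → ℝ}
    {g : EuclideanSpace ℝ (Fin d) → EuclideanSpace ℝ (Fin d)}
    (hg : MemLp g 2 (volume.restrict Ω)) (hw : HasWeakGradient Ω u g)
    {s : Lp ℝ 2 (volume.restrict Ω)} (hs : u =ᵐ[volume.restrict Ω] s) :
    ∃ c : 𝒯 → ℝ, ‖s - feVal hm hd hΩ hσ r (constFamily 𝒯 r c)‖ ≤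
      √(2 ^ d / σ ^ d) * h * lpNorm g 2 (volume.restrict Ω) := by
  have hh := hm.h_pos hd hΩ
  have hfin : IsFiniteMeasure (volume.restrict Ω) :=
    isFiniteMeasure_restrict.2 hΩ.measure_lt_top.ne
  have hu : MemLp u 2 (volume.restrict Ω) := (Lp.memLp s).ae_eq hs.symm
  have huI : IntegrableOn u Ω := hu.integrable one_le_two
  have hgI : IntegrableOn g Ω := hg.integrable one_le_two
  have hg2 : IntegrableOn (fun x => ‖g x‖ ^ 2) Ω := hg.integrable_norm_pow two_ne_zero
  have key : ∀ T : 𝒯, ∃ c : ℝ,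
      ∫ x in T.1, ‖u x - c‖ ^ 2 ≤ 2 ^ d / σ ^ d * h ^ 2 * ∫ x in T.1, ‖g x‖ ^ 2 := by
    intro T
    have hTΩ := hm.subset T.1 T.2
    obtain ⟨x₀, hT, hB, hstar⟩ := hm.exists_center hd hΩ hσ T.2
    obtain ⟨c, hc⟩ := exists_const_lintegral_sub_sq_le (hm.isOpen T.1 T.2) (mul_pos hσ hh) hstar
      (hm.norm_sub_le hΩ T.2) (huI.mono_set hTΩ) (hgI.mono_set hTΩ)
      (hw.mono hΩo.measurableSet hTΩ)
    refine ⟨c, ?_⟩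
    have hfinT : IsFiniteMeasure (volume.restrict T.1) :=
      isFiniteMeasure_restrict.2 ((measure_mono hTΩ).trans_lt hΩ.measure_lt_top).ne
    have hucL : MemLp (fun x => u x - c) 2 (volume.restrict T.1) :=
      (hu.mono_measure (Measure.restrict_mono hTΩ le_rfl)).sub (memLp_const c)
    have huc : IntegrableOn (fun x => ‖u x - c‖ ^ 2) T.1 :=
      hucL.integrable_norm_pow two_ne_zero
    have e1 : ∫⁻ x in T.1, ‖u x - c‖ₑ ^ 2 = ENNReal.ofReal (∫ x in T.1, ‖u x - c‖ ^ 2) := by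
      rw [ofReal_integral_eq_lintegral_ofReal huc (ae_of_all _ fun x => sq_nonneg _)]
      simp only [ENNReal.ofReal_pow (norm_nonneg _), ofReal_norm]
    have e2 : ∫⁻ x in T.1, ‖g x‖ₑ ^ 2 = ENNReal.ofReal (∫ x in T.1, ‖g x‖ ^ 2) := by
      rw [ofReal_integral_eq_lintegral_ofReal (hg2.mono_set hTΩ) (ae_of_all _ fun x => sq_nonneg _)]
      simp only [ENNReal.ofReal_pow (norm_nonneg _), ofReal_norm]
    have hTtop : volume T.1 ≠ ⊤ := ((measure_mono hTΩ).trans_lt hΩ.measure_lt_top).ne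
    have hBvol : volume.real (Metric.ball x₀ (σ * h)) = (σ * h) ^ d * unitBallVolume d := by
      have h1 := Measure.addHaar_ball_of_pos (volume : Measure (EuclideanSpace ℝ (Fin d))) x₀
        (mul_pos hσ hh)
      rw [finrank_euclideanSpace_fin] at h1
      rw [Measure.real, h1, ENNReal.toReal_mul, ENNReal.toReal_ofReal (by positivity)]
      rfl
    have hc' : volume.real (Metric.ball x₀ (σ * h)) * ∫ x in T.1, ‖u x - c‖ ^ 2 ≤
        h ^ 2 * (2 ^ d * volume.real T.1 * ∫ x in T.1, ‖g x‖ ^ 2) := by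
      have hI1 : 0 ≤ ∫ x in T.1, ‖u x - c‖ ^ 2 := integral_nonneg fun _ => sq_nonneg _
      have hI2 : 0 ≤ ∫ x in T.1, ‖g x‖ ^ 2 := integral_nonneg fun _ => sq_nonneg _
      rw [e1, e2] at hc
      have hne : ENNReal.ofReal h ^ 2 *
          (2 ^ d * volume T.1 * ENNReal.ofReal (∫ x in T.1, ‖g x‖ ^ 2)) ≠ ⊤ := by
        finiteness
      have := ENNReal.toReal_mono hne hc
      simpa only [ENNReal.toReal_mul, ENNReal.toReal_pow, ENNReal.toReal_ofReal hI1,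
        ENNReal.toReal_ofReal hI2, ENNReal.toReal_ofReal hh.le, ENNReal.toReal_ofNat,
        Measure.real] using this
    have hω := unitBallVolume_pos d
    rw [hBvol] at hc'
    have h2 : (σ * h) ^ d * unitBallVolume d * ∫ x in T.1, ‖u x - c‖ ^ 2 ≤
        h ^ 2 * (2 ^ d * (h ^ d * unitBallVolume d) * ∫ x in T.1, ‖g x‖ ^ 2) := by
      refine hc'.trans ?_
      have := volume_real_le hh.le hT
      gcongr
    -- The element lies in a ball of radius `h` and contains one of radius `σ h`; their volume ratio
    -- leaves a constant depending only on `d` and `σ`.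
    have h3 : h ^ 2 * (2 ^ d * (h ^ d * unitBallVolume d) * ∫ x in T.1, ‖g x‖ ^ 2) =
        (σ * h) ^ d * unitBallVolume d * (2 ^ d / σ ^ d * h ^ 2 * ∫ x in T.1, ‖g x‖ ^ 2) := by
      rw [mul_pow]; field_simp
    rw [h3] at h2
    exact le_of_mul_le_mul_left h2 (by positivity)
  choose c hc using key
  refine ⟨c, ?_⟩
  have hg0 : 0 ≤ lpNorm g 2 (volume.restrict Ω) := lpNorm_nonneg
  refine le_of_sq_le_sq ?_ (by positivity)
  have hgsq : lpNorm g 2 (volume.restrict Ω) ^ 2 = ∫ x in Ω, ‖g x‖ ^ 2 := by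
    rw [lpNorm_eq_norm hg.coeFn_toLp.symm, norm_sq_eq_integral]
    refine integral_congr_ae ?_
    filter_upwards [hg.coeFn_toLp] with x hx
    rw [hx]
  rw [mul_pow, mul_pow, Real.sq_sqrt (by positivity), hgsq, norm_sq_eq_integral]
  have e3 : ∫ x in Ω, ‖(s - feVal hm hd hΩ hσ r (constFamily 𝒯 r c) :
      Lp ℝ 2 (volume.restrict Ω)) x‖ ^ 2 = ∑ T : 𝒯, ∫ x in T.1, ‖u x - c T‖ ^ 2 := by
    refine hm.integral_eq_sum (g := fun T x => ‖u x - c T‖ ^ 2) (fun T => ?_) (fun T => ?_)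
    · have hTΩ := hm.subset T.1 T.2
      filter_upwards [ae_restrict_of_ae_restrict_of_subset hTΩ (Lp.coeFn_sub s _),
        ae_restrict_of_ae_restrict_of_subset hTΩ hs,
        feVal_ae hm hd hΩ hσ (constFamily 𝒯 r c) T] with x h1 h2 h3
      rw [h1, Pi.sub_apply, ← h2, h3, coe_constFamily, polyEval_C]
    · have hTΩ := hm.subset T.1 T.2
      have hfinT : IsFiniteMeasure (volume.restrict T.1) :=
        isFiniteMeasure_restrict.2 ((measure_mono hTΩ).trans_lt hΩ.measure_lt_top).ne
      exact ((hu.mono_measure (Measure.restrict_mono hTΩ le_rfl)).sub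
        (memLp_const (c T))).integrable_norm_pow two_ne_zero
  have e4 : ∫ x in Ω, ‖g x‖ ^ 2 = ∑ T : 𝒯, ∫ x in T.1, ‖g x‖ ^ 2 :=
    hm.integral_eq_sum (g := fun _ x => ‖g x‖ ^ 2) (fun T => EventuallyEq.rfl)
      (fun T => hg2.mono_set (hm.subset T.1 T.2))
  rw [e3, e4, Finset.mul_sum]
  exact Finset.sum_le_sum fun T _ => hc T

/-- Existence of the discrete gradient, with a constant independent of the mesh. -/
theorem exists_isDiscreteGradient (hd : 1 ≤ d) (hΩo : IsOpen Ω) (hΩ : Bornology.IsBounded Ω)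
    (r : ℕ) (hσ : 0 < σ) {β : ℝ} (hβ : 1 < β) (hβ2 : β ≤ 2) (hdβ : 0 ≤ β * (1 + d / 2) - d) :
    ∃ C : ℝ, 0 < C ∧ ∀ (h : ℝ) (𝒯 : Finset (Set (EuclideanSpace ℝ (Fin d)))),
      IsQuasiUniformMesh Ω σ h 𝒯 → ∃ S S₀ G, IsDiscreteGradient Ω 𝒯 r β C h S S₀ G := by
  obtain ⟨C₁, hC₁, hinv⟩ := exists_inverse_inequality hσ d r
  obtain ⟨C₂, hC₂, hsob⟩ := exists_poincare_sobolev hσ d r hβ hdβ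
    (R := Metric.diam Ω + 1) (by have := Metric.diam_nonneg (s := Ω); linarith)
  refine ⟨√C₁ + C₂ + √(2 ^ d / σ ^ d), by positivity, fun h 𝒯 hm => ?_⟩
  have hh := hm.h_pos hd hΩ
  have hhR : h ≤ Metric.diam Ω + 1 := (hm.h_le hΩ).trans (by linarith)
  set A := feVal hm hd hΩ hσ r with hA
  set B := feGrad hm hd hΩ hσ r with hB
  set C := √C₁ + C₂ + √(2 ^ d / σ ^ d) with hC
  have hsq : 0 ≤ √(2 ^ d / σ ^ d) := Real.sqrt_nonneg _
  have hsq1 : 0 ≤ √C₁ := Real.sqrt_nonneg _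
  have hAB : ∀ m, h * ‖B m‖ ≤ √C₁ * ‖A m‖ := by
    intro m
    refine le_of_sq_le_sq ?_ (by positivity)
    rw [mul_pow, mul_pow, Real.sq_sqrt hC₁.le, norm_sq_eq_integral, norm_sq_eq_integral,
      integral_comp_feGrad hm hd hΩ hσ m (Ψ := fun v => ‖v‖ ^ 2) (by fun_prop),
      integral_comp_feVal hm hd hΩ hσ m (Ψ := fun v => ‖v‖ ^ 2) (by fun_prop), Finset.mul_sum,
      Finset.mul_sum]
    refine Finset.sum_le_sum fun T _ => ?_
    obtain ⟨x₀, hT, hB, -⟩ := hm.exists_center hd hΩ hσ T.2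
    exact hinv T.1 x₀ h hh (hm.isOpen T.1 T.2).measurableSet hT hB _
      ((MvPolynomial.mem_restrictTotalDegree _ _ _).1 (m T).2)
  -- The inverse inequality shows that a family representing zero in `L²` has zero gradient, so the
  -- elementwise gradient is well defined on classes.
  obtain ⟨G, hG⟩ := exists_clm_factor A B fun m hm0 => by
    have h1 := hAB m
    rw [hm0, norm_zero, mul_zero] at h1
    exact norm_le_zero_iff.1 (nonpos_of_mul_nonpos_right h1 hh)
  refine ⟨LinearMap.range A, LinearMap.range (A ∘ₗ constFamily 𝒯 r), G, ?_⟩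
  refine ⟨inferInstance, inferInstance, LinearMap.range_comp_le_range _ _, ?_, ?_, ?_, ?_, ?_, ?_⟩
  · intro w hw
    choose p hp hwp using fun T : 𝒯 => hw T.1 T.2
    let m : PolyFamily 𝒯 r := fun T => ⟨p T, (MvPolynomial.mem_restrictTotalDegree _ _ _).2 (hp T)⟩
    refine ⟨A m, ⟨m, rfl⟩, ?_, ?_⟩
    · filter_upwards [hm.ae_mem, (memLp_feVal hm hd hΩ hσ m).coeFn_toLp] with x hx hx'
      obtain ⟨T, hT, hxT⟩ := hx
      change w x = (memLp_feVal hm hd hΩ hσ m).toLp _ x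
      rw [hx', piecewise_of_mem hm _ ⟨T, hT⟩ hxT]
      exact hwp ⟨T, hT⟩ x hxT
    · rw [hG]
      filter_upwards [hm.ae_mem, (memLp_feGrad hm hd hΩ hσ m).coeFn_toLp] with x hx hx'
      obtain ⟨T, hT, hxT⟩ := hx
      change gradient w x = (memLp_feGrad hm hd hΩ hσ m).toLp _ x
      rw [hx', piecewise_of_mem hm _ ⟨T, hT⟩ hxT]
      have h1 : w =ᶠ[𝓝 x] polyEval (p ⟨T, hT⟩) := by
        filter_upwards [(hm.isOpen T hT).mem_nhds hxT] with y hy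
        exact hwp ⟨T, hT⟩ y hy
      rw [h1.gradient_eq, (hasGradientAt_polyEval _ _).gradient]
  · rintro _ ⟨m, rfl⟩
    refine ⟨piecewise fun T => polyEval (m T).1, fun T hT => ⟨(m ⟨T, hT⟩).1,
      (MvPolynomial.mem_restrictTotalDegree _ _ _).1 (m ⟨T, hT⟩).2, fun x hx => ?_⟩,
      (memLp_feVal hm hd hΩ hσ m).coeFn_toLp.symm⟩
    exact piecewise_of_mem hm _ ⟨T, hT⟩ hx
  · rintro _ ⟨c, rfl⟩
    rw [LinearMap.comp_apply, hG]
    refine (Lp.eq_zero_iff_ae_eq_zero).2 ?_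
    filter_upwards [hm.ae_mem, (memLp_feGrad hm hd hΩ hσ (constFamily 𝒯 r c)).coeFn_toLp]
      with x hx hx'
    obtain ⟨T, hT, hxT⟩ := hx
    change (memLp_feGrad hm hd hΩ hσ (constFamily 𝒯 r c)).toLp _ x = 0
    rw [hx', piecewise_of_mem hm _ ⟨T, hT⟩ hxT, coe_constFamily, polyGrad_C]
  · rintro _ ⟨m, rfl⟩
    rw [hG]
    refine (hAB m).trans (mul_le_mul_of_nonneg_right ?_ (norm_nonneg _))
    rw [hC]; linarith
  · rintro _ ⟨m, rfl⟩
    choose x₀ hT hB _ using fun T : 𝒯 => hm.exists_center hd hΩ hσ T.2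
    -- The approximating piecewise constant takes the value of the polynomial at the centre of each
    -- element.
    let c : 𝒯 → ℝ := fun T => polyEval (m T).1 (x₀ T)
    refine ⟨A (constFamily 𝒯 r c), ⟨c, rfl⟩, ?_⟩
    have hβ0 : 0 < β := by linarith
    rw [hG, integral_comp_feGrad hm hd hΩ hσ m (Ψ := fun v => ‖v‖ ^ β)
      (continuous_norm.rpow_const fun _ => Or.inr hβ0.le)]
    have e1 : ‖A m - A (constFamily 𝒯 r c)‖ ^ β =
        (∑ T : 𝒯, ∫ x in T.1, ‖polyEval (m T).1 x - c T‖ ^ 2) ^ (β / 2) := by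
      have e2 : ‖A m - A (constFamily 𝒯 r c)‖ ^ 2 =
          ∑ T : 𝒯, ∫ x in T.1, ‖polyEval (m T).1 x - c T‖ ^ 2 := by
        rw [← map_sub, norm_sq_eq_integral,
          integral_comp_feVal hm hd hΩ hσ _ (Ψ := fun v => ‖v‖ ^ 2) (by fun_prop)]
        refine Finset.sum_congr rfl fun T _ => ?_
        have e3 : ∀ x, polyEval ((m - constFamily 𝒯 r c) T).1 x = polyEval (m T).1 x - c T := by
          intro x
          have : ((m - constFamily 𝒯 r c) T).1 = (m T).1 - (constFamily 𝒯 r c T).1 := rfl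
          rw [this, coe_constFamily]
          simp [polyEval]
        simp only [e3]
      rw [← e2, ← Real.rpow_natCast _ 2, ← Real.rpow_mul (norm_nonneg _)]
      congr 1
      push_cast; ring
    rw [e1]
    refine (rpow_sum_le_sum_rpow _ (fun T _ => integral_nonneg fun _ => sq_nonneg _)
      (by positivity) (by linarith)).trans ?_
    rw [Finset.mul_sum]
    refine Finset.sum_le_sum fun T _ => ?_
    refine (hsob T.1 (x₀ T) h hh hhR (hm.isOpen T.1 T.2).measurableSet (hT T) (hB T) _
      ((MvPolynomial.mem_restrictTotalDegree _ _ _).1 (m T).2)).trans ?_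
    refine mul_le_mul_of_nonneg_right ?_ (integral_nonneg fun _ => by positivity)
    rw [hC]; linarith
  · intro u g hg hw s hs
    obtain ⟨c, hc⟩ := exists_const_norm_sub_le hm hd hΩo hΩ hσ r hg hw hs
    refine ⟨A (constFamily 𝒯 r c), ⟨c, rfl⟩, hc.trans ?_⟩
    refine mul_le_mul_of_nonneg_right (mul_le_mul_of_nonneg_right ?_ hh.le) lpNorm_nonneg
    rw [hC]; linarith

end DiscreteGradient

end Forchheimer

end

/-! ### Power integrals and energies of `L²` vector fields -/

noncomputable section

namespace Forchheimer

section

variable {α F : Type*} [MeasurableSpace α] {μ : Measure α} [NormedAddCommGroup F]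

theorem integrable_norm_sq (Z : Lp F 2 μ) : Integrable (fun x => ‖Z x‖ ^ 2) μ :=
  (Lp.memLp Z).integrable_norm_pow two_ne_zero

theorem integrable_norm_rpow [IsFiniteMeasure μ] {β : ℝ} (hβ : 0 ≤ β) (hβ2 : β ≤ 2) (Z : Lp F 2 μ) :
    Integrable (fun x => ‖Z x‖ ^ β) μ := by
  refine ((integrable_norm_sq Z).add (integrable_const (1 : ℝ))).mono
    ((Real.continuous_rpow_const hβ).comp_aestronglyMeasurable
      (Lp.aestronglyMeasurable Z).norm) (ae_of_all _ fun x => ?_)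
  have h0 := norm_nonneg (Z x)
  simp only [Pi.add_apply]
  rw [Real.norm_of_nonneg (by positivity), Real.norm_of_nonneg (by positivity)]
  rcases le_total ‖Z x‖ 1 with h | h
  · have := Real.rpow_le_one h0 h hβ
    nlinarith
  · have := Real.rpow_le_rpow_of_exponent_le h hβ2
    rw [Real.rpow_two] at this
    linarith

theorem integral_norm_sub_rpow_le [IsFiniteMeasure μ] {β : ℝ} (hβ : 0 ≤ β) (hβ2 : β ≤ 2)
    (Z W : Lp F 2 μ) :
    ∫ x, ‖(Z - W : Lp F 2 μ) x‖ ^ β ∂μ ≤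
      2 ^ β * (∫ x, ‖Z x‖ ^ β ∂μ + ∫ x, ‖W x‖ ^ β ∂μ) := by
  have hI := fun Z : Lp F 2 μ => integrable_norm_rpow hβ hβ2 Z
  rw [← integral_add (hI Z) (hI W), ← integral_const_mul]
  refine integral_mono_ae (hI _) (((hI Z).add (hI W)).const_mul _) ?_
  filter_upwards [Lp.coeFn_sub Z W] with x hx
  rw [hx, Pi.sub_apply]
  have hZ := norm_nonneg (Z x)
  have hW := norm_nonneg (W x)
  have h3 : ‖Z x - W x‖ ≤ 2 * max ‖Z x‖ ‖W x‖ := by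
    have := norm_sub_le (Z x) (W x)
    have := le_max_left ‖Z x‖ ‖W x‖
    have := le_max_right ‖Z x‖ ‖W x‖
    linarith
  calc ‖Z x - W x‖ ^ β ≤ (2 * max ‖Z x‖ ‖W x‖) ^ β :=
        Real.rpow_le_rpow (norm_nonneg _) h3 hβ
    _ = 2 ^ β * max ‖Z x‖ ‖W x‖ ^ β := Real.mul_rpow (by norm_num) (by positivity)
    _ ≤ 2 ^ β * (‖Z x‖ ^ β + ‖W x‖ ^ β) := by
        gcongr
        have := Real.rpow_nonneg hZ β
        have := Real.rpow_nonneg hW β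
        rcases le_total ‖Z x‖ ‖W x‖ with h | h
        · rw [max_eq_right h]; linarith
        · rw [max_eq_left h]; linarith

end

namespace GenPoly

/-! ### The flux and the energies on `L²` -/

variable {N : ℕ} (P : GenPoly N) {α F : Type*} [MeasurableSpace α] {μ : Measure α}
  [NormedAddCommGroup F] [InnerProductSpace ℝ F]

/-- The flux as a map of `L²`. -/
def fluxLp (Z : Lp F 2 μ) : Lp F 2 μ := P.lipschitzWith_flux.compLp P.flux_zero Z

theorem coeFn_fluxLp (Z : Lp F 2 μ) : P.fluxLp Z =ᵐ[μ] fun x => P.flux (Z x) :=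
  P.lipschitzWith_flux.coeFn_compLp P.flux_zero Z

/-- The dissipation `∫ K(|Z|) |Z|²`. -/
def dissipation (Z : Lp F 2 μ) : ℝ := inner ℝ (P.fluxLp Z) Z

/-- The potential energy `∫ H(|Z|)`. -/
def potentialEnergy (Z : Lp F 2 μ) : ℝ := ∫ x, P.potential (Z x) ∂μ

theorem inner_fluxLp (Z W : Lp F 2 μ) :
    inner ℝ (P.fluxLp Z) W = ∫ x, inner ℝ (P.flux (Z x)) (W x) ∂μ := by
  rw [L2.inner_def]
  refine integral_congr_ae ?_
  filter_upwards [P.coeFn_fluxLp Z] with x hx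
  rw [hx]

theorem integrable_inner_flux (Z W : Lp F 2 μ) :
    Integrable (fun x => inner ℝ (P.flux (Z x)) (W x)) μ := by
  refine (L2.integrable_inner (𝕜 := ℝ) (P.fluxLp Z) W).congr ?_
  filter_upwards [P.coeFn_fluxLp Z] with x hx
  rw [hx]

theorem inner_flux_self_nonneg (v : F) : 0 ≤ inner ℝ (P.flux v) v := by
  rw [P.inner_flux_self]
  have := P.K_nonneg (norm_nonneg v)
  positivity

theorem dissipation_nonneg (Z : Lp F 2 μ) : 0 ≤ P.dissipation Z := by
  rw [dissipation, inner_fluxLp]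
  exact integral_nonneg fun x => P.inner_flux_self_nonneg _

theorem norm_fluxLp_sq_le (Z : Lp F 2 μ) :
    ‖P.fluxLp Z‖ ^ 2 ≤ 1 / P.coeff 0 * P.dissipation Z := by
  rw [norm_sq_eq_integral, dissipation, inner_fluxLp, ← integral_const_mul]
  refine integral_mono_ae ((Lp.memLp _).integrable_norm_pow two_ne_zero)
    ((P.integrable_inner_flux Z Z).const_mul _) ?_
  filter_upwards [P.coeFn_fluxLp Z] with x hx
  rw [hx]
  exact P.norm_flux_sq_le _

theorem dissipation_le (Z : Lp F 2 μ) : P.dissipation Z ≤ 1 / P.coeff 0 * ‖Z‖ ^ 2 := by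
  rw [norm_sq_eq_integral, dissipation, inner_fluxLp, ← integral_const_mul]
  refine integral_mono (P.integrable_inner_flux Z Z) ((integrable_norm_sq Z).const_mul _)
    fun x => ?_
  simp only [P.inner_flux_self]
  exact mul_le_mul_of_nonneg_right (P.K_le (norm_nonneg _)) (by positivity)

theorem integrable_potential (Z : Lp F 2 μ) : Integrable (fun x => P.potential (Z x)) μ := by
  refine ((P.integrable_inner_flux Z Z).const_mul 2).mono
    (P.continuous_potential.comp_aestronglyMeasurable (Lp.aestronglyMeasurable Z))
    (ae_of_all _ fun x => ?_)
  have h1 := P.inner_flux_self_nonneg (Z x)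
  have h2 := P.inner_flux_le_potential (Z x)
  rw [Real.norm_of_nonneg (h1.trans h2), Real.norm_of_nonneg (by positivity)]
  exact P.potential_le _

theorem dissipation_le_potentialEnergy (Z : Lp F 2 μ) :
    P.dissipation Z ≤ P.potentialEnergy Z := by
  rw [dissipation, inner_fluxLp]
  exact integral_mono (P.integrable_inner_flux Z Z) (P.integrable_potential Z)
    fun x => P.inner_flux_le_potential _

theorem potentialEnergy_le (Z : Lp F 2 μ) : P.potentialEnergy Z ≤ 2 * P.dissipation Z := by
  rw [dissipation, inner_fluxLp, ← integral_const_mul]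
  exact integral_mono (P.integrable_potential Z) ((P.integrable_inner_flux Z Z).const_mul _)
    fun x => P.potential_le _

/-- Pointwise, the first-order remainder of the potential lies between 0, by convexity, and a
multiple of the squared increment, by the Lipschitz bound. Integrated, it is `O(‖W‖²)` in `L²`, so
no differentiation under the integral sign is needed. -/
theorem hasFDerivAt_potentialEnergy (Z : Lp F 2 μ) :
    HasFDerivAt P.potentialEnergy ((2 : ℝ) • innerSL ℝ (P.fluxLp Z)) Z := by
  have hc := P.coeff_zero_pos
  rw [hasFDerivAt_iff_isLittleO_nhds_zero]
  refine Asymptotics.IsBigO.trans_isLittleO (g := fun W : Lp F 2 μ => ‖W‖ ^ 2) ?_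
    (Asymptotics.isLittleO_norm_pow_id one_lt_two)
  refine Asymptotics.IsBigO.of_bound (4 / P.coeff 0) (Eventually.of_forall fun W => ?_)
  have hsub : Integrable (fun x => P.potential ((Z + W : Lp F 2 μ) x) - P.potential (Z x)) μ :=
    (P.integrable_potential _).sub (P.integrable_potential _)
  have e1 : P.potentialEnergy (Z + W) - P.potentialEnergy Z -
      ((2 : ℝ) • innerSL ℝ (P.fluxLp Z)) W =
      ∫ x, (P.potential ((Z + W : Lp F 2 μ) x) - P.potential (Z x) -
        2 * inner ℝ (P.flux (Z x)) (W x)) ∂μ := by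
    rw [integral_sub hsub ((P.integrable_inner_flux Z W).const_mul 2),
      integral_sub (P.integrable_potential _) (P.integrable_potential _), integral_const_mul,
      ← inner_fluxLp]
    simp [potentialEnergy]
  have hadd := Lp.coeFn_add Z W
  rw [e1, Real.norm_of_nonneg, Real.norm_of_nonneg (by positivity), norm_sq_eq_integral,
    ← integral_const_mul]
  · refine integral_mono_ae (hsub.sub ((P.integrable_inner_flux Z W).const_mul 2)) ((integrable_norm_sq W).const_mul _) ?_
    filter_upwards [hadd] with x hx
    have := P.potential_sub_le (Z x) (Z x + W x)
    rw [add_sub_cancel_left] at this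
    rw [hx, Pi.add_apply]
    linarith
  · refine integral_nonneg_of_ae ?_
    filter_upwards [hadd] with x hx
    have := P.two_inner_flux_le (Z x) (Z x + W x)
    rw [add_sub_cancel_left] at this
    rw [hx, Pi.add_apply, Pi.zero_apply]
    linarith

variable [IsFiniteMeasure μ]

theorem integral_norm_rpow_le (hN : 1 ≤ N) {η C : ℝ}
    (hC : ∀ ξ : ℝ, 0 ≤ ξ → ξ ^ P.β ≤ η + C * (P.K ξ * ξ ^ 2)) (Z : Lp F 2 μ) :
    ∫ x, ‖Z x‖ ^ P.β ∂μ ≤ η * μ.real univ + C * P.dissipation Z := by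
  have h1 := P.one_lt_beta hN
  have h2 := P.beta_lt_two hN
  have e : η * μ.real univ = ∫ _, η ∂μ := by rw [integral_const, smul_eq_mul, mul_comm]
  rw [dissipation, inner_fluxLp, ← integral_const_mul, e,
    ← integral_add (integrable_const η) ((P.integrable_inner_flux Z Z).const_mul C)]
  refine integral_mono (integrable_norm_rpow (by linarith) h2.le Z)
    ((integrable_const η).add ((P.integrable_inner_flux Z Z).const_mul C)) fun x => ?_
  simp only [P.inner_flux_self]
  exact hC _ (norm_nonneg _)

end GenPoly

end Forchheimer

end

/-! ### From the discrete flow to scalar energy inequalities -/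

noncomputable section

namespace Forchheimer

section Flow

variable {d : ℕ} {N : ℕ} {P : GenPoly N} {Ω : Set (EuclideanSpace ℝ (Fin d))}
  {𝒯 : Finset (Set (EuclideanSpace ℝ (Fin d)))} {r : ℕ} {C h : ℝ}
  {S S₀ : Submodule ℝ (Lp ℝ 2 (volume.restrict Ω))}
  {G : Lp ℝ 2 (volume.restrict Ω) →L[ℝ] Lp (EuclideanSpace ℝ (Fin d)) 2 (volume.restrict Ω)}

/-- Stability of the discrete gradient of the `L²` projection in `H¹`. -/
theorem IsDiscreteGradient.norm_map_starProjection_le {β : ℝ}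
    (hG : IsDiscreteGradient Ω 𝒯 r β C h S S₀ G) [S.HasOrthogonalProjection]
    (hC : 0 < C) (hh : 0 < h) {w : EuclideanSpace ℝ (Fin d) → ℝ} (hw : MemH1 Ω w)
    {s : Lp ℝ 2 (volume.restrict Ω)} (hs : w =ᵐ[volume.restrict Ω] s) :
    ‖G (S.starProjection s)‖ ^ 2 ≤ C ^ 4 * h1Norm Ω w ^ 2 := by
  have hex := hw.2
  have hwg : MemLp (weakGradient Ω w) 2 (volume.restrict Ω) ∧
      HasWeakGradient Ω w (weakGradient Ω w) := by
    unfold weakGradient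
    rw [dif_pos hex]
    exact hex.choose_spec
  obtain ⟨c, hc, hle⟩ := hG.poincare w _ hwg.1 hwg.2 s hs
  -- Piecewise constants are fixed by the projection and annihilated by `G`. After subtracting one,
  -- the `h` gained from Poincaré compensates the `h⁻¹` lost in the inverse inequality.
  have h1 : G (S.starProjection s) = G (S.starProjection (s - c)) := by
    rw [map_sub, map_sub, S.starProjection_eq_self_iff.2 (hG.const_le hc), hG.map_const c hc,
      sub_zero]
  have h2 := hG.inverse _ (S.starProjection_apply_mem (s - c))
  have h3 := S.norm_starProjection_apply_le (s - c)
  set L := lpNorm (weakGradient Ω w) 2 (volume.restrict Ω) with hL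
  have hL0 : 0 ≤ L := lpNorm_nonneg
  have h4 : h * ‖G (S.starProjection s)‖ ≤ h * (C ^ 2 * L) := by
    rw [h1]
    calc _ ≤ C * ‖S.starProjection (s - c)‖ := h2
      _ ≤ C * (C * h * L) := by gcongr; exact h3.trans hle
      _ = _ := by ring
  have h5 := le_of_mul_le_mul_left h4 hh
  have h6 : L ^ 2 ≤ h1Norm Ω w ^ 2 := by
    rw [h1Norm, Real.sq_sqrt (by positivity)]
    have := sq_nonneg (l2Norm Ω w)
    linarith
  calc ‖G (S.starProjection s)‖ ^ 2 ≤ (C ^ 2 * L) ^ 2 := by gcongr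
    _ = C ^ 4 * L ^ 2 := by ring
    _ ≤ _ := by gcongr

theorem inner_le_half_add {X : Type*} [NormedAddCommGroup X] [InnerProductSpace ℝ X] (x y : X)
    {a : ℝ} (ha : 0 < a) : inner ℝ x y ≤ a / 4 * ‖x‖ ^ 2 + 1 / a * ‖y‖ ^ 2 := by
  refine (real_inner_le_norm x y).trans ?_
  have h1 : a / 4 * ‖x‖ ^ 2 + 1 / a * ‖y‖ ^ 2 - ‖x‖ * ‖y‖ =
      1 / a * (a / 2 * ‖x‖ - ‖y‖) ^ 2 := by field_simp; ring
  have h2 : 0 ≤ 1 / a * (a / 2 * ‖x‖ - ‖y‖) ^ 2 := by positivity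
  linarith

/-- Constant bookkeeping for the coupling estimate: `X` is the `β`-th power of the norm of the
oscillating part, and `I`, `I₁`, `I₂` are the `β`-integrals of the gradients of the unknown, of the
full density and of the projected boundary data. -/
theorem rpow_le_of_sobolev {C T A k b D ψ e η X I I₁ I₂ : ℝ} (hC : 0 ≤ C) (hT : 0 ≤ T)
    (hA0 : 0 ≤ A) (hA : A = C * T) (hk : 0 ≤ k) (hb : 0 ≤ b) (hD : 0 ≤ D) (hψ : 0 ≤ ψ) (he : 0 ≤ e)
    (hη : (2 * A + 1) * e ≤ η) (hX : X ≤ C * I) (hI : I ≤ T * (I₁ + I₂)) (h₁ : I₁ ≤ e + k * D)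
    (h₂ : I₂ ≤ e + k * (b * ψ)) : X ≤ η + k * (A * (1 + b) + 1) * (D + ψ) := by
  have h3 : T * (I₁ + I₂) ≤ T * ((e + k * D) + (e + k * (b * ψ))) :=
    mul_le_mul_of_nonneg_left (by linarith) hT
  have h4 := mul_le_mul_of_nonneg_left (hI.trans h3) hC
  have h5 : C * (T * ((e + k * D) + (e + k * (b * ψ)))) =
      2 * A * e + k * A * D + k * A * b * ψ := by rw [hA]; ring
  have h6 : 0 ≤ k * A * b * D := by positivity
  have h7 : 0 ≤ k * A * ψ := by positivity
  have h8 : 0 ≤ k * (D + ψ) := by positivity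
  linarith

set_option maxHeartbeats 1000000 in
/-- The energy inequalities for a discrete flow, in Hilbert space form: `u` is the unknown, `z` the
discrete gradient of the boundary data. -/
theorem exists_energySystem_of_flow (P : GenPoly N) (hN : 1 ≤ N) (hC : 0 < C)
    (hΩ : Bornology.IsBounded Ω) :
    ∃ (C₁ : ℝ) (Cη : ℝ → ℝ), 0 < C₁ ∧ (∀ η, 0 < η → 0 < Cη η) ∧
      ∀ (h : ℝ) (𝒯 : Finset (Set (EuclideanSpace ℝ (Fin d)))) (r : ℕ)
        (S S₀ : Submodule ℝ (Lp ℝ 2 (volume.restrict Ω)))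
        (G : Lp ℝ 2 (volume.restrict Ω) →L[ℝ]
          Lp (EuclideanSpace ℝ (Fin d)) 2 (volume.restrict Ω)),
        IsDiscreteGradient Ω 𝒯 r P.β C h S S₀ G →
      ∀ (u u' F : ℝ → Lp ℝ 2 (volume.restrict Ω))
        (z z' : ℝ → Lp (EuclideanSpace ℝ (Fin d)) 2 (volume.restrict Ω)) (ψ χ : ℝ → ℝ),
        (∀ t, 0 ≤ t → u t ∈ S) → (∀ t, 0 < t → u' t ∈ S) →
        (∀ t, 0 < t → HasDerivAt u (u' t) t) → (∀ t, 0 < t → HasDerivAt z (z' t) t) →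
        ContinuousWithinAt u (Ici 0) 0 → ContinuousWithinAt z (Ici 0) 0 →
        (∀ t, 0 ≤ t → ‖z t‖ ^ 2 ≤ C ^ 4 * ψ t) → (∀ t, 0 ≤ t → ‖z' t‖ ^ 2 ≤ C ^ 4 * χ t) →
        (∀ t, 0 < t → ∀ w ∈ S,
          inner ℝ (u' t) w + inner ℝ (P.fluxLp (G (u t) + z t)) (G w) = inner ℝ (F t) w) →
      ∃ y y' H H' D : ℝ → ℝ, EnergySystem P.β C₁ Cη y y' H H' D
        (fun t => ∫ x in Ω, ‖(G (u t) + z t) x‖ ^ P.β) ψ (fun t => ‖F t‖) χ ∧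
        y 0 ≤ ‖u 0‖ ^ 2 ∧ H 0 ≤ C₁ * ‖G (u 0) + z 0‖ ^ 2 := by
  have hfin : IsFiniteMeasure (volume.restrict Ω) :=
    isFiniteMeasure_restrict.2 hΩ.measure_lt_top.ne
  have ha := P.coeff_zero_pos
  have hβ1 := P.one_lt_beta hN
  have hβ2 := P.beta_lt_two hN
  have hβ0 : 0 < P.β := by linarith
  set V := (volume.restrict Ω).real univ with hV
  have hV0 : 0 ≤ V := measureReal_nonneg
  set A := C * 2 ^ P.β with hA
  have hA0 : 0 < A := by positivity
  -- The pointwise error in the coercivity estimate is later multiplied by the volume of `Ω` and by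
  -- the Sobolev constants; it is scaled down in advance so that the total stays below `η`.
  let η' : ℝ → ℝ := fun η => η / ((2 * A + 1) * (V + 1))
  have hη' : ∀ η, 0 < η → 0 < η' η := fun η hη => by positivity
  have hη'le : ∀ η, 0 < η → (2 * A + 1) * (η' η * V) ≤ η := fun η hη => by
    have h1 : (2 * A + 1) * (η' η * (V + 1)) = η := by simp only [η']; field_simp
    have h2 : (2 * A + 1) * (η' η * V) ≤ (2 * A + 1) * (η' η * (V + 1)) := by
      have := (hη' η hη).le
      gcongr; linarith
    linarith
  have hk : ∀ η : ℝ, ∃ k : ℝ, 0 < η → 0 < k ∧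
      ∀ ξ : ℝ, 0 ≤ ξ → ξ ^ P.β ≤ η' η + k * (P.K ξ * ξ ^ 2) := fun η => by
    by_cases hη : 0 < η
    · obtain ⟨k, hk⟩ := P.rpow_beta_le hN (hη' η hη)
      exact ⟨k, fun _ => hk⟩
    · exact ⟨0, fun h => absurd h hη⟩
  choose k hk using hk
  set a₀ := P.coeff 0 with ha₀
  refine ⟨2 * C ^ 4 / a₀ + 2 / a₀, fun η => k η * (A * (1 + C ^ 4 / a₀) + 1), by positivity,
    fun η hη => mul_pos (hk η hη).1 (by positivity), ?_⟩
  intro h 𝒯 r S S₀ G hG u u' F z z' ψ χ huS hu'S hu hz hu0 hz0 hψ hχ heq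
  have := hG.finite
  have := hG.finite_const
  -- Removal of the piecewise constant part: an orthogonal projection that preserves `S`, leaves the
  -- gradient unchanged and gives the smallest norm modulo `S₀`.
  set Q : Lp ℝ 2 (volume.restrict Ω) →L[ℝ] Lp ℝ 2 (volume.restrict Ω) :=
    ContinuousLinearMap.id ℝ _ - S₀.starProjection with hQ
  have hQa : ∀ v, Q v = v - S₀.starProjection v := fun v => rfl
  have hQS : ∀ v ∈ S, Q v ∈ S := fun v hv => by
    rw [hQa]
    exact S.sub_mem hv (hG.const_le (S₀.starProjection_apply_mem v))
  have hGQ : ∀ v, G (Q v) = G v := fun v => by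
    rw [hQa, map_sub, hG.map_const _ (S₀.starProjection_apply_mem v), sub_zero]
  have hQQ : ∀ v w, inner ℝ (Q v) (Q w) = inner ℝ (Q v) w := fun v w => by
    rw [hQa w, inner_sub_right, hQa v,
      S₀.starProjection_inner_eq_zero v _ (S₀.starProjection_apply_mem w), sub_zero]
  have hQmin : ∀ v, ∀ c ∈ S₀, ‖Q v‖ ≤ ‖v - c‖ := fun v c hc => by
    have h1 : Q v = Q (v - c) := by
      rw [map_sub, hQa c, S₀.starProjection_eq_self_iff.2 hc, sub_self, sub_zero]
    have h2 : ‖Q (v - c)‖ ^ 2 ≤ ‖Q (v - c)‖ * ‖v - c‖ := by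
      rw [← real_inner_self_eq_norm_sq, hQQ]
      exact real_inner_le_norm _ _
    rw [h1]
    rcases (norm_nonneg (Q (v - c))).eq_or_lt with h0 | h0
    · rw [← h0]; exact norm_nonneg _
    · rw [pow_two] at h2; exact le_of_mul_le_mul_left h2 h0
  let Z : ℝ → Lp (EuclideanSpace ℝ (Fin d)) 2 (volume.restrict Ω) := fun t => G (u t) + z t
  have hZ : ∀ t, 0 < t → HasDerivAt Z (G (u' t) + z' t) t := fun t ht =>
    (G.hasFDerivAt.comp_hasDerivAt t (hu t ht)).add (hz t ht)
  have hZ0 : ContinuousWithinAt Z (Ici 0) 0 :=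
    (G.continuous.continuousAt.comp_continuousWithinAt hu0).add hz0
  have hψ0 : ∀ t, 0 ≤ t → 0 ≤ ψ t := fun t ht =>
    nonneg_of_mul_nonneg_right ((sq_nonneg _).trans (hψ t ht)) (by positivity)
  have hχ0 : ∀ t, 0 ≤ t → 0 ≤ χ t := fun t ht =>
    nonneg_of_mul_nonneg_right ((sq_nonneg _).trans (hχ t ht)) (by positivity)
  have hflux : ∀ t, a₀ * ‖P.fluxLp (Z t)‖ ^ 2 ≤ P.dissipation (Z t) := fun t => by
    have := P.norm_fluxLp_sq_le (Z t)
    rw [one_div, ← div_eq_inv_mul, le_div_iff₀ ha] at this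
    linarith
  refine ⟨fun t => ‖Q (u t)‖ ^ 2, fun t => 2 * inner ℝ (Q (u t)) (Q (u' t)),
    fun t => P.potentialEnergy (Z t), fun t => 2 * inner ℝ (P.fluxLp (Z t)) (G (u' t) + z' t),
    fun t => P.dissipation (Z t), ?_, ?_, ?_⟩
  · constructor
    · intro t ht
      exact (Q.hasFDerivAt.comp_hasDerivAt t (hu t ht)).norm_sq
    · intro t ht
      have h1 := (P.hasFDerivAt_potentialEnergy (Z t)).comp_hasDerivAt t (hZ t ht)
      simpa [Function.comp_def] using h1
    · exact ((Q.continuous.continuousAt.comp_continuousWithinAt hu0).norm).pow 2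
    · exact (P.hasFDerivAt_potentialEnergy (Z 0)).continuousAt.comp_continuousWithinAt hZ0
    · intro t _; positivity
    · intro t _; exact P.dissipation_nonneg _
    · exact hψ0
    · intro t _; exact norm_nonneg _
    · exact hχ0
    · intro t ht
      -- Since `Q` is an orthogonal projection, `⟨Qu, Qu'⟩ = ⟨Qu, u'⟩`, which is the equation tested
      -- with `Qu`. The boundary contribution `⟨flux, z⟩` is absorbed by the dissipation through `a₀
      -- ‖flux‖² ≤ D`.
      rw [hQQ, real_inner_comm]
      have h1 := heq t ht _ (hQS _ (huS t ht.le))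
      rw [hGQ] at h1
      have h2 : inner ℝ (P.fluxLp (Z t)) (G (u t)) =
          P.dissipation (Z t) - inner ℝ (P.fluxLp (Z t)) (z t) := by
        have : G (u t) = Z t - z t := by simp [Z]
        rw [this, inner_sub_right]; rfl
      have h3 := inner_le_half_add (P.fluxLp (Z t)) (z t) ha
      have h4 := real_inner_le_norm (F t) (Q (u t))
      have h5 := hflux t
      have h6 : 1 / a₀ * ‖z t‖ ^ 2 ≤ 1 / a₀ * (C ^ 4 * ψ t) :=
        mul_le_mul_of_nonneg_left (hψ t ht.le) (by positivity)
      have h7 : 0 ≤ 2 / a₀ * ψ t := mul_nonneg (by positivity) (hψ0 t ht.le)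
      have h8 := P.dissipation_nonneg (Z t)
      have h9 : (2 * C ^ 4 / a₀ + 2 / a₀) * ψ t = 2 * (1 / a₀ * (C ^ 4 * ψ t)) + 2 / a₀ * ψ t := by
        ring
      rw [Real.sqrt_sq (norm_nonneg _), h9]
      change inner ℝ (u' t) (Q (u t)) + inner ℝ (P.fluxLp (Z t)) (G (u t)) = _ at h1
      linarith
    · intro t ht
      -- The equation tested with the time derivative itself; the resulting `-2‖u'‖²` absorbs the
      -- source term, leaving `‖F‖²`.
      have h1 := heq t ht _ (hu'S t ht)
      change inner ℝ (u' t) (u' t) + inner ℝ (P.fluxLp (Z t)) (G (u' t)) = _ at h1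
      rw [real_inner_self_eq_norm_sq] at h1
      have h3 := inner_le_half_add (P.fluxLp (Z t)) (z' t) ha
      have h4 := real_inner_le_norm (F t) (u' t)
      have h5 := hflux t
      have h6 : 1 / a₀ * ‖z' t‖ ^ 2 ≤ 1 / a₀ * (C ^ 4 * χ t) :=
        mul_le_mul_of_nonneg_left (hχ t ht.le) (by positivity)
      have h7 : 0 ≤ 2 / a₀ * χ t := mul_nonneg (by positivity) (hχ0 t ht.le)
      have h9 : (2 * C ^ 4 / a₀ + 2 / a₀) * χ t = 2 * (1 / a₀ * (C ^ 4 * χ t)) + 2 / a₀ * χ t := by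
        ring
      rw [h9, inner_add_right]
      nlinarith [sq_nonneg (‖F t‖ - 2 * ‖u' t‖), sq_nonneg ‖F t‖]
    · intro t _; exact P.dissipation_le_potentialEnergy _
    · intro t _; exact P.potentialEnergy_le _
    · intro η hη t ht
      obtain ⟨hk0, hkξ⟩ := hk η hη
      obtain ⟨c, hc, hsob⟩ := hG.sobolev (u t) (huS t ht)
      have h1 : (‖Q (u t)‖ ^ 2) ^ (P.β / 2) ≤ ‖u t - c‖ ^ P.β := by
        rw [← Real.rpow_natCast _ 2, ← Real.rpow_mul (norm_nonneg _)]
        have : ((2 : ℕ) : ℝ) * (P.β / 2) = P.β := by push_cast; ring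
        rw [this]
        exact Real.rpow_le_rpow (norm_nonneg _) (hQmin _ c hc) hβ0.le
      have h2 := integral_norm_sub_rpow_le hβ0.le hβ2.le (Z t) (z t)
      -- Sobolev involves the gradient of the unknown, coercivity that of the full density; their
      -- difference is the boundary part, controlled by `ψ`.
      have h3 : Z t - z t = G (u t) := by simp [Z]
      rw [h3] at h2
      have h4 := P.integral_norm_rpow_le hN hkξ (Z t)
      have h5 := P.integral_norm_rpow_le hN hkξ (z t)
      have h6 : P.dissipation (z t) ≤ C ^ 4 / a₀ * ψ t := by
        calc _ ≤ 1 / a₀ * ‖z t‖ ^ 2 := P.dissipation_le _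
          _ ≤ 1 / a₀ * (C ^ 4 * ψ t) := mul_le_mul_of_nonneg_left (hψ t ht) (by positivity)
          _ = _ := by ring
      have h7 := mul_le_mul_of_nonneg_left h6 hk0.le
      have hD := P.dissipation_nonneg (Z t)
      have hψt := hψ0 t ht
      have h8 := hη'le η hη
      have hη0 := (hη' η hη).le
      refine rpow_le_of_sobolev hC.le (by positivity) hA0.le hA hk0.le (by positivity) hD hψt
        (mul_nonneg hη0 hV0) h8 (h1.trans hsob) h2 h4 (h5.trans (add_le_add_right h7 _))
    · intro η hη t ht
      obtain ⟨hk0, hkξ⟩ := hk η hη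
      have h4 := P.integral_norm_rpow_le hN hkξ (Z t)
      have hD := P.dissipation_nonneg (Z t)
      have h8 := hη'le η hη
      have h9 : 0 ≤ η' η * V := mul_nonneg (hη' η hη).le hV0
      have h10 : 0 ≤ A * (η' η * V) := by positivity
      have h11 : 0 ≤ k η * (A * (1 + C ^ 4 / a₀)) * P.dissipation (Z t) := by positivity
      change ∫ x in Ω, ‖Z t x‖ ^ P.β ≤ _
      linarith
  · refine pow_le_pow_left₀ (norm_nonneg _) ?_ 2
    simpa using hQmin (u 0) 0 S₀.zero_mem
  · have h1 := P.potentialEnergy_le (Z 0)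
    have h2 := P.dissipation_le (Z 0)
    have h3 : 0 ≤ 2 * C ^ 4 / a₀ * ‖Z 0‖ ^ 2 := by positivity
    change P.potentialEnergy (Z 0) ≤ (2 * C ^ 4 / a₀ + 2 / a₀) * ‖Z 0‖ ^ 2
    have h4 : 1 / a₀ * ‖Z 0‖ ^ 2 * 2 = 2 / a₀ * ‖Z 0‖ ^ 2 := by ring
    linarith

end Flow

end Forchheimer

end

/-! ### Semidiscrete solutions as curves in `L²(Ω)` -/

noncomputable section

namespace Forchheimer

section Solution

variable {d : ℕ} {N : ℕ} {P : GenPoly N} {Ω : Set (EuclideanSpace ℝ (Fin d))}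
  {𝒯 : Finset (Set (EuclideanSpace ℝ (Fin d)))} {r : ℕ} {β C h : ℝ}
  {S S₀ : Submodule ℝ (Lp ℝ 2 (volume.restrict Ω))}
  {G : Lp ℝ 2 (volume.restrict Ω) →L[ℝ] Lp (EuclideanSpace ℝ (Fin d)) 2 (volume.restrict Ω)}

open Classical in
/-- The class of a square integrable function in `L²(Ω)`. -/
def toL2 (Ω : Set (EuclideanSpace ℝ (Fin d))) (w : EuclideanSpace ℝ (Fin d) → ℝ) :
    Lp ℝ 2 (volume.restrict Ω) :=
  if h : MemLp w 2 (volume.restrict Ω) then h.toLp w else 0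

theorem ae_eq_toL2 {w : EuclideanSpace ℝ (Fin d) → ℝ} (hw : MemLp w 2 (volume.restrict Ω)) :
    w =ᵐ[volume.restrict Ω] toL2 Ω w := by
  rw [toL2, dif_pos hw]
  exact hw.coeFn_toLp.symm

theorem toL2_eq {w : EuclideanSpace ℝ (Fin d) → ℝ} {s : Lp ℝ 2 (volume.restrict Ω)}
    (hw : w =ᵐ[volume.restrict Ω] s) : toL2 Ω w = s :=
  Lp.ext ((ae_eq_toL2 ((memLp_congr_ae hw).2 (Lp.memLp s))).symm.trans hw)

theorem toL2_sub {v w : EuclideanSpace ℝ (Fin d) → ℝ} (hv : MemLp v 2 (volume.restrict Ω))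
    (hw : MemLp w 2 (volume.restrict Ω)) : toL2 Ω (v - w) = toL2 Ω v - toL2 Ω w := by
  refine toL2_eq ?_
  filter_upwards [ae_eq_toL2 hv, ae_eq_toL2 hw, Lp.coeFn_sub (toL2 Ω v) (toL2 Ω w)]
    with x h1 h2 h3
  rw [h3, Pi.sub_apply, Pi.sub_apply, h1, h2]

theorem l2Norm_eq {w : EuclideanSpace ℝ (Fin d) → ℝ} (hw : MemLp w 2 (volume.restrict Ω)) :
    l2Norm Ω w = ‖toL2 Ω w‖ :=
  lpNorm_eq_norm (ae_eq_toL2 hw)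

theorem l2Norm_sq_le_h1Norm_sq (Ω : Set (EuclideanSpace ℝ (Fin d)))
    (w : EuclideanSpace ℝ (Fin d) → ℝ) : l2Norm Ω w ^ 2 ≤ h1Norm Ω w ^ 2 := by
  rw [h1Norm, Real.sq_sqrt (by positivity)]
  exact le_add_of_nonneg_right (sq_nonneg _)

theorem inner_eq_integral_mul {u w : EuclideanSpace ℝ (Fin d) → ℝ}
    {s s' : Lp ℝ 2 (volume.restrict Ω)} (hu : u =ᵐ[volume.restrict Ω] s)
    (hw : w =ᵐ[volume.restrict Ω] s') : inner ℝ s s' = ∫ x in Ω, u x * w x := by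
  rw [L2.inner_def]
  refine integral_congr_ae ?_
  filter_upwards [hu, hw] with x h1 h2
  simp [h1, h2, mul_comm]

theorem HasL2TimeDeriv.hasDerivWithinAt {u : ℝ → EuclideanSpace ℝ (Fin d) → ℝ}
    {v : EuclideanSpace ℝ (Fin d) → ℝ} {t : ℝ} (h : HasL2TimeDeriv Ω u v t) (ht : 0 ≤ t)
    (hu : ∀ s, 0 ≤ s → MemLp (u s) 2 (volume.restrict Ω))
    (hv : MemLp v 2 (volume.restrict Ω)) :
    HasDerivWithinAt (fun s => toL2 Ω (u s)) (toL2 Ω v) (Ici 0) t := by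
  rw [hasDerivWithinAt_iff_tendsto_slope, tendsto_iff_norm_sub_tendsto_zero]
  refine Tendsto.congr' ?_ ((ENNReal.tendsto_toReal ENNReal.zero_ne_top).comp h)
  filter_upwards [self_mem_nhdsWithin] with s hs
  rw [Function.comp_apply, Lp.norm_def]
  congr 1
  refine eLpNorm_congr_ae ?_
  rw [slope_def_module]
  filter_upwards [ae_eq_toL2 (hu s hs.1), ae_eq_toL2 (hu t ht), ae_eq_toL2 hv,
    Lp.coeFn_sub ((s - t)⁻¹ • (toL2 Ω (u s) - toL2 Ω (u t))) (toL2 Ω v),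
    Lp.coeFn_smul (s - t)⁻¹ (toL2 Ω (u s) - toL2 Ω (u t)),
    Lp.coeFn_sub (toL2 Ω (u s)) (toL2 Ω (u t))] with x h1 h2 h3 h4 h5 h6
  rw [h4, Pi.sub_apply, h5, Pi.smul_apply, h6, Pi.sub_apply, h1, h2, h3, smul_eq_mul]

theorem continuousWithinAt_toL2 {u : ℝ → EuclideanSpace ℝ (Fin d) → ℝ}
    (hu : ∀ s, 0 ≤ s → MemLp (u s) 2 (volume.restrict Ω))
    (h : Tendsto (fun t => eLpNorm (u t - u 0) 2 (volume.restrict Ω)) (𝓝[>] 0) (𝓝 0)) :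
    ContinuousWithinAt (fun s => toL2 Ω (u s)) (Ici 0) 0 := by
  rw [← continuousWithinAt_Ioi_iff_Ici, ContinuousWithinAt, tendsto_iff_norm_sub_tendsto_zero]
  refine Tendsto.congr' ?_ ((ENNReal.tendsto_toReal ENNReal.zero_ne_top).comp h)
  filter_upwards [self_mem_nhdsWithin] with s hs
  have hs0 : 0 ≤ s := le_of_lt hs
  rw [Function.comp_apply, Lp.norm_def]
  congr 1
  refine eLpNorm_congr_ae ?_
  rw [← toL2_sub (hu s hs0) (hu 0 le_rfl)]
  exact ae_eq_toL2 ((hu s hs0).sub (hu 0 le_rfl))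

theorem add_mem_feSpace {v w : EuclideanSpace ℝ (Fin d) → ℝ} (hv : v ∈ feSpace 𝒯 r)
    (hw : w ∈ feSpace 𝒯 r) : v + w ∈ feSpace 𝒯 r := by
  intro T hT
  obtain ⟨p, hp, hpv⟩ := hv T hT
  obtain ⟨q, hq, hqw⟩ := hw T hT
  refine ⟨p + q, (MvPolynomial.totalDegree_add p q).trans (max_le hp hq), fun x hx => ?_⟩
  rw [Pi.add_apply, hpv x hx, hqw x hx, map_add]

namespace IsDiscreteGradient

theorem toL2_mem (hG : IsDiscreteGradient Ω 𝒯 r β C h S S₀ G) {w : EuclideanSpace ℝ (Fin d) → ℝ}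
    (hw : w ∈ feSpace 𝒯 r) : toL2 Ω w ∈ S := by
  obtain ⟨s, hs, h1, -⟩ := hG.exists_class w hw
  rwa [toL2_eq h1]

theorem memLp (hG : IsDiscreteGradient Ω 𝒯 r β C h S S₀ G) {w : EuclideanSpace ℝ (Fin d) → ℝ}
    (hw : w ∈ feSpace 𝒯 r) : MemLp w 2 (volume.restrict Ω) := by
  obtain ⟨s, -, h1, -⟩ := hG.exists_class w hw
  exact (memLp_congr_ae h1).2 (Lp.memLp s)

theorem gradient_ae (hG : IsDiscreteGradient Ω 𝒯 r β C h S S₀ G)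
    {w : EuclideanSpace ℝ (Fin d) → ℝ} (hw : w ∈ feSpace 𝒯 r) :
    gradient w =ᵐ[volume.restrict Ω] G (toL2 Ω w) := by
  obtain ⟨s, -, h1, h2⟩ := hG.exists_class w hw
  rwa [toL2_eq h1]

theorem toL2_add (hG : IsDiscreteGradient Ω 𝒯 r β C h S S₀ G)
    {v w : EuclideanSpace ℝ (Fin d) → ℝ} (hv : v ∈ feSpace 𝒯 r) (hw : w ∈ feSpace 𝒯 r) :
    toL2 Ω (v + w) = toL2 Ω v + toL2 Ω w := by
  rw [← sub_eq_iff_eq_add, ← toL2_sub (hG.memLp (add_mem_feSpace hv hw)) (hG.memLp hw),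
    add_sub_cancel_right]

/-- Every class in `S` has a piecewise polynomial representative, so the defining integral
identities say precisely that the residual is orthogonal to `S`. -/
theorem toL2_eq_starProjection (hG : IsDiscreteGradient Ω 𝒯 r β C h S S₀ G)
    [S.HasOrthogonalProjection] {u p : EuclideanSpace ℝ (Fin d) → ℝ}
    (hu : MemLp u 2 (volume.restrict Ω)) (hp : IsL2Projection Ω 𝒯 r u p) :
    toL2 Ω p = S.starProjection (toL2 Ω u) := by
  symm
  refine Submodule.eq_starProjection_of_mem_of_inner_eq_zero (hG.toL2_mem hp.1) fun s hs => ?_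
  obtain ⟨w, hw, hws⟩ := hG.exists_rep s hs
  rw [inner_sub_left, inner_eq_integral_mul (ae_eq_toL2 hu) hws,
    inner_eq_integral_mul (ae_eq_toL2 (hG.memLp hp.1)) hws, hp.2 w hw, sub_self]

end IsDiscreteGradient

theorem gradEnergy_eq_integral {Z : Lp (EuclideanSpace ℝ (Fin d)) 2 (volume.restrict Ω)}
    {w : EuclideanSpace ℝ (Fin d) → ℝ} (hβ : 0 < β)
    (hw : gradient w =ᵐ[volume.restrict Ω] Z) :
    gradEnergy Ω β w = ∫ x in Ω, ‖Z x‖ ^ β := by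
  have hm : AEStronglyMeasurable (gradient w) (volume.restrict Ω) :=
    (Lp.aestronglyMeasurable Z).congr hw.symm
  have h0 : 0 ≤ ∫ x in Ω, ‖gradient w x‖ ^ β :=
    integral_nonneg fun x => Real.rpow_nonneg (norm_nonneg _) _
  rw [gradEnergy, lpNorm_eq_integral_norm_rpow_toReal (by simpa using hβ) (by simp) hm,
    ENNReal.toReal_ofReal hβ.le, ← Real.rpow_mul h0, inv_mul_cancel₀ hβ.ne', Real.rpow_one]
  refine integral_congr_ae ?_
  filter_upwards [hw] with x hx
  rw [hx]

/-- Semidiscrete solutions satisfy the energy inequalities, uniformly in the mesh and the data. -/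
theorem exists_energySystem_of_solution (hd : 1 ≤ d) (hN : 1 ≤ N) (P : GenPoly N)
    (hdβ : 0 ≤ P.β * (1 + (d : ℝ) / 2) - d) (hΩo : IsOpen Ω) (hΩ : Bornology.IsBounded Ω)
    (r : ℕ) {σ : ℝ} (hσ : 0 < σ) :
    ∃ (C₁ C₂ : ℝ) (Cη : ℝ → ℝ), 0 < C₁ ∧ 0 < C₂ ∧ (∀ η, 0 < η → 0 < Cη η) ∧
      ∀ (h : ℝ) (𝒯 : Finset (Set (EuclideanSpace ℝ (Fin d)))), IsQuasiUniformMesh Ω σ h 𝒯 →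
      ∀ (f φ φt : ℝ → EuclideanSpace ℝ (Fin d) → ℝ) (ρ0 : EuclideanSpace ℝ (Fin d) → ℝ),
      IsData Ω f φ φt ρ0 → ∀ πφ ρt : ℝ → EuclideanSpace ℝ (Fin d) → ℝ,
      IsSemidiscreteSolution P Ω 𝒯 r f φ φt ρ0 πφ ρt →
      ∃ y y' H H' D E : ℝ → ℝ, EnergySystem P.β C₁ Cη y y' H H' D E
          (fun t => h1Norm Ω (φ t) ^ 2) (fun t => l2Norm Ω (ftilde f φt t))
          (fun t => h1Norm Ω (φt t) ^ 2) ∧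
        (∀ t, 0 ≤ t → gradEnergy Ω P.β (ρt t + πφ t) = E t) ∧
        H 0 + y 0 ≤ C₂ * (h1Norm Ω ρ0 ^ 2 + l2Norm Ω (φ 0) ^ 2) := by
  have hβ1 := P.one_lt_beta hN
  obtain ⟨C, hC, hmesh⟩ :=
    exists_isDiscreteGradient hd hΩo hΩ r hσ hβ1 (P.beta_lt_two hN).le hdβ
  obtain ⟨C₁, Cη, hC₁, hCη, hflow⟩ := exists_energySystem_of_flow P hN hC hΩ
  refine ⟨C₁, C₁ * C ^ 4 + 2, Cη, hC₁, by positivity, hCη, ?_⟩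
  intro h 𝒯 hm f φ φt ρ0 hdata πφ ρt hsol
  obtain ⟨S, S₀, G, hG⟩ := hmesh h 𝒯 hm
  have := hG.finite
  have hh := hm.h_pos hd hΩ
  choose! v hvW hv heqn using hsol.eqn
  have hρ : ∀ t, 0 ≤ t → MemLp (ρt t) 2 (volume.restrict Ω) := fun t ht =>
    hG.memLp (hsol.mem t ht)
  have hφ : ∀ t, 0 ≤ t → MemLp (φ t) 2 (volume.restrict Ω) := fun t ht => (hdata.φ_mem t ht).1
  have hφt : ∀ t, 0 ≤ t → MemLp (φt t) 2 (volume.restrict Ω) := fun t ht =>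
    (hdata.φt_mem t ht).1
  have hf : ∀ t, 0 ≤ t → MemLp (ftilde f φt t) 2 (volume.restrict Ω) := fun t ht =>
    (hdata.f_mem t ht).sub (hφt t ht)
  -- Bounded and independent of time, so differentiability of `φ` passes to the discrete gradient of
  -- `πφ`, whose derivative is the one built from `φ_t`.
  let A : Lp ℝ 2 (volume.restrict Ω) →L[ℝ]
      Lp (EuclideanSpace ℝ (Fin d)) 2 (volume.restrict Ω) := G ∘L S.starProjection
  have hgrad : ∀ t, 0 ≤ t → gradient (ρt t + πφ t) =ᵐ[volume.restrict Ω]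
      (G (toL2 Ω (ρt t)) + A (toL2 Ω (φ t)) :
        Lp (EuclideanSpace ℝ (Fin d)) 2 (volume.restrict Ω)) := fun t ht => by
    have h1 := hG.gradient_ae (add_mem_feSpace (hsol.mem t ht) (hsol.proj t ht).1)
    rwa [hG.toL2_add (hsol.mem t ht) (hsol.proj t ht).1, map_add,
      hG.toL2_eq_starProjection (hφ t ht) (hsol.proj t ht)] at h1
  have hΦ : ∀ t, 0 ≤ t → HasDerivWithinAt (fun s => toL2 Ω (φ s)) (toL2 Ω (φt t)) (Ici 0) t :=
    fun t ht => (hdata.φ_deriv t ht).hasDerivWithinAt ht hφ (hφt t ht)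
  obtain ⟨y, y', H, H', D, hE, hy0, hH0⟩ := hflow h 𝒯 r S S₀ G hG (fun t => toL2 Ω (ρt t))
    (fun t => toL2 Ω (v t)) (fun t => toL2 Ω (ftilde f φt t)) (fun t => A (toL2 Ω (φ t)))
    (fun t => A (toL2 Ω (φt t))) (fun t => h1Norm Ω (φ t) ^ 2) (fun t => h1Norm Ω (φt t) ^ 2)
    (fun t ht => hG.toL2_mem (hsol.mem t ht)) (fun t ht => hG.toL2_mem (hvW t ht))
    (fun t ht => ((hv t ht).hasDerivWithinAt ht.le hρ (hG.memLp (hvW t ht))).hasDerivAt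
      (Ici_mem_nhds ht))
    (fun t ht => A.hasFDerivAt.comp_hasDerivAt t ((hΦ t ht.le).hasDerivAt (Ici_mem_nhds ht)))
    (continuousWithinAt_toL2 hρ hsol.cont_zero)
    (A.continuous.continuousAt.comp_continuousWithinAt (hΦ 0 le_rfl).continuousWithinAt)
    (fun t ht => hG.norm_map_starProjection_le hC hh (hdata.φ_mem t ht) (ae_eq_toL2 (hφ t ht)))
    (fun t ht => hG.norm_map_starProjection_le hC hh (hdata.φt_mem t ht)
      (ae_eq_toL2 (hφt t ht)))
    (fun t ht s hs => by
      obtain ⟨w, hw, hws⟩ := hG.exists_rep s hs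
      have h1 := heqn t ht w hw
      have h2 := hG.gradient_ae hw
      rw [toL2_eq hws] at h2
      rw [inner_eq_integral_mul (ae_eq_toL2 (hG.memLp (hvW t ht))) hws,
        inner_eq_integral_mul (ae_eq_toL2 (hf t ht.le)) hws, ← h1, P.inner_fluxLp]
      congr 1
      refine integral_congr_ae ?_
      filter_upwards [hgrad t ht.le, h2] with x h3 h4
      rw [h3, h4, GenPoly.flux, real_inner_smul_left])
  refine ⟨y, y', H, H', D, _, ?_, fun t ht =>
    gradEnergy_eq_integral (by linarith) (hgrad t ht), ?_⟩
  -- The two source norms are identified only for `t ≥ 0`, where the data are known to be square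
  -- integrable; hence only the fields involving `q` are rewritten.
  · have hq : ∀ t, 0 ≤ t → ‖toL2 Ω (ftilde f φt t)‖ = l2Norm Ω (ftilde f φt t) := fun t ht =>
      (l2Norm_eq (hf t ht)).symm
    exact { hE with
      q_nonneg := fun t ht => by rw [← hq t ht]; exact hE.q_nonneg t ht
      y_le := fun t ht => by rw [← hq t ht.le]; exact hE.y_le t ht
      H_le := fun t ht => by rw [← hq t ht.le]; exact hE.H_le t ht }
  · have hρ0 := hdata.ρ0_mem.1
    have h1 := hG.toL2_eq_starProjection (hρ0.sub (hφ 0 le_rfl)) hsol.init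
    have h2 : ‖toL2 Ω (ρt 0)‖ ≤ l2Norm Ω ρ0 + l2Norm Ω (φ 0) := by
      rw [h1, l2Norm_eq hρ0, l2Norm_eq (hφ 0 le_rfl)]
      refine (S.norm_starProjection_apply_le _).trans ?_
      rw [toL2_sub hρ0 (hφ 0 le_rfl)]
      exact norm_sub_le _ _
    have h3 : ‖toL2 Ω (ρt 0)‖ ^ 2 ≤ 2 * h1Norm Ω ρ0 ^ 2 + 2 * l2Norm Ω (φ 0) ^ 2 := by
      have h4 := l2Norm_sq_le_h1Norm_sq Ω ρ0
      have h5 := pow_le_pow_left₀ (norm_nonneg _) h2 2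
      have h6 := sq_nonneg (l2Norm Ω ρ0 - l2Norm Ω (φ 0))
      linarith
    -- At time zero the boundary data cancel from `ρ_h`, which is why the initial potential energy
    -- needs only the `H¹` norm of `ρ⁰`, while `φ⁰` enters through its `L²` norm alone.
    have h4 : G (toL2 Ω (ρt 0)) + A (toL2 Ω (φ 0)) = G (S.starProjection (toL2 Ω ρ0)) := by
      rw [h1, toL2_sub hρ0 (hφ 0 le_rfl), map_sub, map_sub]
      exact sub_add_cancel _ _
    have h5 := hG.norm_map_starProjection_le hC hh hdata.ρ0_mem (ae_eq_toL2 hρ0)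
    rw [h4] at hH0
    have h6 := hH0.trans (mul_le_mul_of_nonneg_left h5 hC₁.le)
    have h7 : 0 ≤ C₁ * C ^ 4 * l2Norm Ω (φ 0) ^ 2 := by positivity
    have h8 := hy0.trans h3
    linarith

end Solution

end Forchheimer

end

/-! ### Limits superior in `[0, ∞]` and the conclusion -/

noncomputable section

namespace Forchheimer

theorem eventually_le_of_limsupInfty_ne_top {u : ℝ → ℝ} (h : limsupInfty u ≠ ⊤) :
    ∀ᶠ t in atTop, u t ≤ (limsupInfty u).toReal + 1 := by
  have h1 : limsupInfty u < ENNReal.ofReal ((limsupInfty u).toReal + 1) := by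
    rw [ENNReal.lt_ofReal_iff_toReal_lt h]
    linarith
  filter_upwards [eventually_lt_of_limsup_lt h1] with t ht
  exact (ENNReal.ofReal_le_ofReal_iff (by positivity)).1 ht.le

theorem tendsto_zero_of_limsupInfty {u : ℝ → ℝ} (hu : ∀ t, 0 ≤ u t) (h : limsupInfty u = 0) :
    Tendsto u atTop (𝓝 0) := by
  rw [tendsto_order]
  refine ⟨fun b hb => Eventually.of_forall fun t => hb.trans_le (hu t), fun b hb => ?_⟩
  have h1 : limsupInfty u < ENNReal.ofReal b := by rw [h]; simpa using hb
  filter_upwards [eventually_lt_of_limsup_lt h1] with t ht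
  exact (ENNReal.ofReal_lt_ofReal_iff hb).1 ht

theorem limsupInfty_eq_zero {u : ℝ → ℝ} (h : Tendsto u atTop (𝓝 0)) : limsupInfty u = 0 := by
  simpa [limsupInfty] using (ENNReal.tendsto_ofReal h).limsup_eq

theorem limsupInfty_le {u : ℝ → ℝ} {b : ℝ} (h : ∀ᶠ t in atTop, u t ≤ b) :
    limsupInfty u ≤ ENNReal.ofReal b :=
  limsup_le_of_le (by isBoundedDefault) (h.mono fun _ ht => ENNReal.ofReal_le_ofReal ht)

theorem ofReal_mul_one_add_add_rpow {C p : ℝ} (hC : 0 ≤ C) (hp : 0 ≤ p) {m l : ENNReal}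
    (hm : m ≠ ⊤) (hl : l ≠ ⊤) :
    ENNReal.ofReal (C * (1 + m.toReal + l.toReal ^ p)) = ENNReal.ofReal C * (1 + m + l ^ p) := by
  rw [ENNReal.ofReal_mul hC, ENNReal.ofReal_add (by positivity) (by positivity),
    ENNReal.ofReal_add zero_le_one ENNReal.toReal_nonneg, ENNReal.ofReal_toReal hm,
    ← ENNReal.ofReal_rpow_of_nonneg ENNReal.toReal_nonneg hp, ENNReal.ofReal_toReal hl,
    ENNReal.ofReal_one]

theorem gData_nonneg {d N : ℕ} (P : GenPoly N) (Ω : Set (EuclideanSpace ℝ (Fin d)))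
    (f φ φt : ℝ → EuclideanSpace ℝ (Fin d) → ℝ) (t : ℝ) : 0 ≤ gData P Ω f φ φt t :=
  add_nonneg (Real.rpow_nonneg lpNorm_nonneg _) (sq_nonneg _)

/-- Multiplying by `d + 2` and inserting `β = 2 - a` turns the degree condition into nonnegativity
of the scaling exponent in the Poincaré–Sobolev inequality. -/
theorem GenPoly.le_beta_mul {N : ℕ} (P : GenPoly N) {d : ℕ} (hdeg : P.a ≤ 4 / ((d : ℝ) + 2)) :
    0 ≤ P.β * (1 + (d : ℝ) / 2) - d := by
  have h1 : (0 : ℝ) < (d : ℝ) + 2 := by positivity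
  rw [le_div_iff₀ h1] at hdeg
  rw [GenPoly.β]
  linarith

end Forchheimer

end

theorem theorem4p2 {d : ℕ} (hd : 2 ≤ d) {N : ℕ} (hN : 1 ≤ N) (P : Forchheimer.GenPoly N)
    (hdeg : P.a ≤ 4 / ((d : ℝ) + 2))
    (Ω : Set (EuclideanSpace ℝ (Fin d))) (hΩo : IsOpen Ω) (hΩb : Bornology.IsBounded Ω)
    (r : ℕ) (σ : ℝ) (hσ : 0 < σ) :
    ∃ C : ℝ, 0 < C ∧
      ∀ (h : ℝ) (𝒯 : Finset (Set (EuclideanSpace ℝ (Fin d)))),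
      Forchheimer.IsQuasiUniformMesh Ω σ h 𝒯 →
      ∀ (f φ φt : ℝ → EuclideanSpace ℝ (Fin d) → ℝ) (ρ0 : EuclideanSpace ℝ (Fin d) → ℝ),
      Forchheimer.IsData Ω f φ φt ρ0 →
      ∀ πφ ρt : ℝ → EuclideanSpace ℝ (Fin d) → ℝ,
      Forchheimer.IsSemidiscreteSolution P Ω 𝒯 r f φ φt ρ0 πφ ρt →
        (∀ F : ℝ → ℝ, Forchheimer.IsEnvelope (Forchheimer.gData P Ω f φ φt) F →
          ∀ t : ℝ, 0 ≤ t →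
            Forchheimer.gradEnergy Ω P.β (ρt t + πφ t) ≤ C * Forchheimer.bigA P Ω φ φt ρ0 F t) ∧
        Forchheimer.limsupInfty (fun t => Forchheimer.gradEnergy Ω P.β (ρt t + πφ t)) ≤
          ENNReal.ofReal C *
            (1 + Forchheimer.limsupInfty (fun t => Forchheimer.h1Norm Ω (φt t) ^ 2) +
              Forchheimer.limsupInfty (Forchheimer.gData P Ω f φ φt) ^ (2 / P.β)) ∧
        (Forchheimer.limsupInfty
              (fun t => Forchheimer.l2Norm Ω (Forchheimer.ftilde f φt t)) = 0 →
          Forchheimer.limsupInfty (fun t => Forchheimer.h1Norm Ω (φ t)) = 0 →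
          Forchheimer.limsupInfty (fun t => Forchheimer.h1Norm Ω (φt t)) = 0 →
          Forchheimer.limsupInfty (fun t =>
            lpNorm (gradient (ρt t + πφ t)) (ENNReal.ofReal P.β) (volume.restrict Ω)) = 0) := by
  have hβ1 := P.one_lt_beta hN
  have hβ2 := P.beta_lt_two hN
  have hβ0 : 0 < P.β := by linarith
  set p := 2 / P.β with hp
  have hp0 : 0 < p := by positivity
  obtain ⟨C₁, C₂, Cη, hC₁, hC₂, hCη, hsys⟩ := Forchheimer.exists_energySystem_of_solution
    (by omega) hN P (P.le_beta_mul hdeg) hΩo hΩb r hσ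
  obtain ⟨C, hC, hbound⟩ := Forchheimer.EnergySystem.exists_bound hβ1 hβ2 hC₁ (hCη 1 one_pos)
  -- `C₂` pays for the initial energies in (i); 2 and `2 ^ p` pay for enlarging the two limits
  -- superior by 1 in (ii).
  refine ⟨C * (2 + 2 ^ p + C₂), by positivity, ?_⟩
  intro h 𝒯 hm f φ φt ρ0 hdata πφ ρt hsol
  obtain ⟨y, y', H, H', D, E, hS, hE, hinit⟩ := hsys h 𝒯 hm f φ φt ρ0 hdata πφ ρt hsol
  obtain ⟨hb1, hb2⟩ := hbound Cη y y' H H' D E _ _ _ rfl hS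
  have hev : ∀ᶠ t in atTop, Forchheimer.gradEnergy Ω P.β (ρt t + πφ t) = E t :=
    (eventually_ge_atTop 0).mono hE
  refine ⟨fun F hF t ht => ?_, ?_, fun hf0 hφ0 hφt0 => ?_⟩
  · have h1 := hb1 F hF.cont hF.mono hF.le t ht (hdata.φt_int t ht)
    rw [hE t ht, Forchheimer.bigA]
    have h2 : 0 ≤ ∫ s in (0 : ℝ)..t, Real.exp (-(1 / 2) * (t - s)) *
        (Forchheimer.h1Norm Ω (φt s) ^ 2 + F s ^ (2 / P.β)) := by
      refine intervalIntegral.integral_nonneg ht fun s hs => ?_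
      have h3 : 0 ≤ F s := (Forchheimer.gData_nonneg P Ω f φ φt s).trans (hF.le s hs.1)
      positivity
    set I := ∫ s in (0 : ℝ)..t, Real.exp (-(1 / 2) * (t - s)) *
        (Forchheimer.h1Norm Ω (φt s) ^ 2 + F s ^ (2 / P.β))
    have h3 := sq_nonneg (Forchheimer.h1Norm Ω ρ0)
    have h4 := sq_nonneg (Forchheimer.l2Norm Ω (φ 0))
    set a := Forchheimer.h1Norm Ω ρ0 ^ 2
    set b := Forchheimer.l2Norm Ω (φ 0) ^ 2
    refine h1.trans ?_
    rw [mul_assoc]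
    refine mul_le_mul_of_nonneg_left ?_ hC.le
    have h5 : 0 ≤ (1 + 2 ^ p) * (1 + a + b + I) := by positivity
    have h6 : 0 ≤ C₂ * (1 + I) := by positivity
    linarith
  · set m := Forchheimer.limsupInfty fun t => Forchheimer.h1Norm Ω (φt t) ^ 2 with hmdef
    set l := Forchheimer.limsupInfty (Forchheimer.gData P Ω f φ φt) with hldef
    have hCpos : 0 < C * (2 + 2 ^ p + C₂) := by positivity
    rcases eq_or_ne m ⊤ with hmt | hmt
    · rw [hmt, add_top, top_add, ENNReal.mul_top (by simpa using hCpos)]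
      exact le_top
    rcases eq_or_ne l ⊤ with hlt | hlt
    · rw [hlt, ENNReal.top_rpow_of_pos hp0, add_top, ENNReal.mul_top (by simpa using hCpos)]
      exact le_top
    rw [← Forchheimer.ofReal_mul_one_add_add_rpow hCpos.le hp0.le hmt hlt]
    refine Forchheimer.limsupInfty_le ?_
    obtain ⟨-, -, h1⟩ := hb2 (l.toReal + 1) (m.toReal + 1) (by positivity) (by positivity)
      (Forchheimer.eventually_le_of_limsupInfty_ne_top hlt)
      (Forchheimer.eventually_le_of_limsupInfty_ne_top hmt)
    filter_upwards [h1, hev] with t h2 h3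
    rw [h3]
    refine h2.trans ?_
    rw [mul_assoc]
    refine mul_le_mul_of_nonneg_left ?_ hC.le
    have hl0 : 0 ≤ l.toReal := ENNReal.toReal_nonneg
    have hm0 : 0 ≤ m.toReal := ENNReal.toReal_nonneg
    have h4 := Forchheimer.one_add_rpow_le hl0 hp0.le
    rw [add_comm] at h4
    have h5 : 0 ≤ l.toReal ^ p := by positivity
    have h6 : 0 ≤ (2 : ℝ) ^ p * m.toReal := by positivity
    have h7 : 0 ≤ C₂ * (1 + m.toReal + l.toReal ^ p) := by positivity
    linarith
  · have hq := Forchheimer.tendsto_zero_of_limsupInfty (fun _ => lpNorm_nonneg) hf0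
    have hψ := (Forchheimer.tendsto_zero_of_limsupInfty (fun _ => Real.sqrt_nonneg _) hφ0).pow 2
    have hχ := (Forchheimer.tendsto_zero_of_limsupInfty (fun _ => Real.sqrt_nonneg _) hφt0).pow 2
    rw [zero_pow two_ne_zero] at hψ hχ
    have hlam : 0 < P.β / (P.β - 1) := div_pos hβ0 (by linarith)
    have hg := (hq.rpow_const (Or.inr hlam.le)).add hψ
    rw [Real.zero_rpow hlam.ne', add_zero] at hg
    -- Vanishing data are eventually below 1, which gives the bound on the oscillating part required
    -- for the decay argument.
    obtain ⟨Y, hY, -⟩ := hb2 1 1 zero_le_one zero_le_one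
      (hg.eventually_le_const one_pos) (hχ.eventually_le_const one_pos)
    have hEt : Tendsto (fun t => Forchheimer.gradEnergy Ω P.β (ρt t + πφ t)) atTop (𝓝 0) := by
      rw [tendsto_order]
      refine ⟨fun b hb => Eventually.of_forall fun t =>
        hb.trans_le (Real.rpow_nonneg lpNorm_nonneg _), fun b hb => ?_⟩
      filter_upwards [hS.eventually_E_le hβ1 hCη hY hq hψ hχ (half_pos hb), hev] with t h1 h2
      linarith
    refine Forchheimer.limsupInfty_eq_zero ?_
    have h1 := hEt.rpow_const (p := P.β⁻¹) (Or.inr (by positivity))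
    rw [Real.zero_rpow (by positivity)] at h1
    refine h1.congr fun t => ?_
    exact Real.rpow_rpow_inv lpNorm_nonneg hβ0.ne'
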